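/- Let $k$ be a commutative ring; all rings and algebras are unital associative $k$-algebras, $R^o$ is the opposite algebra of $R$ and $\otimes=\otimes_k$. **Takeuchi products.** For algebras $R,S$, an *algebra over $R^o\otimes S$* is an algebra $M$ with an algebra map $R^o\otimes S\to M$, that is, with algebra maps $t:R^o\to M$ and $s:S\to M$ whose images commute. We write $M^S$ and $M^{R^o}$ for $M$ as a right $S$-module via $s$ and as a right $R^o$-module via $t$. If $M$ is an algebra over $R^o\otimes S$ and $N$ an algebra over $S^o\otimes T$, let $M\otimes_S N$ be the quotient of $M\otimes N$ by the relations $m\,s(y)\otimes n=m\otimes n\,t(y)$ $(y\in S)$, and let $$M\times_S N=\Big\{\sum m_i\otimes n_i\in M\otimes_S N:\ \sum s(y)m_i\otimes n_i=\sum m_i\otimes t(y)n_i\ \text{ for all } y\in S\Big\},$$ which is an algebra over $R^o\otimes T$ under componentwise multiplication. The multiple products $M\times_S N\times_T L$, etc., are defined in the same way inside $M\otimes_S N\otimes_T L$, with one family of relations and one family of conditions for each of the middle algebras. **Bialgebroids.** A *bialgebroid* ($\times_R$-bialgebra) $(A,R)$ consists of an algebra $R$, an algebra $A$ over $R^o\otimes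 R$ and maps of algebras over $R^o\otimes R$ $$\Delta:A\to A\times_R A,\qquad \varepsilon:A\to \mathrm{End}_k(R),$$ where $\mathrm{End}_k(R)$ acts on $R$ from the right, $s(x)$ acting on $R$ by $r\mapsto rx$ and $t(x)$ by $r\mapsto xr$, such that $(\Delta\otimes 1)\Delta=(1\otimes\Delta)\Delta$ as maps to $A\otimes_RA\otimes_RA$ and such that, with $e(a)=1\cdot\varepsilon(a)\in R$, one has $\sum a_2\,t(e(a_1))=a=\sum a_1\,s(e(a_2))$ whenever $\Delta(a)=\sum a_1\otimes a_2$. **Comodule algebras.** A *comodule algebra* from $(A,R)$ to $(B,S)$ is an algebra $M$ over $R^o\otimes S$ with a map $\alpha:M\to A\times_R M\times_S B$ of algebras over $R^o\otimes S$ such that $(1\otimes\alpha\otimes1)\alpha=(\Delta\otimes1\otimes\Delta)\alpha$ as maps to $A\otimes_RA\otimes_RM\otimes_SB\otimes_SB$, and such that $m=\sum m'\,s(e(b))\,t(e(a))$ whenever $\alpha(m)=\sum a\otimes m'\otimes b$. Its left and right coactions are $\lambda_M:M\to A\otimes_RM$, $m\mapsto\sum a\otimes m'\,s(e(b))$, and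 $\rho_M:M\to M\otimes_SB$, $m\mapsto\sum m'\,t(e(a))\otimes b$. A *map* $f:M\to M'$ of comodule algebras is a map of algebras over $R^o\otimes S$ with $\alpha_{M'}f=(1\otimes f\otimes1)\alpha_M$. For comodule algebras $M$ from $(A,R)$ to $(B,S)$ and $N$ from $(B,S)$ to $(C,T)$ let $M\bullet N\subseteq M\times_SN$ be the equalizer of the two maps $M\times_SN\rightrightarrows M\otimes_SB\otimes_SN$ given by $\rho_M\otimes1$ and $1\otimes\lambda_N$. **Hypotheses.** A ring is *hereditary* if submodules of projective left modules, and of projective right modules, are projective. A module is a *union of projectives* if it is the union of a directed family of projective submodules. **Theorem.** The bialgebroids $(A,R)$ with $R$ hereditary and $A^R$ and $A^{R^o}$ unions of projectives, the comodule algebras $M$ from $(A,R)$ to $(B,S)$ with $M^S$ and $M^{R^o}$ unions of projectives, and the maps of comodule algebras form a bicategory with composition $\bullet$. More precisely, there is a bicategory with these objects, 1-cells and 2-cells, with the usual composition of maps as vertical composition, in which: 1. the composite of $M$ and $N$ is the algebra $M\bullet N$ over $R^o\otimes T$, with the coaction $\alpha:M\bullet N\to A\times_R(M\bullet N)\times_TC$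 that is determined by $\alpha(p)=\sum\lambda_M(m)\otimes\rho_N(n)$ in $A\otimes_RM\otimes_SN\otimes_TC$ for $p=\sum m\otimes n$; 2. the horizontal composite of maps $f:M\to M'$ and $g:N\to N'$ is induced by $f\otimes g$; 3. the identity of $(A,R)$ is $A$ with coaction $(\Delta\otimes1)\Delta$; 4. the associativity isomorphisms $(M\bullet N)\bullet L\cong M\bullet(N\bullet L)$ are induced by the identity of $M\otimes_SN\otimes_TL$; 5. the unit isomorphisms $M\cong A\bullet M$ and $M\cong M\bullet B$ are given by $\lambda_M$ and $\rho_M$. -/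

import Mathlib

open scoped TensorProduct
open CategoryTheory MulOpposite

/-! ### Bicategory structures with prescribed hom-categories -/

/-- A bicategory structure with objects `Ob` and prescribed hom-categories `H a b`: the data and
the laws of a bicategory, without the choice of 1-cells and 2-cells. -/
structure BicategoryOn (Ob : Type*) (H : Ob → Ob → Type*) [∀ a b, Category (H a b)] where
  id : ∀ a, H a a
  comp : ∀ {a b c}, H a b → H b c → H a c
  whiskerLeft : ∀ {a b c} (f : H a b) {g h : H b c}, (g ⟶ h) → (comp f g ⟶ comp f h)
  whiskerRight : ∀ {a b c} {f g : H a b}, (f ⟶ g) → ∀ h : H b c, comp f h ⟶ comp g h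
  associator : ∀ {a b c d} (f : H a b) (g : H b c) (h : H c d),
    comp (comp f g) h ≅ comp f (comp g h)
  leftUnitor : ∀ {a b} (f : H a b), comp (id a) f ≅ f
  rightUnitor : ∀ {a b} (f : H a b), comp f (id b) ≅ f
  whiskerLeft_id : ∀ {a b c} (f : H a b) (g : H b c), whiskerLeft f (𝟙 g) = 𝟙 (comp f g)
  whiskerLeft_comp : ∀ {a b c} (f : H a b) {g h i : H b c} (η : g ⟶ h) (θ : h ⟶ i),
    whiskerLeft f (η ≫ θ) = whiskerLeft f η ≫ whiskerLeft f θ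
  id_whiskerLeft : ∀ {a b} {f g : H a b} (η : f ⟶ g),
    whiskerLeft (id a) η = (leftUnitor f).hom ≫ η ≫ (leftUnitor g).inv
  comp_whiskerLeft : ∀ {a b c d} (f : H a b) (g : H b c) {h h' : H c d} (η : h ⟶ h'),
    whiskerLeft (comp f g) η =
      (associator f g h).hom ≫ whiskerLeft f (whiskerLeft g η) ≫ (associator f g h').inv
  id_whiskerRight : ∀ {a b c} (f : H a b) (g : H b c), whiskerRight (𝟙 f) g = 𝟙 (comp f g)
  comp_whiskerRight : ∀ {a b c} {f g h : H a b} (η : f ⟶ g) (θ : g ⟶ h) (i : H b c),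
    whiskerRight (η ≫ θ) i = whiskerRight η i ≫ whiskerRight θ i
  whiskerRight_id : ∀ {a b} {f g : H a b} (η : f ⟶ g),
    whiskerRight η (id b) = (rightUnitor f).hom ≫ η ≫ (rightUnitor g).inv
  whiskerRight_comp : ∀ {a b c d} {f f' : H a b} (η : f ⟶ f') (g : H b c) (h : H c d),
    whiskerRight η (comp g h) =
      (associator f g h).inv ≫ whiskerRight (whiskerRight η g) h ≫ (associator f' g h).hom
  whisker_assoc : ∀ {a b c d} (f : H a b) {g g' : H b c} (η : g ⟶ g') (h : H c d),
    whiskerRight (whiskerLeft f η) h =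
      (associator f g h).hom ≫ whiskerLeft f (whiskerRight η h) ≫ (associator f g' h).inv
  whisker_exchange : ∀ {a b c} {f g : H a b} {h i : H b c} (η : f ⟶ g) (θ : h ⟶ i),
    whiskerLeft f θ ≫ whiskerRight η i = whiskerRight η h ≫ whiskerLeft g θ
  pentagon : ∀ {a b c d e} (f : H a b) (g : H b c) (h : H c d) (i : H d e),
    whiskerRight (associator f g h).hom i ≫
        (associator f (comp g h) i).hom ≫ whiskerLeft f (associator g h i).hom =
      (associator (comp f g) h i).hom ≫ (associator f g (comp h i)).hom
  triangle : ∀ {a b c} (f : H a b) (g : H b c),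
    (associator f (id b) g).hom ≫ whiskerLeft f (leftUnitor g).hom =
      whiskerRight (rightUnitor f).hom g

/-- A `BicategoryOn` is exactly a Mathlib `Bicategory` whose 1-cells and 2-cells are the
prescribed ones. -/
@[reducible] def BicategoryOn.toBicategory {Ob : Type*} {H : Ob → Ob → Type*}
    [∀ a b, Category (H a b)] (S : BicategoryOn Ob H) : Bicategory Ob where
  Hom := H
  id := S.id
  comp := S.comp
  homCategory := fun a b => inferInstanceAs (Category (H a b))
  whiskerLeft := S.whiskerLeft
  whiskerRight := S.whiskerRight
  associator := S.associator
  leftUnitor := S.leftUnitor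
  rightUnitor := S.rightUnitor
  whiskerLeft_id := S.whiskerLeft_id
  whiskerLeft_comp := S.whiskerLeft_comp
  id_whiskerLeft := S.id_whiskerLeft
  comp_whiskerLeft := S.comp_whiskerLeft
  id_whiskerRight := S.id_whiskerRight
  comp_whiskerRight := S.comp_whiskerRight
  whiskerRight_id := S.whiskerRight_id
  whiskerRight_comp := S.whiskerRight_comp
  whisker_assoc := S.whisker_assoc
  whisker_exchange := S.whisker_exchange
  pentagon := S.pentagon
  triangle := S.triangle

universe u v

namespace Takeuchi

/-! ### Algebras over `Rᵒ ⊗ S` and balanced tensor products -/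

/-- A `k`-algebra with an algebra map from `Rᵒ ⊗ S`, i.e. a monoid in the monoidal category of
`Rᵒ ⊗ S`-bimodules. -/
structure EnvAlg (k : Type u) [CommRing k] (R S : Type v) [Ring R] [Algebra k R] [Ring S]
    [Algebra k S] where
  carrier : Type v
  [ring : Ring carrier]
  [algebra : Algebra k carrier]
  η : Rᵐᵒᵖ ⊗[k] S →ₐ[k] carrier

attribute [instance] EnvAlg.ring EnvAlg.algebra

instance {k : Type u} [CommRing k] {R S : Type v} [Ring R] [Algebra k R] [Ring S]
    [Algebra k S] : CoeSort (EnvAlg k R S) (Type v) := ⟨EnvAlg.carrier⟩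

/-- A `k`-algebra with an algebra map `τ` from `Rᵒ` and a set of elements `rel`. The elements of
`rel` generate a left ideal, to be divided out. -/
structure RelAlg (k : Type u) [CommRing k] (R : Type v) [Ring R] [Algebra k R] where
  carrier : Type v
  [ring : Ring carrier]
  [algebra : Algebra k carrier]
  τ : Rᵐᵒᵖ →ₐ[k] carrier
  rel : Set carrier

attribute [instance] RelAlg.ring RelAlg.algebra

instance {k : Type u} [CommRing k] {R : Type v} [Ring R] [Algebra k R] :
    CoeSort (RelAlg k R) (Type v) := ⟨RelAlg.carrier⟩

section General

variable {k : Type u} [CommRing k]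
variable {R R₁ R₂ S : Type v} [Ring R] [Algebra k R] [Ring R₁] [Algebra k R₁] [Ring R₂]
  [Algebra k R₂] [Ring S] [Algebra k S]

/-- The map `Rᵒ → X`. Right multiplication by its values is the left `R`-action on `X`. -/
def EnvAlg.t (X : EnvAlg k R S) : Rᵐᵒᵖ →ₐ[k] X :=
  X.η.comp Algebra.TensorProduct.includeLeft

/-- The map `S → X`. Right multiplication by its values is the right `S`-action on `X`. -/
def EnvAlg.s (X : EnvAlg k R S) : S →ₐ[k] X :=
  X.η.comp Algebra.TensorProduct.includeRight

theorem EnvAlg.s_mul_t (X : EnvAlg k R S) (x : S) (y : Rᵐᵒᵖ) :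
    X.s x * X.t y = X.t y * X.s x := by
  simp [EnvAlg.s, EnvAlg.t, ← map_mul]

/-- A single factor, without relations. -/
@[reducible] def EnvAlg.last (X : EnvAlg k R S) : RelAlg k R where
  carrier := X
  τ := X.t
  rel := ∅

/-- The tensor product `X ⊗ P` over `k`, with the relations `s x ⊗ 1 - 1 ⊗ τ x` for `x ∈ S` and
`1 ⊗ b` for the relations `b` of `P`. The left ideal that they generate is spanned by the
differences `m (s x) ⊗ p - m ⊗ p (τ x)` and by the elements `m ⊗ p b`. -/
def cons (X : EnvAlg k R S) (P : RelAlg k S) : RelAlg k R where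
  carrier := X ⊗[k] P
  τ := Algebra.TensorProduct.includeLeft.comp X.t
  rel := Set.range (fun x : S => X.s x ⊗ₜ[k] (1 : P) - (1 : X) ⊗ₜ[k] P.τ (op x)) ∪
    (fun b : P => (1 : X) ⊗ₜ[k] b) '' P.rel

infixr:70 " ⊠ " => cons

/-- The quotient of `P` by the left ideal generated by the relations. For
`P = X₁ ⊠ ⋯ ⊠ Xₙ.last` this is the tensor product of the `Xᵢ` balanced over the
intermediate rings. -/
abbrev Quo (P : RelAlg k R) : Type v := P ⧸ Ideal.span P.rel

/-- The class of an element, as a `k`-linear map. -/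
def cls (P : RelAlg k R) : P →ₗ[k] Quo P :=
  (Submodule.mkQ (Ideal.span P.rel)).restrictScalars k

theorem cls_eq_zero {P : RelAlg k R} {w : P} : cls P w = 0 ↔ w ∈ Ideal.span P.rel :=
  Submodule.Quotient.mk_eq_zero _

theorem mul_mem_span {P : RelAlg k R} {w : P} (hw : ∀ b ∈ P.rel, b * w ∈ Ideal.span P.rel)
    {j : P} (hj : j ∈ Ideal.span P.rel) : j * w ∈ Ideal.span P.rel := by
  induction hj using Submodule.span_induction with
  | mem x hx => exact hw x hx
  | zero => simp
  | add x y _ _ hx hy => rw [add_mul]; exact add_mem hx hy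
  | smul a x _ hx => rw [smul_eq_mul, mul_assoc]; exact Ideal.mul_mem_left _ _ hx

/-- The elements `w` with `b w ≡ 0` modulo the left ideal generated by the relations, for every
relation `b`. For `b = s x ⊗ 1 - 1 ⊗ t x` and `w = ∑ mᵢ ⊗ nᵢ` this is Takeuchi's condition
`∑ (s x) mᵢ ⊗ nᵢ = ∑ mᵢ ⊗ (t x) nᵢ`. -/
def takSub (P : RelAlg k R) : Subalgebra k P where
  carrier := {w | ∀ b ∈ P.rel, b * w ∈ Ideal.span P.rel}
  mul_mem' := by
    intro x y hx hy b hb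
    rw [← mul_assoc]
    exact mul_mem_span hy (hx b hb)
  add_mem' := by
    intro x y hx hy b hb
    rw [mul_add]
    exact add_mem (hx b hb) (hy b hb)
  algebraMap_mem' := by
    intro r b hb
    rw [← Algebra.commutes]
    exact Ideal.mul_mem_left _ _ (Ideal.subset_span hb)

/-- The left ideal generated by the relations, inside `takSub P`. -/
def takIdeal (P : RelAlg k R) : Ideal (takSub P) :=
  (Ideal.span P.rel).comap (takSub P).val

instance takIdeal_isTwoSided (P : RelAlg k R) : (takIdeal P).IsTwoSided where
  mul_mem_of_left := by
    intro a b ha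
    exact mul_mem_span b.2 ha

/-- The Takeuchi product: the classes in `Quo P` that satisfy Takeuchi's condition. It is a
`k`-algebra under the multiplication induced by that of `P`. `Tak (X ⊠ Y.last)` is `X ×_S Y` and
`Tak (X ⊠ Y ⊠ Z.last)` is the threefold product. -/
abbrev Tak (P : RelAlg k R) : Type v := takSub P ⧸ takIdeal P

/-- The inclusion of the Takeuchi product in the balanced tensor product. -/
def val (P : RelAlg k R) : Tak P →ₗ[k] Quo P :=
  Submodule.liftQ ((takIdeal P).restrictScalars k)
    ((cls P).comp (takSub P).val.toLinearMap) (by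
      intro w hw
      exact cls_eq_zero.2 hw)

theorem val_mk {P : RelAlg k R} (w : takSub P) :
    val P (Ideal.Quotient.mk (takIdeal P) w) = cls P w.1 := rfl

theorem val_injective {P : RelAlg k R} : Function.Injective (val P) := by
  rw [← LinearMap.ker_eq_bot, LinearMap.ker_eq_bot']
  intro p hp
  obtain ⟨w, rfl⟩ := Ideal.Quotient.mk_surjective p
  rw [val_mk, cls_eq_zero] at hp
  exact Ideal.Quotient.eq_zero_iff_mem.2 hp

/-- A map of algebras to a Takeuchi product, as a linear map to the balanced tensor product. -/
def toQuo {M : Type v} [Ring M] [Algebra k M] {P : RelAlg k R} (f : M →ₐ[k] Tak P) :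
    M →ₗ[k] Quo P :=
  (val P).comp f.toLinearMap

theorem map_mem_span {P : RelAlg k R} {P₁ : RelAlg k R₁} (f : P₁ →ₐ[k] P)
    (hf : ∀ b ∈ P₁.rel, f b ∈ Ideal.span P.rel) {w : P₁} (hw : w ∈ Ideal.span P₁.rel) :
    f w ∈ Ideal.span P.rel := by
  have h : Ideal.span P₁.rel ≤ (Ideal.span P.rel).comap f := Ideal.span_le.2 hf
  exact h hw

/-- The map on the quotient induced by a linear map that vanishes on the left ideal. -/
def Quo.lift {P : RelAlg k R} {V : Type v} [AddCommGroup V] [Module k V] (g : P →ₗ[k] V)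
    (h : ∀ w ∈ Ideal.span P.rel, g w = 0) : Quo P →ₗ[k] V :=
  Submodule.liftQ ((Ideal.span P.rel).restrictScalars k) g (fun w hw => h w hw)

theorem Quo.lift_cls {P : RelAlg k R} {V : Type v} [AddCommGroup V] [Module k V]
    (g : P →ₗ[k] V) (h : ∀ w ∈ Ideal.span P.rel, g w = 0) (w : P) :
    Quo.lift g h (cls P w) = g w := rfl

theorem cls_surjective (P : RelAlg k R) : Function.Surjective (cls P) :=
  Submodule.Quotient.mk_surjective _

/-- The map of quotients induced by an algebra map that respects the relations. -/
def Quo.map {P : RelAlg k R} {P₁ : RelAlg k R₁} (f : P₁ →ₐ[k] P)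
    (hf : ∀ b ∈ P₁.rel, f b ∈ Ideal.span P.rel) : Quo P₁ →ₗ[k] Quo P :=
  Quo.lift ((cls P).comp f.toLinearMap) (fun _ hw => cls_eq_zero.2 (map_mem_span f hf hw))

theorem Quo.map_cls {P : RelAlg k R} {P₁ : RelAlg k R₁} (f : P₁ →ₐ[k] P)
    (hf : ∀ b ∈ P₁.rel, f b ∈ Ideal.span P.rel) (w : P₁) :
    Quo.map f hf (cls P₁ w) = cls P (f w) := rfl

/-- For algebra maps `f₁`, `f₂` with commuting images, the map that sends the classes of
`w₁` and `w₂` to the class of `f₁ w₁ * f₂ w₂`. -/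
def Quo.mul {P : RelAlg k R} {P₁ : RelAlg k R₁} {P₂ : RelAlg k R₂} (f₁ : P₁ →ₐ[k] P)
    (f₂ : P₂ →ₐ[k] P) (h₁ : ∀ b ∈ P₁.rel, f₁ b ∈ Ideal.span P.rel)
    (h₂ : ∀ b ∈ P₂.rel, f₂ b ∈ Ideal.span P.rel) (hc : ∀ x y, f₁ x * f₂ y = f₂ y * f₁ x) :
    Quo P₁ →ₗ[k] Quo P₂ →ₗ[k] Quo P :=
  Quo.lift
    (((Algebra.lsmul k k (Quo P)).toLinearMap.comp f₁.toLinearMap).compl₂ (Quo.map f₂ h₂)) (by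
      intro w hw
      refine LinearMap.ext fun q => ?_
      obtain ⟨y, rfl⟩ := cls_surjective _ q
      change cls P (f₁ w * f₂ y) = 0
      rw [hc, cls_eq_zero]
      exact Ideal.mul_mem_left _ _ (map_mem_span f₁ h₁ hw))

theorem Quo.mul_cls {P : RelAlg k R} {P₁ : RelAlg k R₁} {P₂ : RelAlg k R₂} (f₁ : P₁ →ₐ[k] P)
    (f₂ : P₂ →ₐ[k] P) (h₁ : ∀ b ∈ P₁.rel, f₁ b ∈ Ideal.span P.rel)
    (h₂ : ∀ b ∈ P₂.rel, f₂ b ∈ Ideal.span P.rel) (hc : ∀ x y, f₁ x * f₂ y = f₂ y * f₁ x)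
    (w₁ : P₁) (w₂ : P₂) :
    Quo.mul f₁ f₂ h₁ h₂ hc (cls P₁ w₁) (cls P₂ w₂) = cls P (f₁ w₁ * f₂ w₂) := rfl

/-- The pure tensor `x ⊗ p`. -/
def tm {X : EnvAlg k R S} {P : RelAlg k S} (x : X) (p : P) : (X ⊠ P).carrier := x ⊗ₜ[k] p

theorem tm_mul_tm {X : EnvAlg k R S} {P : RelAlg k S} (x x' : X) (p p' : P) :
    tm x p * tm x' p' = tm (x * x') (p * p') :=
  Algebra.TensorProduct.tmul_mul_tmul x x' p p'

theorem one_def {X : EnvAlg k R S} {P : RelAlg k S} : (1 : (X ⊠ P).carrier) = tm 1 1 := rfl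

theorem tm_add {X : EnvAlg k R S} {P : RelAlg k S} (x : X) (p p' : P) :
    tm x (p + p') = tm x p + tm x p' := TensorProduct.tmul_add x p p'

theorem add_tm {X : EnvAlg k R S} {P : RelAlg k S} (x x' : X) (p : P) :
    tm (x + x') p = tm x p + tm x' p := TensorProduct.add_tmul x x' p

theorem tm_zero {X : EnvAlg k R S} {P : RelAlg k S} (x : X) :
    (tm x 0 : (X ⊠ P).carrier) = 0 := TensorProduct.tmul_zero _ x

theorem tm_sub {X : EnvAlg k R S} {P : RelAlg k S} (x : X) (p p' : P) :
    tm x (p - p') = tm x p - tm x p' := TensorProduct.tmul_sub x p p'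

theorem sub_tm {X : EnvAlg k R S} {P : RelAlg k S} (x x' : X) (p : P) :
    tm (x - x') p = tm x p - tm x' p := TensorProduct.sub_tmul x x' p

theorem tm_induction {X : EnvAlg k R S} {P : RelAlg k S} {C : (X ⊠ P).carrier → Prop}
    (h0 : C 0) (h1 : ∀ x p, C (tm x p)) (h2 : ∀ a b, C a → C b → C (a + b)) (w) : C w :=
  TensorProduct.induction_on (motive := C) w h0 h1 h2

/-- The linear map on `X ⊗ P` given by a bilinear map. -/
def lift {X : EnvAlg k R S} {P : RelAlg k S} {V : Type v} [AddCommGroup V] [Module k V]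
    (f : X →ₗ[k] P →ₗ[k] V) : (X ⊠ P).carrier →ₗ[k] V :=
  TensorProduct.lift f

theorem lift_tm {X : EnvAlg k R S} {P : RelAlg k S} {V : Type v} [AddCommGroup V] [Module k V]
    (f : X →ₗ[k] P →ₗ[k] V) (x : X) (p : P) : lift f (tm x p) = f x p := rfl

/-- The linear map `x ⊗ p ↦ f x • g p`. -/
def actL {X : EnvAlg k R S} {P : RelAlg k S} {P' : RelAlg k R₁} (f : X →ₐ[k] P')
    (g : P →ₗ[k] Quo P') : (X ⊠ P).carrier →ₗ[k] Quo P' :=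
  lift (((Algebra.lsmul k k (Quo P')).toLinearMap.comp f.toLinearMap).compl₂ g)

theorem actL_tm {X : EnvAlg k R S} {P : RelAlg k S} {P' : RelAlg k R₁} (f : X →ₐ[k] P')
    (g : P →ₗ[k] Quo P') (x : X) (p : P) : actL f g (tm x p) = f x • g p := rfl

/-- The linear map `x ⊗ p ↦ f p • g x`. -/
def actR {X : EnvAlg k R S} {P : RelAlg k S} {P' : RelAlg k R₁} (f : P →ₐ[k] P')
    (g : X →ₗ[k] Quo P') : (X ⊠ P).carrier →ₗ[k] Quo P' :=
  lift (((Algebra.lsmul k k (Quo P')).toLinearMap.comp f.toLinearMap).compl₂ g).flip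

theorem actR_tm {X : EnvAlg k R S} {P : RelAlg k S} {P' : RelAlg k R₁} (f : P →ₐ[k] P')
    (g : X →ₗ[k] Quo P') (x : X) (p : P) : actR f g (tm x p) = f p • g x := rfl

/-- `x ↦ x ⊗ 1`. -/
def inl (X : EnvAlg k R S) (P : RelAlg k S) : X →ₐ[k] (X ⊠ P).carrier :=
  Algebra.TensorProduct.includeLeft

/-- `p ↦ 1 ⊗ p`. -/
def inr (X : EnvAlg k R S) (P : RelAlg k S) : P →ₐ[k] (X ⊠ P).carrier :=
  Algebra.TensorProduct.includeRight

theorem inl_apply (X : EnvAlg k R S) (P : RelAlg k S) (x : X) : inl X P x = tm x 1 := rfl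

theorem inr_apply (X : EnvAlg k R S) (P : RelAlg k S) (p : P) : inr X P p = tm 1 p := rfl

theorem mem_rel {X : EnvAlg k R S} {P : RelAlg k S} {b : (X ⊠ P).carrier} :
    b ∈ (X ⊠ P).rel ↔ (∃ x, b = inl X P (X.s x) - inr X P (P.τ (op x))) ∨
      ∃ b' ∈ P.rel, b = inr X P b' := by
  constructor
  · rintro (⟨x, rfl⟩ | ⟨b', h, rfl⟩)
    · exact Or.inl ⟨x, rfl⟩
    · exact Or.inr ⟨b', h, rfl⟩
  · rintro (⟨x, rfl⟩ | ⟨b', h, rfl⟩)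
    · exact Or.inl ⟨x, rfl⟩
    · exact Or.inr ⟨b', h, rfl⟩

theorem tm_induction₃ {T : Type v} [Ring T] [Algebra k T] {X : EnvAlg k R S} {Y : EnvAlg k S T}
    {P : RelAlg k T} {C : (X ⊠ Y ⊠ P).carrier → Prop} (h0 : C 0)
    (h1 : ∀ x y p, C (tm x (tm y p))) (h2 : ∀ a b, C a → C b → C (a + b)) (w) : C w := by
  induction w using tm_induction with
  | h0 => exact h0
  | h1 x p =>
    induction p using tm_induction with
    | h0 => exact (tm_zero x) ▸ h0
    | h1 y p => exact h1 x y p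
    | h2 _ _ hp hq => rw [tm_add]; exact h2 _ _ hp hq
  | h2 a b ha hb => exact h2 _ _ ha hb

theorem inr_mem (X : EnvAlg k R S) (P : RelAlg k S) :
    ∀ b ∈ P.rel, inr X P b ∈ Ideal.span (X ⊠ P).rel :=
  fun b hb => Ideal.subset_span (Or.inr ⟨b, hb, rfl⟩)

/-- `x ⊗ p ↦ f x ⊗ ψ p`. -/
def bimap {X X' : EnvAlg k R S} {P P' : RelAlg k S} (f : X →ₐ[k] X') (ψ : P →ₐ[k] P') :
    (X ⊠ P).carrier →ₐ[k] (X' ⊠ P').carrier :=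
  Algebra.TensorProduct.map f ψ

theorem bimap_tm {X X' : EnvAlg k R S} {P P' : RelAlg k S} (f : X →ₐ[k] X')
    (ψ : P →ₐ[k] P') (x : X) (p : P) : bimap f ψ (tm x p) = tm (f x) (ψ p) := rfl

/-- `x ⊗ p ↦ x ⊗ ψ p`. -/
abbrev ext (X : EnvAlg k R S) {P P' : RelAlg k S} (ψ : P →ₐ[k] P') :
    (X ⊠ P).carrier →ₐ[k] (X ⊠ P').carrier :=
  bimap (AlgHom.id k X) ψ

theorem ext_mem (X : EnvAlg k R S) {P P' : RelAlg k S} (ψ : P →ₐ[k] P')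
    (hτ : ∀ x, ψ (P.τ x) = P'.τ x) (hψ : ∀ b ∈ P.rel, ψ b ∈ Ideal.span P'.rel) :
    ∀ b ∈ (X ⊠ P).rel, ext X ψ b ∈ Ideal.span (X ⊠ P').rel := by
  rintro _ (⟨x, rfl⟩ | ⟨b, hb, rfl⟩)
  · refine Ideal.subset_span (Or.inl ⟨x, ?_⟩)
    change _ = Algebra.TensorProduct.map (AlgHom.id k X) ψ _
    simp [hτ]
  · have h := map_mem_span (inr X P') (inr_mem X P') (hψ b hb)
    have h2 : ext X ψ ((1 : X) ⊗ₜ[k] b) = inr X P' (ψ b) := by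
      change Algebra.TensorProduct.map (AlgHom.id k X) ψ _ = _
      rw [Algebra.TensorProduct.map_tmul, map_one]
      rfl
    exact h2 ▸ h

end General

/-! ### Insertions

The name of an insertion lists the positions that it fills, and the number of factors of the
target. -/

section Insert

variable {k : Type u} [CommRing k]
variable {R₀ R₁ R₂ R₃ R₄ R₅ : Type v} [Ring R₀] [Algebra k R₀] [Ring R₁] [Algebra k R₁]
  [Ring R₂] [Algebra k R₂] [Ring R₃] [Algebra k R₃] [Ring R₄] [Algebra k R₄]
  [Ring R₅] [Algebra k R₅]

/-- `x ⊗ y ↦ x ⊗ y ⊗ 1`. -/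
def put12 (X : EnvAlg k R₀ R₁) (Y : EnvAlg k R₁ R₂) (P : RelAlg k R₂) :
    (X ⊠ Y.last).carrier →ₐ[k] (X ⊠ Y ⊠ P).carrier :=
  ext X (P := Y.last) (P' := Y ⊠ P) (inl Y P)

theorem put12_mem (X : EnvAlg k R₀ R₁) (Y : EnvAlg k R₁ R₂) (P : RelAlg k R₂) :
    ∀ b ∈ (X ⊠ Y.last).rel, put12 X Y P b ∈ Ideal.span (X ⊠ Y ⊠ P).rel :=
  ext_mem X (P := Y.last) (P' := Y ⊠ P) (inl Y P) (fun _ => rfl) (fun _ hb => hb.elim)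

theorem put12_comm (X : EnvAlg k R₀ R₁) (Y : EnvAlg k R₁ R₂) (P : RelAlg k R₂)
    (w : (X ⊠ Y.last).carrier) (p : P) :
    put12 X Y P w * inr X (Y ⊠ P) (inr Y P p) = inr X (Y ⊠ P) (inr Y P p) * put12 X Y P w := by
  induction w using tm_induction with
  | h0 => rw [map_zero, zero_mul, mul_zero]
  | h1 x y =>
    rw [put12, bimap_tm, inl_apply, inr_apply, inr_apply]
    simp only [tm_mul_tm, one_mul, mul_one]
  | h2 a b ha hb => rw [map_add, add_mul, mul_add, ha, hb]

/-- `x ⊗ y ⊗ z ↦ x ⊗ y ⊗ z ⊗ 1`. -/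
def put123 (X : EnvAlg k R₀ R₁) (Y : EnvAlg k R₁ R₂) (Z : EnvAlg k R₂ R₃) (P : RelAlg k R₃) :
    (X ⊠ Y ⊠ Z.last).carrier →ₐ[k] (X ⊠ Y ⊠ Z ⊠ P).carrier :=
  ext X (put12 Y Z P)

theorem put123_mem (X : EnvAlg k R₀ R₁) (Y : EnvAlg k R₁ R₂) (Z : EnvAlg k R₂ R₃)
    (P : RelAlg k R₃) :
    ∀ b ∈ (X ⊠ Y ⊠ Z.last).rel, put123 X Y Z P b ∈ Ideal.span (X ⊠ Y ⊠ Z ⊠ P).rel :=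
  ext_mem X _ (fun _ => rfl) (put12_mem Y Z P)

/-- `x ⊗ y ↦ x ⊗ y ⊗ 1`. -/
def ins12of3 (X : EnvAlg k R₀ R₁) (Y : EnvAlg k R₁ R₂) (Z : EnvAlg k R₂ R₃) :
    Quo (X ⊠ Y.last) →ₗ[k] Quo (X ⊠ Y ⊠ Z.last) :=
  Quo.map (put12 X Y Z.last) (put12_mem X Y Z.last)

/-- `y ⊗ z ↦ 1 ⊗ y ⊗ z`. -/
def ins23of3 (X : EnvAlg k R₀ R₁) (Y : EnvAlg k R₁ R₂) (Z : EnvAlg k R₂ R₃) :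
    Quo (Y ⊠ Z.last) →ₗ[k] Quo (X ⊠ Y ⊠ Z.last) :=
  Quo.map (inr X (Y ⊠ Z.last)) (inr_mem X (Y ⊠ Z.last))

/-- `y ⊗ z ↦ 1 ⊗ y ⊗ z ⊗ 1`. -/
def ins23of4 (X : EnvAlg k R₀ R₁) (Y : EnvAlg k R₁ R₂) (Z : EnvAlg k R₂ R₃)
    (U : EnvAlg k R₃ R₄) : Quo (Y ⊠ Z.last) →ₗ[k] Quo (X ⊠ Y ⊠ Z ⊠ U.last) :=
  (Quo.map (inr X (Y ⊠ Z ⊠ U.last)) (inr_mem X _)).comp (ins12of3 Y Z U)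

/-- `y ⊗ z ⊗ u ↦ 1 ⊗ y ⊗ z ⊗ u ⊗ 1`. -/
def ins234of5 (X : EnvAlg k R₀ R₁) (Y : EnvAlg k R₁ R₂) (Z : EnvAlg k R₂ R₃)
    (U : EnvAlg k R₃ R₄) (V : EnvAlg k R₄ R₅) :
    Quo (Y ⊠ Z ⊠ U.last) →ₗ[k] Quo (X ⊠ Y ⊠ Z ⊠ U ⊠ V.last) :=
  (Quo.map (inr X (Y ⊠ Z ⊠ U ⊠ V.last)) (inr_mem X _)).comp
    (Quo.map (put123 Y Z U V.last) (put123_mem Y Z U V.last))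

/-- `(x ⊗ y, z ⊗ u) ↦ x ⊗ y ⊗ z ⊗ u`. -/
def glue4 (X : EnvAlg k R₀ R₁) (Y : EnvAlg k R₁ R₂) (Z : EnvAlg k R₂ R₃)
    (U : EnvAlg k R₃ R₄) :
    Quo (X ⊠ Y.last) →ₗ[k] Quo (Z ⊠ U.last) →ₗ[k] Quo (X ⊠ Y ⊠ Z ⊠ U.last) :=
  Quo.mul (put12 X Y (Z ⊠ U.last)) ((inr X (Y ⊠ Z ⊠ U.last)).comp (inr Y (Z ⊠ U.last)))
    (put12_mem X Y _)
    (fun b hb => map_mem_span (inr X _) (inr_mem X _) (inr_mem Y _ b hb))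
    (fun w p => put12_comm X Y _ w p)

/-- `(x ⊗ y, u ⊗ v) ↦ x ⊗ y ⊗ 1 ⊗ u ⊗ v`. -/
def glue5 (X : EnvAlg k R₀ R₁) (Y : EnvAlg k R₁ R₂) (Z : EnvAlg k R₂ R₃)
    (U : EnvAlg k R₃ R₄) (V : EnvAlg k R₄ R₅) :
    Quo (X ⊠ Y.last) →ₗ[k] Quo (U ⊠ V.last) →ₗ[k] Quo (X ⊠ Y ⊠ Z ⊠ U ⊠ V.last) :=
  Quo.mul (put12 X Y (Z ⊠ U ⊠ V.last))
    ((inr X (Y ⊠ Z ⊠ U ⊠ V.last)).comp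
      ((inr Y (Z ⊠ U ⊠ V.last)).comp (inr Z (U ⊠ V.last))))
    (put12_mem X Y _)
    (fun b hb => map_mem_span (inr X _) (inr_mem X _)
      (map_mem_span (inr Y _) (inr_mem Y _) (inr_mem Z _ b hb)))
    (fun w p => put12_comm X Y _ w (inr Z (U ⊠ V.last) p))

/-- `x ⊗ y ↦ x ⊗ f y`, for a linear map `f` to `X₂ ⊗ X₃`. -/
def lext (X : EnvAlg k R₀ R₁) (Y : EnvAlg k R₁ R₃) (X₂ : EnvAlg k R₁ R₂)
    (X₃ : EnvAlg k R₂ R₃) (f : Y →ₗ[k] Quo (X₂ ⊠ X₃.last)) :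
    (X ⊠ Y.last).carrier →ₗ[k] Quo (X ⊠ X₂ ⊠ X₃.last) :=
  actL (inl X (X₂ ⊠ X₃.last)) ((ins23of3 X X₂ X₃).comp f)

/-- `x ⊗ y ↦ f x ⊗ y`, for a linear map `f` to `X₁ ⊗ X₂`. -/
def rext (X : EnvAlg k R₀ R₂) (Y : EnvAlg k R₂ R₃) (X₁ : EnvAlg k R₀ R₁) (X₂ : EnvAlg k R₁ R₂)
    (f : X →ₗ[k] Quo (X₁ ⊠ X₂.last)) :
    (X ⊠ Y.last).carrier →ₗ[k] Quo (X₁ ⊠ X₂ ⊠ Y.last) :=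
  actR (P := Y.last) ((inr X₁ (X₂ ⊠ Y.last)).comp (inr X₂ Y.last)) ((ins12of3 X₁ X₂ Y).comp f)

end Insert

/-! ### Bialgebroids and comodule algebras -/

/-- The data of a bialgebroid. -/
structure PreBialgebroid (k : Type u) [CommRing k] (R : Type v) [Ring R] [Algebra k R] extends
    EnvAlg k R R where
  /-- The comultiplication. -/
  Δ : carrier →ₐ[k] Tak (toEnvAlg ⊠ toEnvAlg.last)
  /-- The counit, an action of the algebra on `R` from the right. -/
  ε : carrier →ₐ[k] (Module.End k R)ᵐᵒᵖ

section Comod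

variable {k : Type u} [CommRing k]
variable {R S T : Type v} [Ring R] [Algebra k R] [Ring S] [Algebra k S] [Ring T] [Algebra k T]

/-- The comultiplication, as a map to the balanced tensor product. -/
def PreBialgebroid.δ (A : PreBialgebroid k R) :
    A.carrier →ₗ[k] Quo (A.toEnvAlg ⊠ A.last) :=
  toQuo A.Δ

/-- `a ↦ ε(a)(1)`. -/
def PreBialgebroid.e (A : PreBialgebroid k R) : A.carrier →ₗ[k] R :=
  (LinearMap.applyₗ (1 : R)).comp ((opLinearEquiv k).symm.toLinearMap.comp A.ε.toLinearMap)

theorem PreBialgebroid.e_apply (A : PreBialgebroid k R) (a : A.carrier) :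
    A.e a = unop (A.ε a) 1 := rfl

/-- `a ⊗ m ↦ m t(ε(a)(1))`. -/
def PreBialgebroid.collapseL (A : PreBialgebroid k R) (M : EnvAlg k R S) :
    (A.toEnvAlg ⊠ M.last).carrier →ₗ[k] M :=
  lift (P := M.last) ((LinearMap.mul k M).flip.comp
    (M.t.toLinearMap.comp ((opLinearEquiv k).toLinearMap.comp A.e)))

/-- `m ⊗ a ↦ m s(ε(a)(1))`. -/
def PreBialgebroid.collapseR (A : PreBialgebroid k S) (M : EnvAlg k R S) :
    (M ⊠ A.last).carrier →ₗ[k] M :=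
  lift (P := A.last) ((LinearMap.mul k M).compl₂ (M.s.toLinearMap.comp A.e))

theorem PreBialgebroid.collapseL_tm (A : PreBialgebroid k R) (M : EnvAlg k R S)
    (a : A.carrier) (m : M) :
    A.collapseL M (tm (P := M.last) a m) = m * M.t (op (A.e a)) := rfl

theorem PreBialgebroid.collapseR_tm (A : PreBialgebroid k S) (M : EnvAlg k R S) (m : M)
    (a : A.carrier) : A.collapseR M (tm (P := A.last) m a) = m * M.s (A.e a) := rfl

/-- `a ⊗ m ⊗ b ↦ a ⊗ m s(ε(b)(1))`. -/
def PreBialgebroid.collapse₃ (B : PreBialgebroid k S) (A : EnvAlg k R R) (M : EnvAlg k R S) :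
    (A ⊠ M ⊠ B.last).carrier →ₗ[k] (A ⊠ M.last).carrier :=
  LinearMap.lTensor A (B.collapseR M)

/-- `a ⊗ m ⊗ b ↦ m t(ε(a)(1)) ⊗ b`. -/
def PreBialgebroid.collapse₁ (A : PreBialgebroid k R) (M : EnvAlg k R S) (B : EnvAlg k S S) :
    (A.toEnvAlg ⊠ M ⊠ B.last).carrier →ₗ[k] (M ⊠ B.last).carrier :=
  (LinearMap.rTensor B (A.collapseL M)).comp
    (TensorProduct.assoc k A.carrier M B).symm.toLinearMap

theorem PreBialgebroid.collapse₃_tm (B : PreBialgebroid k S) (A : EnvAlg k R R)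
    (M : EnvAlg k R S) (a : A) (m : M) (b : B.carrier) :
    B.collapse₃ A M (tm a (tm (P := B.last) m b)) = tm (P := M.last) a (m * M.s (B.e b)) := rfl

theorem PreBialgebroid.collapse₁_tm (A : PreBialgebroid k R) (M : EnvAlg k R S)
    (B : EnvAlg k S S) (a : A.carrier) (m : M) (b : B) :
    A.collapse₁ M B (tm a (tm (P := B.last) m b)) =
      tm (P := B.last) (m * M.t (op (A.e a))) b := rfl

end Comod

/-- A bialgebroid (`×_R`-bialgebra) over `R`: an algebra `A` over `Rᵒ ⊗ R` with maps of algebras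
over `Rᵒ ⊗ R` from `A` to `A ×_R A` and to the algebra of `k`-linear endomorphisms of `R`, which
are coassociative and counital. The endomorphisms act on the right, so that their algebra is the
opposite of `Module.End k R`, and `R` (resp. `Rᵒ`) acts by right (resp. left) multiplication.
In `coassoc` both sides depend only on the class of `w`. -/
structure Bialgebroid (k : Type u) [CommRing k] (R : Type v) [Ring R] [Algebra k R] extends
    PreBialgebroid k R where
  Δ_t : ∀ x, toPreBialgebroid.δ (toEnvAlg.t x) =
    cls (toEnvAlg ⊠ toEnvAlg.last) (tm (P := toEnvAlg.last) (toEnvAlg.t x) 1)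
  Δ_s : ∀ x, toPreBialgebroid.δ (toEnvAlg.s x) =
    cls (toEnvAlg ⊠ toEnvAlg.last) (tm (P := toEnvAlg.last) 1 (toEnvAlg.s x))
  ε_t : ∀ x r : R, unop (ε (toEnvAlg.t (op x))) r = x * r
  ε_s : ∀ x r : R, unop (ε (toEnvAlg.s x)) r = r * x
  coassoc : ∀ (a : carrier) (w : (toEnvAlg ⊠ toEnvAlg.last).carrier),
    cls (toEnvAlg ⊠ toEnvAlg.last) w = toPreBialgebroid.δ a →
      lext toEnvAlg toEnvAlg toEnvAlg toEnvAlg toPreBialgebroid.δ w =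
        rext toEnvAlg toEnvAlg toEnvAlg toEnvAlg toPreBialgebroid.δ w
  counit_left : ∀ (a : carrier) (w : (toEnvAlg ⊠ toEnvAlg.last).carrier),
    cls (toEnvAlg ⊠ toEnvAlg.last) w = toPreBialgebroid.δ a →
      toPreBialgebroid.collapseL toEnvAlg w = a
  counit_right : ∀ (a : carrier) (w : (toEnvAlg ⊠ toEnvAlg.last).carrier),
    cls (toEnvAlg ⊠ toEnvAlg.last) w = toPreBialgebroid.δ a →
      toPreBialgebroid.collapseR toEnvAlg w = a

section Comod

variable {k : Type u} [CommRing k]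
variable {R S T : Type v} [Ring R] [Algebra k R] [Ring S] [Algebra k S] [Ring T] [Algebra k T]

theorem Bialgebroid.e_mul_t (A : Bialgebroid k R) (a : A.carrier) (x : R) :
    A.e (a * A.t (op x)) = x * A.e a := by
  rw [PreBialgebroid.e_apply, map_mul, unop_mul, Module.End.mul_apply, A.ε_t,
    PreBialgebroid.e_apply]

theorem Bialgebroid.e_mul_s (A : Bialgebroid k R) (a : A.carrier) (x : R) :
    A.e (a * A.s x) = A.e a * x := by
  rw [PreBialgebroid.e_apply, map_mul, unop_mul, Module.End.mul_apply, A.ε_s,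
    PreBialgebroid.e_apply]

/-- `a ⊗ n ⊗ b ↦ a ⊗ f n ⊗ b`, for a linear map `f` to `A ⊗ M ⊗ B`. -/
def mext (A : EnvAlg k R R) (M : EnvAlg k R S) (B : EnvAlg k S S)
    (f : M →ₗ[k] Quo (A ⊠ M ⊠ B.last)) :
    (A ⊠ M ⊠ B.last).carrier →ₗ[k] Quo (A ⊠ A ⊠ M ⊠ B ⊠ B.last) :=
  actL (inl A (A ⊠ M ⊠ B ⊠ B.last))
    (actR (P := B.last) ((inr A (A ⊠ M ⊠ B ⊠ B.last)).comp ((inr A (M ⊠ B ⊠ B.last)).comp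
        ((inr M (B ⊠ B.last)).comp (inr B B.last))))
      ((ins234of5 A A M B B).comp f))

/-- `a ⊗ m ⊗ b ↦ Δ a ⊗ m ⊗ Δ b`. -/
def dext (A : Bialgebroid k R) (M : EnvAlg k R S) (B : Bialgebroid k S) :
    (A.toEnvAlg ⊠ M ⊠ B.last).carrier →ₗ[k]
      Quo (A.toEnvAlg ⊠ A.toEnvAlg ⊠ M ⊠ B.toEnvAlg ⊠ B.last) :=
  TensorProduct.lift
    (((Algebra.lsmul k k
        (Quo (A.toEnvAlg ⊠ A.toEnvAlg ⊠ M ⊠ B.toEnvAlg ⊠ B.last))).toLinearMap.comp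
      ((inr A.toEnvAlg (A.toEnvAlg ⊠ M ⊠ B.toEnvAlg ⊠ B.last)).comp
        ((inr A.toEnvAlg (M ⊠ B.toEnvAlg ⊠ B.last)).comp
          (inl M (B.toEnvAlg ⊠ B.last)))).toLinearMap).compl₂
      (TensorProduct.lift
        ((glue5 A.toEnvAlg A.toEnvAlg M B.toEnvAlg B.toEnvAlg).compl₁₂ A.δ B.δ))) ∘ₗ
    (TensorProduct.leftComm k A.carrier M B.carrier).toLinearMap

theorem dext_tm (A : Bialgebroid k R) (M : EnvAlg k R S) (B : Bialgebroid k S) (a : A.carrier)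
    (m : M) (b : B.carrier) :
    dext A M B (tm a (tm (P := B.last) m b)) =
      inr A.toEnvAlg (A.toEnvAlg ⊠ M ⊠ B.toEnvAlg ⊠ B.last)
        (inr A.toEnvAlg (M ⊠ B.toEnvAlg ⊠ B.last) (inl M (B.toEnvAlg ⊠ B.last) m)) •
        glue5 A.toEnvAlg A.toEnvAlg M B.toEnvAlg B.toEnvAlg (A.δ a) (B.δ b) := rfl

end Comod

/-- The data of a comodule algebra. -/
structure PreComodAlg {k : Type u} [CommRing k] {R S : Type v} [Ring R] [Algebra k R] [Ring S]
    [Algebra k S] (A : Bialgebroid k R) (B : Bialgebroid k S) extends EnvAlg k R S where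
  /-- The coaction. -/
  α : carrier →ₐ[k] Tak (A.toEnvAlg ⊠ toEnvAlg ⊠ B.last)

/-- The coaction, as a map to the balanced tensor product. -/
def PreComodAlg.coact {k : Type u} [CommRing k] {R S : Type v} [Ring R] [Algebra k R] [Ring S]
    [Algebra k S] {A : Bialgebroid k R} {B : Bialgebroid k S} (M : PreComodAlg A B) :
    M.carrier →ₗ[k] Quo (A.toEnvAlg ⊠ M.toEnvAlg ⊠ B.last) :=
  toQuo M.α

/-- A comodule algebra from `(A, R)` to `(B, S)`: an algebra `M` over `Rᵒ ⊗ S` with a map `α` of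
algebras over `Rᵒ ⊗ S` from `M` to `A ×_R M ×_S B` that is coassociative, i.e.
`(1 ⊗ α ⊗ 1) α = (Δ ⊗ 1 ⊗ Δ) α`, and counital. In `coassoc` both sides depend only on the class
of `w`. -/
structure ComodAlg {k : Type u} [CommRing k] {R S : Type v} [Ring R] [Algebra k R] [Ring S]
    [Algebra k S] (A : Bialgebroid k R) (B : Bialgebroid k S) extends PreComodAlg A B where
  α_t : ∀ x, toPreComodAlg.coact (toEnvAlg.t x) =
    cls (A.toEnvAlg ⊠ toEnvAlg ⊠ B.last) (tm (A.t x) 1)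
  α_s : ∀ x, toPreComodAlg.coact (toEnvAlg.s x) =
    cls (A.toEnvAlg ⊠ toEnvAlg ⊠ B.last) (tm 1 (tm (P := B.last) 1 (B.s x)))
  coassoc : ∀ (m : carrier) (w : (A.toEnvAlg ⊠ toEnvAlg ⊠ B.last).carrier),
    cls _ w = toPreComodAlg.coact m →
      mext A.toEnvAlg toEnvAlg B.toEnvAlg toPreComodAlg.coact w = dext A toEnvAlg B w
  counit : ∀ (m : carrier) (w : (A.toEnvAlg ⊠ toEnvAlg ⊠ B.last).carrier),
    cls _ w = toPreComodAlg.coact m →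
      A.collapseL toEnvAlg (B.collapse₃ A.toEnvAlg toEnvAlg w) = m

section Bullet

variable {k : Type u} [CommRing k]
variable {R S T : Type v} [Ring R] [Algebra k R] [Ring S] [Algebra k S] [Ring T] [Algebra k T]

theorem smul_span_induction {P : RelAlg k R} {V : Type v} [AddCommGroup V] [Module k V]
    (g : P →ₗ[k] V) (h : ∀ b ∈ P.rel, ∀ c, g (c * b) = 0) {w : P}
    (hw : w ∈ Ideal.span P.rel) : g w = 0 := by
  suffices H : ∀ c, g (c * w) = 0 by simpa using H 1
  induction hw using Submodule.span_induction with
  | mem x hx => exact h x hx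
  | zero => simp
  | add x y _ _ hx hy => intro c; rw [mul_add, map_add, hx, hy, add_zero]
  | smul a x _ hx => intro c; rw [smul_eq_mul, ← mul_assoc]; exact hx _

theorem balance {X : EnvAlg k R S} {P : RelAlg k S} (x : X) (p : P) (y : S) :
    cls (X ⊠ P) (tm (x * X.s y) p) = cls (X ⊠ P) (tm x (p * P.τ (op y))) := by
  rw [← sub_eq_zero, ← map_sub, cls_eq_zero]
  have h : tm (x * X.s y) p - tm x (p * P.τ (op y)) =
      tm x p * (inl X P (X.s y) - inr X P (P.τ (op y))) := by
    rw [mul_sub, inl_apply, inr_apply, tm_mul_tm, tm_mul_tm, mul_one, mul_one]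
  rw [h]
  exact Ideal.mul_mem_left _ _ (Ideal.subset_span (mem_rel.2 (Or.inl ⟨y, rfl⟩)))

theorem collapse₃_mem (B : Bialgebroid k S) (A : EnvAlg k R R) (M : EnvAlg k R S) :
    ∀ w ∈ Ideal.span (A ⊠ M ⊠ B.last).rel,
      ((cls (A ⊠ M.last)).comp (B.collapse₃ A M)) w = 0 := by
  intro w hw
  refine smul_span_induction _ ?_ hw
  intro b hb c
  induction c using tm_induction₃ with
  | h0 => rw [zero_mul, map_zero]
  | h2 c d hc hd => rw [add_mul, map_add, hc, hd, add_zero]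
  | h1 a m b' =>
    rw [mem_rel] at hb
    obtain ⟨x, rfl⟩ | ⟨b, hb, rfl⟩ := hb
    · have h : (M ⊠ B.last).τ (op x) = tm (M.t (op x)) 1 := rfl
      rw [mul_sub, map_sub, inl_apply, inr_apply, tm_mul_tm, tm_mul_tm, h, tm_mul_tm, mul_one,
        mul_one, mul_one, LinearMap.comp_apply, LinearMap.comp_apply,
        PreBialgebroid.collapse₃_tm, PreBialgebroid.collapse₃_tm, balance, sub_eq_zero,
        mul_assoc, mul_assoc, M.s_mul_t]
    · rw [mem_rel] at hb
      obtain ⟨y, rfl⟩ | ⟨_, hb, _⟩ := hb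
      · rw [inr_apply, tm_mul_tm, mul_sub, inl_apply, inr_apply, tm_mul_tm, tm_mul_tm, tm_sub,
          map_sub, LinearMap.comp_apply, LinearMap.comp_apply, mul_one, mul_one, mul_one,
          PreBialgebroid.collapse₃_tm, PreBialgebroid.collapse₃_tm, B.e_mul_t, map_mul,
          mul_assoc, sub_self]
      · exact hb.elim

theorem collapse₁_mem (A : Bialgebroid k R) (M : EnvAlg k R S) (B : EnvAlg k S S) :
    ∀ w ∈ Ideal.span (A.toEnvAlg ⊠ M ⊠ B.last).rel,
      ((cls (M ⊠ B.last)).comp (A.collapse₁ M B)) w = 0 := by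
  intro w hw
  refine smul_span_induction _ ?_ hw
  intro b hb c
  induction c using tm_induction₃ with
  | h0 => rw [zero_mul, map_zero]
  | h2 c d hc hd => rw [add_mul, map_add, hc, hd, add_zero]
  | h1 a m b' =>
    rw [mem_rel] at hb
    obtain ⟨x, rfl⟩ | ⟨b, hb, rfl⟩ := hb
    · have h : (M ⊠ B.last).τ (op x) = tm (M.t (op x)) 1 := rfl
      rw [mul_sub, map_sub, inl_apply, inr_apply, tm_mul_tm, tm_mul_tm, h, tm_mul_tm, mul_one,
        mul_one, mul_one, LinearMap.comp_apply, LinearMap.comp_apply,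
        PreBialgebroid.collapse₁_tm, PreBialgebroid.collapse₁_tm, A.e_mul_s, op_mul, map_mul,
        mul_assoc, sub_self]
    · rw [mem_rel] at hb
      obtain ⟨y, rfl⟩ | ⟨_, hb, _⟩ := hb
      · rw [inr_apply, tm_mul_tm, mul_sub, inl_apply, inr_apply, tm_mul_tm, tm_mul_tm, tm_sub,
          map_sub, LinearMap.comp_apply, LinearMap.comp_apply, mul_one, mul_one, mul_one,
          PreBialgebroid.collapse₁_tm, PreBialgebroid.collapse₁_tm, mul_assoc, M.s_mul_t,
          ← mul_assoc, balance, sub_self]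
      · exact hb.elim

variable {A : Bialgebroid k R} {B : Bialgebroid k S} {C : Bialgebroid k T}

/-- The left coaction `M → A ⊗ M`: the composite of `α` with the collapse of the right factor
along the counit. -/
def ComodAlg.coactL (M : ComodAlg A B) : M.carrier →ₗ[k] Quo (A.toEnvAlg ⊠ M.last) :=
  (Quo.lift (P := A.toEnvAlg ⊠ M.toEnvAlg ⊠ B.last)
    ((cls (A.toEnvAlg ⊠ M.last)).comp (B.collapse₃ A.toEnvAlg M.toEnvAlg))
    (collapse₃_mem B A.toEnvAlg M.toEnvAlg)).comp M.coact

/-- The right coaction `M → M ⊗ B`: the composite of `α` with the collapse of the left factor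
along the counit. -/
def ComodAlg.coactR (M : ComodAlg A B) : M.carrier →ₗ[k] Quo (M.toEnvAlg ⊠ B.last) :=
  (Quo.lift (P := A.toEnvAlg ⊠ M.toEnvAlg ⊠ B.last)
    ((cls (M.toEnvAlg ⊠ B.last)).comp (A.collapse₁ M.toEnvAlg B.toEnvAlg))
    (collapse₁_mem A M.toEnvAlg B.toEnvAlg)).comp M.coact

theorem ComodAlg.coactL_eq (M : ComodAlg A B) {m : M.carrier} {w}
    (hw : cls (A.toEnvAlg ⊠ M.toEnvAlg ⊠ B.last) w = M.coact m) :
    M.coactL m = cls (A.toEnvAlg ⊠ M.last) (B.collapse₃ A.toEnvAlg M.toEnvAlg w) := by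
  rw [coactL, LinearMap.comp_apply, ← hw, Quo.lift_cls, LinearMap.comp_apply]

theorem ComodAlg.coactR_eq (M : ComodAlg A B) {m : M.carrier} {w}
    (hw : cls (A.toEnvAlg ⊠ M.toEnvAlg ⊠ B.last) w = M.coact m) :
    M.coactR m = cls (M.toEnvAlg ⊠ B.last) (A.collapse₁ M.toEnvAlg B.toEnvAlg w) := by
  rw [coactR, LinearMap.comp_apply, ← hw, Quo.lift_cls, LinearMap.comp_apply]

/-- A map of comodule algebras: a map of algebras over `Rᵒ ⊗ S` that respects the coactions. -/
@[ext]
structure ComodAlgHom (M N : ComodAlg A B) where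
  toAlgHom : M.carrier →ₐ[k] N.carrier
  map_η : ∀ x, toAlgHom (M.η x) = N.η x
  map_α : ∀ (m : M.carrier) (w : (A.toEnvAlg ⊠ M.toEnvAlg ⊠ B.last).carrier),
    cls _ w = M.coact m →
      cls (A.toEnvAlg ⊠ N.toEnvAlg ⊠ B.last)
        (ext A.toEnvAlg (bimap (P := B.last) (P' := B.last) toAlgHom (AlgHom.id k B.carrier)) w) =
      N.coact (toAlgHom m)

theorem ext_bimap_id (A : EnvAlg k R R) (M : EnvAlg k R S) (B : EnvAlg k S S) (w) :
    ext A (bimap (P := B.last) (P' := B.last) (AlgHom.id k M) (AlgHom.id k B)) w = w := by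
  induction w using tm_induction₃ with
  | h0 => rw [map_zero]
  | h1 a m b => rfl
  | h2 a b ha hb => rw [map_add, ha, hb]

theorem ext_bimap_comp (A : EnvAlg k R R) {M N L : EnvAlg k R S} (B : EnvAlg k S S)
    (f : M →ₐ[k] N) (g : N →ₐ[k] L) (w) :
    ext A (bimap (P := B.last) (P' := B.last) (g.comp f) (AlgHom.id k B)) w =
      ext A (bimap (P := B.last) (P' := B.last) g (AlgHom.id k B))
        (ext A (bimap (P := B.last) (P' := B.last) f (AlgHom.id k B)) w) := by
  induction w using tm_induction₃ with
  | h0 => simp only [map_zero]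
  | h1 a m b => rfl
  | h2 a b ha hb => simp only [map_add, ha, hb]

/-- The identity map. -/
def ComodAlgHom.id (M : ComodAlg A B) : ComodAlgHom M M where
  toAlgHom := AlgHom.id k M.carrier
  map_η := fun _ => rfl
  map_α := by
    intro m w hw
    exact (congrArg _ (ext_bimap_id _ M.toEnvAlg _ w)).trans hw

/-- The composite of maps. -/
def ComodAlgHom.comp {M N L : ComodAlg A B} (f : ComodAlgHom M N) (g : ComodAlgHom N L) :
    ComodAlgHom M L where
  toAlgHom := g.toAlgHom.comp f.toAlgHom
  map_η := fun x => by rw [AlgHom.comp_apply, f.map_η, g.map_η]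
  map_α := by
    intro m w hw
    exact (congrArg _ (ext_bimap_comp _ _ f.toAlgHom g.toAlgHom w)).trans
      (g.map_α _ _ (f.map_α m w hw))

/-! ### The composite `M • N` -/

/-- `ι : P → M ×_S N` exhibits the comodule algebra `P` from `(A, R)` to `(C, T)` as the composite
`M • N` of the comodule algebras `M` from `(A, R)` to `(B, S)` and `N` from `(B, S)` to `(C, T)`:
`ι` is a map of algebras over `Rᵒ ⊗ T`, it is an equalizer of the two maps
`M ×_S N → M ×_S B ×_S N` given by the coactions of `B` on `M` and on `N`, and the coaction
of `P` is induced by those of `A` on `M` and of `C` on `N`. -/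
structure IsBullet (M : ComodAlg A B) (N : ComodAlg B C) (P : ComodAlg A C)
    (ι : P.carrier →ₐ[k] Tak (M.toEnvAlg ⊠ N.last)) : Prop where
  map_t : ∀ x, toQuo ι (P.t x) = cls (M.toEnvAlg ⊠ N.last) (tm (P := N.last) (M.t x) 1)
  map_s : ∀ x, toQuo ι (P.s x) = cls (M.toEnvAlg ⊠ N.last) (tm (P := N.last) 1 (N.s x))
  injective : Function.Injective ι
  /-- Both sides of the equation depend only on the class of `w`. -/
  mem_range : ∀ q, q ∈ Set.range ι ↔ ∀ w : (M.toEnvAlg ⊠ N.last).carrier, cls _ w = val (M.toEnvAlg ⊠ N.last) q →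
    rext M.toEnvAlg N.toEnvAlg M.toEnvAlg B.toEnvAlg M.coactR w =
      lext M.toEnvAlg N.toEnvAlg B.toEnvAlg N.toEnvAlg N.coactL w
  /-- The coaction: for `α p = ∑ a ⊗ p' ⊗ c` and `ι p = ∑ m ⊗ n`, one has
  `∑ a ⊗ ι p' ⊗ c = ∑ λ m ⊗ ρ n` in `A ⊗ M ⊗ N ⊗ C`, where `λ` and `ρ` are the left coaction of
  `A` on `M` and the right coaction of `C` on `N`. -/
  coact : ∀ (p : P.carrier) (u : (A.toEnvAlg ⊠ P.toEnvAlg ⊠ C.last).carrier)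
    (w : (M.toEnvAlg ⊠ N.last).carrier), cls _ u = P.coact p → cls _ w = toQuo ι p →
    actL (inl A.toEnvAlg (M.toEnvAlg ⊠ N.toEnvAlg ⊠ C.last))
      (actR (P := C.last) ((inr A.toEnvAlg (M.toEnvAlg ⊠ N.toEnvAlg ⊠ C.last)).comp
          ((inr M.toEnvAlg (N.toEnvAlg ⊠ C.last)).comp (inr N.toEnvAlg C.last)))
        ((ins23of4 A.toEnvAlg M.toEnvAlg N.toEnvAlg C.toEnvAlg).comp
          (toQuo ι))) u =
    lift (P := N.last) ((glue4 A.toEnvAlg M.toEnvAlg N.toEnvAlg C.toEnvAlg).compl₁₂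
      M.coactL N.coactR) w

/-- `κ` identifies the comodule algebra `I` with `A`, coacted on by `A` on both sides through its
comultiplication. -/
structure IsRegular (I : ComodAlg A A) (κ : I.carrier ≃ₐ[k] A.carrier) : Prop where
  map_η : ∀ x, κ (I.η x) = A.η x
  coact : ∀ (x : I.carrier) (u : (A.toEnvAlg ⊠ I.toEnvAlg ⊠ A.last).carrier)
    (w : (A.toEnvAlg ⊠ A.last).carrier), cls _ u = I.coact x → cls _ w = A.δ (κ x) →
    cls (A.toEnvAlg ⊠ A.toEnvAlg ⊠ A.last)
      (ext A.toEnvAlg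
        (bimap (P := A.last) (P' := A.last) κ.toAlgHom (AlgHom.id k A.carrier)) u) =
      rext A.toEnvAlg A.toEnvAlg A.toEnvAlg A.toEnvAlg A.δ w

end Bullet

/-! ### Hereditary rings and unions of projectives -/

/-- `R` is left hereditary: submodules of projective left `R`-modules are projective. -/
def IsLeftHereditary (R : Type v) [Ring R] : Prop :=
  ∀ (P : Type v) [AddCommGroup P] [Module R P], Module.Projective R P →
    ∀ N : Submodule R P, Module.Projective R N

/-- `R` is hereditary on both sides. -/
def IsHereditary (R : Type v) [Ring R] : Prop :=
  IsLeftHereditary R ∧ IsLeftHereditary Rᵐᵒᵖ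

/-- A module is a union of projectives if it is the union of a directed family of projective
submodules. -/
def IsUnionOfProjectives (R X : Type*) [Ring R] [AddCommGroup X] [Module R X] : Prop :=
  ∃ F : Set (Submodule R X), F.Nonempty ∧ DirectedOn (· ≤ ·) F ∧
    (∀ P ∈ F, Module.Projective R P) ∧ ∀ x, ∃ P ∈ F, x ∈ P

section Union

variable {k : Type u} [CommRing k]
variable {R S : Type v} [Ring R] [Algebra k R] [Ring S] [Algebra k S]

/-- The right `S`-module `X`: `x · y = x (s y)`. -/
@[reducible] def EnvAlg.rightModule (X : EnvAlg k R S) : Module Sᵐᵒᵖ X :=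
  Module.compHom X (X.s : S →+* X).op

/-- The right `Rᵒ`-module `X`, as a left `R`-module: `y · x = x (t y)`. -/
@[reducible] def EnvAlg.leftModule (X : EnvAlg k R S) : Module R X :=
  Module.compHom X ((X.t : Rᵐᵒᵖ →+* X).op.comp (RingEquiv.opOp R : R →+* Rᵐᵒᵖᵐᵒᵖ))

/-- `X` is a union of projectives as a right `S`-module and as a right `Rᵒ`-module. -/
def EnvAlg.UnionOfProjectives (X : EnvAlg k R S) : Prop :=
  @IsUnionOfProjectives Sᵐᵒᵖ X _ _ X.rightModule ∧ @IsUnionOfProjectives R X _ _ X.leftModule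

end Union

/-! ### The objects and the hom-categories -/

/-- A bialgebroid `(A, R)` with `R` hereditary and `A` a union of projectives on both sides. -/
structure Obj (k : Type u) [CommRing k] where
  base : Type v
  [ring : Ring base]
  [algebra : Algebra k base]
  hereditary : IsHereditary base
  bialgebroid : Bialgebroid k base
  union : bialgebroid.UnionOfProjectives

attribute [instance] Obj.ring Obj.algebra

/-- A comodule algebra that is a union of projectives on both sides. -/
structure Cell {k : Type u} [CommRing k] (a b : Obj.{u, v} k) extends
    ComodAlg a.bialgebroid b.bialgebroid where
  union : toEnvAlg.UnionOfProjectives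

instance {k : Type u} [CommRing k] (a b : Obj.{u, v} k) : Category (Cell a b) where
  Hom M N := ComodAlgHom M.toComodAlg N.toComodAlg
  id M := ComodAlgHom.id M.toComodAlg
  comp f g := ComodAlgHom.comp f g

/-- The map of algebras underlying a 2-cell. -/
def hom {k : Type u} [CommRing k] {a b : Obj.{u, v} k} {M N : Cell a b} (f : M ⟶ N) :
    M.carrier →ₐ[k] N.carrier :=
  ComodAlgHom.toAlgHom f

end Takeuchi

open Takeuchi

/-! Everything takes place inside balanced tensor products. The composite $M\bullet N$ is the part
of $M\otimes_S N$ cut out by Takeuchi's conditions, one for each $y\in S$, and by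
$\rho_M\otimes1=1\otimes\lambda_N$. A bicategory results as soon as this description survives
tensoring with further factors: $A\otimes_R(M\bullet N)$ and $(M\bullet N)\otimes_T L$ must be the
subobjects of $A\otimes_R M\otimes_S N$ and $M\otimes_S N\otimes_T L$ cut out by the same conditions
on the $M$, $N$ factors. Flatness alone preserves finite intersections of kernels, but there may be
infinitely many conditions.

The remedy is local projectivity (`LocProj`): every finitely generated submodule is projective. Over
a hereditary ring this is the same as being a union of projectives. An element of $X\otimes V$ lives
on a finitely generated submodule of $X$. A dual basis of that submodule turns the element into
finitely many elements of $V$, in a way natural in $V$, so that any family of conditions on the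
second factor can be tested coordinatewise. This gives injectivity (`BTensor.map_injective`) and the
preservation of arbitrary intersections of kernels (`BTensor.mem_range_map`); the latter also needs
the targets of the conditions to be locally projective, in order to restrict the conditions to the
finitely generated submodule. Local projectivity passes to anything embedded compatibly in a
balanced tensor product of such modules (`BTensor.locProj`), hence to $M\bullet N$. For composites
the outcome is `TakHom.exists_ext_eq` and `TakHom.exists_wl_eq`.

A comodule algebra is the same as a pair of commuting one-sided coactions. Applying counits to two
of the factors in the fivefold coassociativity law gives the coassociativity of $\lambda$ and of
$\rho$ and the equations $(1\otimes\rho)\lambda=\alpha=(\lambda\otimes1)\rho$; conversely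
$\alpha=(1\otimes\rho)\lambda$ defines a comodule algebra (`Coactions.comodAlg`). The collapse along
a counit is multiplicative only on elements satisfying Takeuchi's condition, since $e(ab)$ depends
on $a$ only through $e(a)$. Multiplicativity of linear maps between balanced tensor products is
recorded by `Mult`, which is stable under composition and tensoring and descends along injective
maps.

The coactions of $M\bullet N$ are then the restrictions of $\lambda_M\otimes1$ and $1\otimes\rho_N$,
and their laws hold because they hold in larger tensor products into which everything embeds. Both
triple composites have the same image in $M\otimes_S N\otimes_T L$, described by `IsTriple`, and
this yields the associator. The inverses of the unit maps $\lambda_M$ and $\rho_M$ are the counits: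
the equalizer condition on $A\bullet M$ followed by $\varepsilon$ says that $\lambda_M\varepsilon$
is the identity. Since all structure maps are induced by identities or by the given maps after
embedding in tensor products, naturality and coherence are equations checked there; the triangle is
exactly the equation that defines $M\bullet N$. -/

namespace Takeuchi

/-! ### Locally projective modules -/

section LocProj

/-- All finitely generated submodules of `X` are projective. -/
def LocProj (S X : Type*) [Ring S] [AddCommGroup X] [Module S X] : Prop :=
  ∀ N : Submodule S X, N.FG → Module.Projective S N

/-- A surjection from a finite free module splits: the `e j` are the images of the standard basis,
and the `φ j` are the components of the splitting. -/
theorem exists_dualBasis (S N : Type*) [Ring S] [AddCommGroup N] [Module S N]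
    [Module.Finite S N] [Module.Projective S N] :
    ∃ (n : ℕ) (e : Fin n → N) (φ : Fin n → N →ₗ[S] S), ∀ x, ∑ j, φ j x • e j = x := by
  obtain ⟨n, f, hf⟩ := Module.Finite.exists_fin' S N
  obtain ⟨g, hg⟩ := Module.projective_lifting_property f LinearMap.id hf
  refine ⟨n, fun j => f (Pi.single j 1), fun j => (LinearMap.proj j).comp g, fun x => ?_⟩
  have h := congrArg (fun l => l x) hg
  simp only [LinearMap.comp_apply, LinearMap.id_apply] at h
  conv_rhs => rw [← h, pi_eq_sum_univ' (g x)]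
  simp [map_sum, ← map_smul, ← Pi.single_smul]

theorem LocProj.exists_dualBasis {S X : Type*} [Ring S] [AddCommGroup X] [Module S X]
    (h : LocProj S X) {N : Submodule S X} (hN : N.FG) :
    ∃ (n : ℕ) (e : Fin n → N) (φ : Fin n → N →ₗ[S] S), ∀ x, ∑ j, φ j x • e j = x := by
  have := h N hN
  have : Module.Finite S N := Module.Finite.iff_fg.2 hN
  exact Takeuchi.exists_dualBasis S N

/-- The target and the exponent may vary with `N`. This matters for tensor products, which embed in
powers of one factor only locally. -/
theorem LocProj.of_local {S X : Type*} [Ring S] [AddCommGroup X] [Module S X]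
    (h : ∀ N : Submodule S X, N.FG → ∃ (n : ℕ) (Y : Type v) (_ : AddCommGroup Y)
      (_ : Module S Y) (f : N →ₗ[S] (Fin n → Y)), LocProj S (Fin n → Y) ∧
        Function.Injective f) : LocProj S X := by
  intro N hN
  obtain ⟨n, Y, _, _, f, hY, hf⟩ := h N hN
  have hfg : (LinearMap.range f).FG := by
    have : Module.Finite S N := Module.Finite.iff_fg.2 hN
    rw [LinearMap.range_eq_map]
    exact Submodule.FG.map f Module.Finite.fg_top
  have := hY _ hfg
  exact Module.Projective.of_equiv (LinearEquiv.ofInjective f hf).symm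

theorem LocProj.of_injective {S X Y : Type*} [Ring S] [AddCommGroup X] [Module S X]
    [AddCommGroup Y] [Module S Y] (hY : LocProj S Y) (f : X →ₗ[S] Y)
    (hf : Function.Injective f) : LocProj S X := by
  intro N hN
  have := hY _ (hN.map f)
  exact Module.Projective.of_equiv (Submodule.equivMapOfInjective f hf N).symm

/-- A finitely generated submodule of $X^n$ lies in $X_0^n$, where $X_0$ is the sum of its
projections. As $X_0$ is finitely generated, $X_0^n$ is projective, and heredity passes this on to
the submodule. -/
theorem LocProj.pi {S X : Type v} [Ring S] [AddCommGroup X] [Module S X]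
    (hS : IsLeftHereditary S) (hX : LocProj S X) (n : ℕ) : LocProj S (Fin n → X) := by
  intro N hN
  let X₀ : Submodule S X := ⨆ i : Fin n, N.map (LinearMap.proj i)
  have hX₀ : X₀.FG := Submodule.fg_iSup _ fun i => hN.map _
  have := hX _ hX₀
  have hP : Module.Projective S (Fin n → X₀) :=
    Module.Projective.of_equiv (DFinsupp.linearEquivFunOnFintype (R := S) (M := fun _ : Fin n => X₀))
  let g : (Fin n → X₀) →ₗ[S] (Fin n → X) := LinearMap.pi fun i => X₀.subtype.comp (LinearMap.proj i)
  have hg : Function.Injective g := by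
    intro a b h
    funext i
    exact Subtype.ext (congrFun h i)
  have := hS _ hP (N.comap g)
  have hN : N = (N.comap g).map g := by
    rw [Submodule.map_comap_eq, inf_eq_right.2]
    intro x hx
    have hm : ∀ i, x i ∈ X₀ := fun i =>
      (le_iSup (fun i : Fin n => N.map (LinearMap.proj i)) i) ⟨x, hx, rfl⟩
    exact ⟨fun i => ⟨x i, hm i⟩, rfl⟩
  rw [hN]
  exact Module.Projective.of_equiv (Submodule.equivMapOfInjective g hg _)

/-- By directedness a finitely generated submodule lies in a single member of the family, and
heredity makes it projective. -/
theorem IsUnionOfProjectives.locProj {S X : Type v} [Ring S] [AddCommGroup X] [Module S X]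
    (hS : IsLeftHereditary S) (h : IsUnionOfProjectives S X) : LocProj S X := by
  obtain ⟨F, ⟨P₀, hP₀⟩, hd, hp, hu⟩ := h
  intro N hN
  have : ∃ P ∈ F, N ≤ P := by
    classical
    obtain ⟨s, rfl⟩ := hN
    induction s using Finset.induction_on with
    | empty => exact ⟨P₀, hP₀, by simp⟩
    | insert a s _ ih =>
      obtain ⟨P, hP, hs⟩ := ih
      obtain ⟨Q, hQ, ha⟩ := hu a
      obtain ⟨L, hL, hPL, hQL⟩ := hd P hP Q hQ
      refine ⟨L, hL, ?_⟩
      rw [Finset.coe_insert, Submodule.span_insert]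
      exact sup_le ((Submodule.span_singleton_le_iff_mem _ _).2 (hQL ha)) (hs.trans hPL)
  obtain ⟨P, hP, hNP⟩ := this
  have := hS P (hp P hP) (N.comap P.subtype)
  exact Module.Projective.of_equiv (Submodule.comapSubtypeEquivOfLe hNP)

/-- The finitely generated submodules themselves form a directed family with union `X`. Hence over
hereditary rings the two conditions agree, and the simpler `LocProj` can be used throughout. -/
theorem LocProj.isUnionOfProjectives {S X : Type*} [Ring S] [AddCommGroup X] [Module S X]
    (h : LocProj S X) : IsUnionOfProjectives S X :=
  ⟨{N | N.FG}, ⟨⊥, Submodule.fg_bot⟩,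
    fun P hP Q hQ => ⟨P ⊔ Q, hP.sup hQ, le_sup_left, le_sup_right⟩, h,
    fun x => ⟨Submodule.span S {x}, Submodule.fg_span_singleton x, Submodule.mem_span_singleton_self x⟩⟩

end LocProj

/-! ### Balanced tensor products of modules -/

section BTensor

variable {S₁ S₂ : Type*} [Ring S₁] [Ring S₂] (σ : S₁ →+* S₂ᵐᵒᵖ)

/-- The relations of the balanced tensor product. -/
def BTensor.rel (X V : Type*) [AddCommGroup X] [Module S₁ X] [AddCommGroup V] [Module S₂ V] :
    Set (FreeAbelianGroup (X × V)) :=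
  {g | (∃ x x' v, g = .of (x + x', v) - .of (x, v) - .of (x', v)) ∨
    (∃ x v v', g = .of (x, v + v') - .of (x, v) - .of (x, v')) ∨
    ∃ (y : S₁) (x : X) (v : V), g = .of (y • x, v) - .of (x, unop (σ y) • v)}

/-- The balanced tensor product of an `S₁`-module `X` and an `S₂`-module `V`, for an antihomomorphism
`σ` from `S₁` to `S₂`. -/
def BTensor (X V : Type*) [AddCommGroup X] [Module S₁ X] [AddCommGroup V] [Module S₂ V] : Type _ :=
  FreeAbelianGroup (X × V) ⧸ AddSubgroup.closure (BTensor.rel σ X V)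

namespace BTensor

variable {X X' V V' W : Type*} [AddCommGroup X] [Module S₁ X] [AddCommGroup X'] [Module S₁ X']
  [AddCommGroup V] [Module S₂ V] [AddCommGroup V'] [Module S₂ V'] [AddCommGroup W]

instance : AddCommGroup (BTensor σ X V) :=
  inferInstanceAs (AddCommGroup (FreeAbelianGroup (X × V) ⧸ AddSubgroup.closure (BTensor.rel σ X V)))

/-- The class of a formal sum. -/
def mk : FreeAbelianGroup (X × V) →+ BTensor σ X V :=
  QuotientAddGroup.mk' _

theorem mk_surjective : Function.Surjective (mk σ : _ → BTensor σ X V) :=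
  QuotientAddGroup.mk'_surjective _

theorem mk_eq_zero {g : FreeAbelianGroup (X × V)} :
    mk σ g = 0 ↔ g ∈ AddSubgroup.closure (rel σ X V) :=
  QuotientAddGroup.eq_zero_iff g

/-- The pure tensor, as a biadditive map. -/
def tmul : X →+ V →+ BTensor σ X V :=
  AddMonoidHom.mk' (fun x => AddMonoidHom.mk' (fun v => mk σ (.of (x, v))) (by
    intro v v'
    rw [← map_add, ← sub_eq_zero, ← map_sub, mk_eq_zero, ← sub_sub]
    exact AddSubgroup.subset_closure (Or.inr (Or.inl ⟨x, v, v', rfl⟩)))) (by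
    intro x x'
    ext v
    change mk σ _ = mk σ _ + mk σ _
    rw [← map_add, ← sub_eq_zero, ← map_sub, mk_eq_zero, ← sub_sub]
    exact AddSubgroup.subset_closure (Or.inl ⟨x, x', v, rfl⟩))

theorem mk_of (x : X) (v : V) : mk σ (.of (x, v)) = tmul σ x v := rfl

theorem smul_tmul (y : S₁) (x : X) (v : V) : tmul σ (y • x) v = tmul σ x (unop (σ y) • v) := by
  rw [← sub_eq_zero, ← mk_of, ← mk_of, ← map_sub, mk_eq_zero]
  exact AddSubgroup.subset_closure (Or.inr (Or.inr ⟨y, x, v, rfl⟩))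

variable {σ} in
theorem induction_on {C : BTensor σ X V → Prop} (w : BTensor σ X V) (h1 : ∀ x v, C (tmul σ x v))
    (h2 : ∀ a b, C a → C b → C (a + b)) : C w := by
  have hz : C 0 := by simpa using h1 0 0
  obtain ⟨g, rfl⟩ := mk_surjective σ w
  induction g using FreeAbelianGroup.induction_on with
  | zero => rwa [map_zero]
  | of p => exact h1 p.1 p.2
  | neg p _ =>
    have := h1 (-p.1) p.2
    rwa [map_neg, AddMonoidHom.neg_apply, ← mk_of, ← map_neg] at this
  | add a b ha hb => rw [map_add]; exact h2 _ _ ha hb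

/-- The additive map given by a balanced biadditive map. -/
def lift (f : X →+ V →+ W) (h : ∀ y x v, f (y • x) v = f x (unop (σ y) • v)) : BTensor σ X V →+ W :=
  QuotientAddGroup.lift _ (FreeAbelianGroup.lift fun p => f p.1 p.2) (by
    rw [AddSubgroup.closure_le]
    rintro _ (⟨x, x', v, rfl⟩ | ⟨x, v, v', rfl⟩ | ⟨y, x, v, rfl⟩) <;>
      simp [AddMonoidHom.mem_ker, h])

theorem lift_tmul (f : X →+ V →+ W) (h : ∀ y x v, f (y • x) v = f x (unop (σ y) • v)) (x v) :
    lift σ f h (tmul σ x v) = f x v := by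
  change FreeAbelianGroup.lift _ _ = _
  simp

/-- The functoriality of the balanced tensor product. -/
def map (f : X →ₗ[S₁] X') (g : V →ₗ[S₂] V') : BTensor σ X V →+ BTensor σ X' V' :=
  lift σ (((tmul σ).comp f.toAddMonoidHom).compr₂ (AddMonoidHom.id _) |>.compl₂ g.toAddMonoidHom) (by
    intro y x v
    simp [smul_tmul])

@[simp] theorem map_tmul (f : X →ₗ[S₁] X') (g : V →ₗ[S₂] V') (x v) :
    map σ f g (tmul σ x v) = tmul σ (f x) (g v) := lift_tmul _ _ _ _ _

/-- The interchange of the factors. -/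
def flip (τ : S₂ →+* S₁ᵐᵒᵖ) (h : ∀ y, unop (τ (unop (σ y))) = y)
    (h' : ∀ y, unop (σ (unop (τ y))) = y) : BTensor σ X V ≃+ BTensor τ V X where
  toFun := lift σ (tmul τ).flip (by intro y x v; simp [smul_tmul, h])
  invFun := lift τ (tmul σ).flip (by intro y x v; simp [smul_tmul, h'])
  left_inv w := by
    induction w using induction_on with
    | h1 x v => exact (congrArg _ (lift_tmul σ _ _ x v)).trans (lift_tmul τ _ _ v x)
    | h2 a b ha hb => rw [map_add, map_add, ha, hb]
  right_inv w := by
    induction w using induction_on with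
    | h1 x v => exact (congrArg _ (lift_tmul τ _ _ x v)).trans (lift_tmul σ _ _ v x)
    | h2 a b ha hb => rw [map_add, map_add, ha, hb]
  map_add' := map_add _

@[simp] theorem flip_tmul (τ : S₂ →+* S₁ᵐᵒᵖ) (h : ∀ y, unop (τ (unop (σ y))) = y)
    (h' : ∀ y, unop (σ (unop (τ y))) = y) (x : X) (v : V) :
    flip σ τ h h' (tmul σ x v) = tmul τ v x :=
  lift_tmul σ (tmul τ).flip (by intro y x v; simp [smul_tmul, h]) x v

/-- The map `x ⊗ v ↦ φ x • v`. -/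
def eval (φ : X →ₗ[S₁] S₁) : BTensor σ X V →+ V :=
  lift σ (AddMonoidHom.mk' (fun x => DistribSMul.toAddMonoidHom V (unop (σ (φ x)))) (by
    intro x x'; ext v; simp [add_smul])) (by intro y x v; simp [mul_smul])

@[simp] theorem eval_tmul (φ : X →ₗ[S₁] S₁) (x : X) (v : V) :
    eval σ φ (tmul σ x v) = unop (σ (φ x)) • v := lift_tmul _ _ _ _ _

/-- A dual basis of $X$ exhibits $X\otimes V$ as a direct summand of $V^n$, naturally in $V$. The
evaluations are the coordinates. -/
theorem sum_tmul_eval {n : ℕ} {e : Fin n → X} {φ : Fin n → X →ₗ[S₁] S₁}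
    (h : ∀ x, ∑ j, φ j x • e j = x) (w : BTensor σ X V) :
    ∑ j, tmul σ (e j) (eval σ (φ j) w) = w := by
  induction w using induction_on with
  | h1 x v =>
    conv_rhs => rw [← h x]
    simp [smul_tmul]
  | h2 a b ha hb =>
    conv_rhs => rw [← ha, ← hb]
    simp [Finset.sum_add_distrib]

theorem eval_map (φ : X →ₗ[S₁] S₁) (g : V →ₗ[S₂] V') (w : BTensor σ X V) :
    eval σ φ (map σ LinearMap.id g w) = g (eval σ φ w) := by
  induction w using induction_on with
  | h1 x v => simp
  | h2 a b ha hb => simp [ha, hb]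

theorem eval_injective {n : ℕ} {e : Fin n → X} {φ : Fin n → X →ₗ[S₁] S₁}
    (h : ∀ x, ∑ j, φ j x • e j = x) {w w' : BTensor σ X V}
    (hw : ∀ j, eval σ (φ j) w = eval σ (φ j) w') : w = w' := by
  rw [← sum_tmul_eval σ h w, ← sum_tmul_eval σ h w']
  simp [hw]

variable {σ} in
-- A tensor involves finitely many elements of $X$. The conclusion is stated for all larger
-- submodules so that finitely many such bounds can be joined.
theorem exists_fg_le (w : BTensor σ X V) : ∃ X₀ : Submodule S₁ X, X₀.FG ∧
    ∀ X₁, X₀ ≤ X₁ → ∃ w₁ : BTensor σ X₁ V, map σ X₁.subtype LinearMap.id w₁ = w := by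
  induction w using induction_on with
  | h1 x v =>
    refine ⟨Submodule.span S₁ {x}, Submodule.fg_span_singleton x, fun X₁ h => ?_⟩
    exact ⟨tmul σ ⟨x, h (Submodule.mem_span_singleton_self x)⟩ v, by simp⟩
  | h2 a b ha hb =>
    obtain ⟨A, hA, ha⟩ := ha
    obtain ⟨B, hB, hb⟩ := hb
    refine ⟨A ⊔ B, hA.sup hB, fun X₁ h => ?_⟩
    obtain ⟨a', rfl⟩ := ha X₁ (le_sup_left.trans h)
    obtain ⟨b', rfl⟩ := hb X₁ (le_sup_right.trans h)
    exact ⟨a' + b', map_add _ _ _⟩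

open Classical in
/-- The evaluation of a formal sum at a function on a submodule, extended by zero. -/
noncomputable def partialEval {X₁ : Submodule S₁ X} (φ : X₁ →ₗ[S₁] S₁) :
    FreeAbelianGroup (X × V) →+ V :=
  FreeAbelianGroup.lift fun p => if h : p.1 ∈ X₁ then unop (σ (φ ⟨p.1, h⟩)) • p.2 else 0

theorem partialEval_of {X₁ : Submodule S₁ X} (φ : X₁ →ₗ[S₁] S₁) {x : X} (hx : x ∈ X₁) (v : V) :
    partialEval σ φ (.of (x, v)) = unop (σ (φ ⟨x, hx⟩)) • v := by
  simp [partialEval, hx]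

/-- A combination of relations mentions only finitely many elements of $X$. Once `X₁` contains them,
the extension by zero plays no role and `φ` respects each relation involved. This replaces the
passage to a direct limit over the submodules of $X$. -/
theorem exists_partialEval_eq_zero {g : FreeAbelianGroup (X × V)}
    (hg : g ∈ AddSubgroup.closure (rel σ X V)) : ∃ X₀ : Submodule S₁ X, X₀.FG ∧
      ∀ X₁, X₀ ≤ X₁ → ∀ φ : X₁ →ₗ[S₁] S₁, partialEval σ φ g = 0 := by
  induction hg using AddSubgroup.closure_induction with
  | zero => exact ⟨⊥, Submodule.fg_bot, fun _ _ _ => map_zero _⟩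
  | add a b _ _ ha hb =>
    obtain ⟨A, hA, ha⟩ := ha
    obtain ⟨B, hB, hb⟩ := hb
    refine ⟨A ⊔ B, hA.sup hB, fun X₁ h φ => ?_⟩
    rw [map_add, ha X₁ (le_sup_left.trans h), hb X₁ (le_sup_right.trans h), add_zero]
  | neg a _ ha =>
    obtain ⟨A, hA, ha⟩ := ha
    refine ⟨A, hA, fun X₁ h φ => ?_⟩
    rw [map_neg, ha X₁ h, neg_zero]
  | mem g hg =>
    obtain ⟨x, x', v, rfl⟩ | ⟨x, v, v', rfl⟩ | ⟨y, x, v, rfl⟩ := hg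
    · refine ⟨Submodule.span S₁ {x} ⊔ Submodule.span S₁ {x'},
        (Submodule.fg_span_singleton x).sup (Submodule.fg_span_singleton x'), fun X₁ h φ => ?_⟩
      have hx : x ∈ X₁ := h (Submodule.mem_sup_left (Submodule.mem_span_singleton_self x))
      have hx' : x' ∈ X₁ := h (Submodule.mem_sup_right (Submodule.mem_span_singleton_self x'))
      rw [map_sub, map_sub, partialEval_of σ φ hx, partialEval_of σ φ hx',
        partialEval_of σ φ (add_mem hx hx')]
      have hxx : φ ⟨x + x', add_mem hx hx'⟩ = φ ⟨x, hx⟩ + φ ⟨x', hx'⟩ := by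
        rw [← map_add]; rfl
      simp [hxx, add_smul]
    · refine ⟨Submodule.span S₁ {x}, Submodule.fg_span_singleton x, fun X₁ h φ => ?_⟩
      have hx : x ∈ X₁ := h (Submodule.mem_span_singleton_self x)
      simp [partialEval_of σ φ hx]
    · refine ⟨Submodule.span S₁ {x}, Submodule.fg_span_singleton x, fun X₁ h φ => ?_⟩
      have hx : x ∈ X₁ := h (Submodule.mem_span_singleton_self x)
      have hyx : φ ⟨y • x, X₁.smul_mem y hx⟩ = y * φ ⟨x, hx⟩ := by
        rw [← smul_eq_mul, ← map_smul]; rfl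
      rw [map_sub, partialEval_of σ φ hx, partialEval_of σ φ (X₁.smul_mem y hx), hyx]
      simp [mul_smul]

/-- The same formal sum, read in $X_1\otimes V$, has the partial evaluations as its true
coordinates. -/
theorem exists_partialEval_map (g : FreeAbelianGroup (X × V)) :
    ∃ X₀ : Submodule S₁ X, X₀.FG ∧ ∀ X₁, X₀ ≤ X₁ → ∃ w : BTensor σ X₁ V,
      map σ X₁.subtype LinearMap.id w = mk σ g ∧
      ∀ φ : X₁ →ₗ[S₁] S₁, partialEval σ φ g = eval σ φ w := by
  induction g using FreeAbelianGroup.induction_on with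
  | zero => exact ⟨⊥, Submodule.fg_bot, fun _ _ => ⟨0, by simp, fun _ => by simp⟩⟩
  | of p =>
    obtain ⟨x, v⟩ := p
    refine ⟨Submodule.span S₁ {x}, Submodule.fg_span_singleton x, fun X₁ h => ?_⟩
    have hx : x ∈ X₁ := h (Submodule.mem_span_singleton_self x)
    exact ⟨tmul σ ⟨x, hx⟩ v, by simp [mk_of], fun φ => by simp [partialEval_of σ φ hx]⟩
  | neg p hp =>
    obtain ⟨A, hA, ha⟩ := hp
    refine ⟨A, hA, fun X₁ h => ?_⟩
    obtain ⟨w, hw, hw'⟩ := ha X₁ h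
    exact ⟨-w, by simp [hw], fun φ => by simp [hw']⟩
  | add a b ha hb =>
    obtain ⟨A, hA, ha⟩ := ha
    obtain ⟨B, hB, hb⟩ := hb
    refine ⟨A ⊔ B, hA.sup hB, fun X₁ h => ?_⟩
    obtain ⟨w, hw, hw'⟩ := ha X₁ (le_sup_left.trans h)
    obtain ⟨z, hz, hz'⟩ := hb X₁ (le_sup_right.trans h)
    exact ⟨w + z, by simp [hw, hz], fun φ => by simp [hw', hz']⟩

/-- Flatness of locally projective modules. Represent a tensor in the kernel by a formal sum and
pass to a finitely generated submodule of $X$ that carries both this sum and the relations which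
kill its image. Its coordinates with respect to a dual basis become zero under the injective `g`, so
they are zero. -/
theorem map_injective (hX : LocProj S₁ X) (g : V →ₗ[S₂] V') (hg : Function.Injective g) :
    Function.Injective (map σ (LinearMap.id : X →ₗ[S₁] X) g) := by
  rw [injective_iff_map_eq_zero]
  intro w hw
  obtain ⟨a, rfl⟩ := mk_surjective σ w
  let G : FreeAbelianGroup (X × V) →+ FreeAbelianGroup (X × V') :=
    FreeAbelianGroup.map fun p => (p.1, g p.2)
  have hG : ∀ a, map σ LinearMap.id g (mk σ a) = mk σ (G a) := by
    intro a
    induction a using FreeAbelianGroup.induction_on with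
    | zero => simp
    | of p =>
      obtain ⟨x, v⟩ := p
      simp [G, mk_of]
    | neg p hp => simp [hp]
    | add a b ha hb => simp [ha, hb]
  have hGe : ∀ (X₁ : Submodule S₁ X) (φ : X₁ →ₗ[S₁] S₁) a,
      partialEval σ φ (G a) = g (partialEval σ φ a) := by
    intro X₁ φ a
    induction a using FreeAbelianGroup.induction_on with
    | zero => simp
    | of p =>
      by_cases h : p.1 ∈ X₁ <;> simp [G, partialEval, h]
    | neg p hp => simp [hp]
    | add a b ha hb => simp [ha, hb]
  -- `A` carries the relations that kill the image of the formal sum, `B` the formal sum itself; the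
  -- dual basis is taken on their sum.
  rw [hG, mk_eq_zero] at hw
  obtain ⟨A, hA, ha⟩ := exists_partialEval_eq_zero σ hw
  obtain ⟨B, hB, hb⟩ := exists_partialEval_map σ a
  obtain ⟨w, hw, hw'⟩ := hb (A ⊔ B) le_sup_right
  obtain ⟨n, e, φ, he⟩ := hX.exists_dualBasis (hA.sup hB)
  suffices h : w = 0 by rw [← hw, h, map_zero]
  refine eval_injective σ he fun j => hg ?_
  rw [← hw', ← hGe, ha _ le_sup_left, map_zero, map_zero]

/-- The mirror image of `map_injective`, obtained by interchanging the factors; for this `σ` has to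
be invertible. -/
theorem map_injective_left {τ : S₂ →+* S₁ᵐᵒᵖ} (h : ∀ y, unop (τ (unop (σ y))) = y)
    (h' : ∀ y, unop (σ (unop (τ y))) = y) (hV : LocProj S₂ V) (f : X →ₗ[S₁] X')
    (hf : Function.Injective f) :
    Function.Injective (map σ f (LinearMap.id : V →ₗ[S₂] V)) := by
  have key : ∀ w, flip σ τ h h' (map σ f LinearMap.id w) =
      map τ (LinearMap.id : V →ₗ[S₂] V) f (flip σ τ h h' w) := by
    intro w
    induction w using induction_on with
    | h1 x v => simp
    | h2 a b ha hb => simp [ha, hb]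
  intro a b hab
  apply (flip σ τ h h').injective
  apply map_injective τ hV f hf
  rw [← key, ← key, hab]

theorem map_comm_map (f : X →ₗ[S₁] X') (g : V →ₗ[S₂] V') (w : BTensor σ X V) :
    map σ f LinearMap.id (map σ LinearMap.id g w) = map σ LinearMap.id g (map σ f LinearMap.id w) := by
  induction w using induction_on with
  | h1 x v => simp
  | h2 a b ha hb => simp [ha, hb]

/-- An element of `X ⊗ V` that is killed by the maps `X ⊗ θ i` and `X ⊗ θ'` comes from
`X ⊗ (ker θ' ⊓ ⨅ i, ker (θ i))`. -/
theorem mem_range_map {τ : S₂ →+* S₁ᵐᵒᵖ} (h : ∀ y, unop (τ (unop (σ y))) = y)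
    (h' : ∀ y, unop (σ (unop (τ y))) = y) (hX : LocProj S₁ X) {ι Z Z' : Type*}
    [AddCommGroup Z] [Module S₂ Z] [AddCommGroup Z'] [Module S₂ Z'] (hZ : LocProj S₂ Z)
    (hZ' : LocProj S₂ Z') (θ : ι → V →ₗ[S₂] Z) (θ' : V →ₗ[S₂] Z') (f : V' →ₗ[S₂] V)
    (hf : ∀ v, (∀ i, θ i v = 0) → θ' v = 0 → ∃ v', f v' = v)
    (w : BTensor σ X V) (hw : ∀ i, map σ LinearMap.id (θ i) w = 0)
    (hw' : map σ LinearMap.id θ' w = 0) :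
    ∃ w', map σ LinearMap.id f w' = w := by
  obtain ⟨A, hA, ha⟩ := exists_fg_le w
  obtain ⟨w₁, rfl⟩ := ha A le_rfl
  obtain ⟨n, e, φ, he⟩ := hX.exists_dualBasis hA
  -- The conditions are known in $X\otimes Z$ but are needed in $A\otimes Z$. The map between these
  -- is injective because $Z$ is locally projective.
  have hz : ∀ i, map σ LinearMap.id (θ i) w₁ = 0 := by
    intro i
    apply map_injective_left σ h h' hZ A.subtype Subtype.val_injective
    rw [map_zero, map_comm_map, hw]
  have hz' : map σ LinearMap.id θ' w₁ = 0 := by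
    apply map_injective_left σ h h' hZ' A.subtype Subtype.val_injective
    rw [map_zero, map_comm_map, hw']
  -- Evaluation commutes with every `θ i`, so each of the finitely many coordinates satisfies all
  -- conditions at once, however many there are.
  have hv : ∀ j, ∃ v', f v' = eval σ (φ j) w₁ := by
    intro j
    refine hf _ (fun i => ?_) ?_
    · rw [← eval_map, hz, map_zero]
    · rw [← eval_map, hz', map_zero]
  choose v hv using hv
  refine ⟨∑ j, tmul σ (e j : X) (v j), ?_⟩
  rw [← sum_tmul_eval σ he w₁]
  simp [hv]

/-- A module `W` is locally projective if it embeds in `X ⊗ V`, where the action on `X ⊗ V` comes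
from one on `X`. -/
theorem locProj {S₁ S₂ R' X V W : Type v} [Ring S₁] [Ring S₂] [Ring R'] {σ : S₁ →+* S₂ᵐᵒᵖ}
    {τ : S₂ →+* S₁ᵐᵒᵖ} [AddCommGroup X] [AddCommGroup V] [AddCommGroup W] [Module S₁ X]
    [Module S₂ V] [Module R' W]
    (h : ∀ y, unop (τ (unop (σ y))) = y) (h' : ∀ y, unop (σ (unop (τ y))) = y)
    (hR : IsLeftHereditary R') [Module R' X] [SMulCommClass R' S₁ X]
    (hX : LocProj S₁ X) (hX' : LocProj R' X) (hV : LocProj S₂ V) (e : W →+ BTensor σ X V)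
    (he : Function.Injective e)
    (hmap : ∀ (r : R') w, e (r • w) = map σ (DistribSMul.toLinearMap S₁ X r) LinearMap.id (e w)) :
    LocProj R' W := by
  refine LocProj.of_local.{v} fun D hD => ?_
  obtain ⟨s, rfl⟩ := hD
  -- A single finitely generated `V₀` suffices for the whole span of the finite set `s`.
  have hs : ∃ V₀ : Submodule S₂ V, V₀.FG ∧ ∀ d ∈ Submodule.span R' (s : Set W),
      ∃ u : BTensor σ X V₀, map σ LinearMap.id V₀.subtype u = e d := by
    have hs : ∃ V₀ : Submodule S₂ V, V₀.FG ∧ ∀ d ∈ s,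
        ∃ u : BTensor σ X V₀, map σ LinearMap.id V₀.subtype u = e d := by
      classical
      induction s using Finset.induction_on with
      | empty => exact ⟨⊥, Submodule.fg_bot, by simp⟩
      | insert a s _ ih =>
        obtain ⟨A, hA, ha⟩ := ih
        -- The bound `exists_fg_le` concerns the first factor, and here the second one is to be
        -- bounded.
        obtain ⟨B, hB, hb⟩ := exists_fg_le (flip σ τ h h' (e a))
        obtain ⟨z, hz⟩ := hb (A ⊔ B) le_sup_right
        refine ⟨A ⊔ B, hA.sup hB, ?_⟩
        rintro d hd
        rw [Finset.mem_insert] at hd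
        obtain rfl | hd := hd
        · refine ⟨(flip σ τ h h').symm z, ?_⟩
          apply (flip σ τ h h').injective
          rw [← hz]
          obtain ⟨z, rfl⟩ := (flip σ τ h h').surjective z
          rw [AddEquiv.symm_apply_apply]
          generalize z = z
          induction z using induction_on with
          | h1 x v => simp
          | h2 a b ha hb => simp [ha, hb]
        · obtain ⟨u, hu⟩ := ha d hd
          refine ⟨map σ LinearMap.id (Submodule.inclusion le_sup_left) u, ?_⟩
          rw [← hu]
          generalize u = u
          induction u using induction_on with
          | h1 x v => simp
          | h2 a b ha hb => simp [ha, hb]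
    obtain ⟨V₀, hV₀, hs⟩ := hs
    refine ⟨V₀, hV₀, fun d hd => ?_⟩
    induction hd using Submodule.span_induction with
    | mem d hd => exact hs d hd
    | zero => exact ⟨0, by simp⟩
    | add a b _ _ ha hb =>
      obtain ⟨a', ha⟩ := ha
      obtain ⟨b', hb⟩ := hb
      exact ⟨a' + b', by simp [ha, hb]⟩
    -- The ring `R'` acts through $X$ alone, so `V₀` need not grow.
    | smul r a _ ha =>
      obtain ⟨a', ha⟩ := ha
      refine ⟨map σ (DistribSMul.toLinearMap S₁ X r) LinearMap.id a', ?_⟩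
      rw [hmap, ← ha]
      generalize a' = u
      induction u using induction_on with
      | h1 x v => simp
      | h2 a b ha hb => simp [ha, hb]
  obtain ⟨V₀, hV₀, hs⟩ := hs
  choose u hu using fun d : Submodule.span R' (s : Set W) => hs d d.2
  -- Flatness of $X$ makes the chosen lifts to $X\otimes V_0$ unique, hence additive and
  -- `R'`-linear.
  have hinj : Function.Injective (map σ (LinearMap.id : X →ₗ[S₁] X) V₀.subtype) :=
    map_injective σ hX V₀.subtype Subtype.val_injective
  obtain ⟨n, b, φ, hb⟩ := hV.exists_dualBasis hV₀
  let ψ : Fin n → BTensor σ X V₀ →+ X := fun j =>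
    (eval τ (φ j)).comp (flip σ τ h h').toAddMonoidHom
  have hψ : ∀ j x v, ψ j (tmul σ x v) = unop (τ (φ j v)) • x := by
    intro j x v
    simp [ψ]
  have hadd : ∀ a b, u (a + b) = u a + u b := by
    intro a b
    apply hinj
    rw [map_add, hu, hu, hu, ← map_add]
    rfl
  have hsmul : ∀ (r : R') a, u (r • a) = map σ (DistribSMul.toLinearMap S₁ X r) LinearMap.id (u a) := by
    intro r a
    apply hinj
    rw [hu, Submodule.coe_smul, hmap, ← hu]
    generalize u a = u
    induction u using induction_on with
    | h1 x v => simp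
    | h2 a b ha hb => simp [ha, hb]
  -- The coordinates with respect to a dual basis of `V₀` embed the submodule in $X^n$, which is
  -- locally projective over the hereditary ring `R'`.
  refine ⟨n, X, inferInstance, inferInstance,
    { toFun := fun d j => ψ j (u d)
      map_add' := fun a b => by funext j; simp [hadd]
      map_smul' := fun r a => by
        funext j
        simp only [hsmul, RingHom.id_apply, Pi.smul_apply]
        generalize u a = u
        induction u using induction_on with
        | h1 x v => simp [hψ, smul_comm r]
        | h2 a b ha hb => simp [ha, hb] }, hX'.pi hR n, ?_⟩
  intro a b hab
  apply Subtype.ext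
  apply he
  rw [← hu, ← hu]
  congr 1
  apply (flip σ τ h h').injective
  exact eval_injective τ hb fun j => congrFun hab j

end BTensor

end BTensor

/-! ### Balanced tensor products as modules -/

section Tower

variable {k : Type u} [CommRing k]
variable {R S T Q : Type v} [Ring R] [Algebra k R] [Ring S] [Algebra k S] [Ring T] [Algebra k T]
  [Ring Q] [Algebra k Q]

/-- Right multiplication by `P.τ` respects the relations of `P`. -/
class Balanced (P : RelAlg k R) : Prop where
  rel_mul_τ : ∀ b ∈ P.rel, ∀ x, b * P.τ x ∈ Ideal.span P.rel

instance (X : EnvAlg k R S) : Balanced X.last := ⟨fun _ hb => hb.elim⟩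

theorem tm_one_comm {X : EnvAlg k R S} {P : RelAlg k S} (x : X) (p : P) :
    (inl X P x) * (inr X P p) = inr X P p * inl X P x := by
  rw [inl_apply, inr_apply, tm_mul_tm, tm_mul_tm, one_mul, one_mul, mul_one, mul_one]

/-- Right multiplication by `t x` commutes with the relations, because the images of `s` and `t`
commute in `X`. -/
instance (X : EnvAlg k R S) (P : RelAlg k S) : Balanced (X ⊠ P) := ⟨by
  intro b hb x
  have h : b * inl X P (X.t x) = inl X P (X.t x) * b := by
    rw [mem_rel] at hb
    obtain ⟨y, rfl⟩ | ⟨b', -, rfl⟩ := hb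
    · rw [sub_mul, mul_sub, ← map_mul, ← map_mul, X.s_mul_t, tm_one_comm]
    · rw [tm_one_comm]
  change b * inl X P (X.t x) ∈ _
  rw [h]
  exact Ideal.mul_mem_left _ _ (Ideal.subset_span hb)⟩

theorem smul_cls {P : RelAlg k R} (p w : P) : p • cls P w = cls P (p * w) := rfl

theorem cls_smul_one {P : RelAlg k R} (p : P) : p • cls P 1 = cls P p := by
  rw [smul_cls, mul_one]

/-- The left action on a quotient by right multiplications. -/
def rmul (P : RelAlg k R) [Balanced P] (x : R) : Quo P →ₗ[k] Quo P :=
  Quo.lift ((cls P).comp (LinearMap.mulRight k (P.τ (op x)))) (by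
    intro w hw
    change cls P (w * P.τ (op x)) = 0
    rw [cls_eq_zero]
    induction hw using Submodule.span_induction with
    | mem b hb => exact Balanced.rel_mul_τ b hb _
    | zero => simp
    | add a b _ _ ha hb => rw [add_mul]; exact add_mem ha hb
    | smul c a _ ha => rw [smul_eq_mul, mul_assoc]; exact Ideal.mul_mem_left _ _ ha)

instance Quo.module (P : RelAlg k R) [Balanced P] : Module R (Quo P) where
  smul x q := rmul P x q
  one_smul q := by
    obtain ⟨w, rfl⟩ := cls_surjective P q
    change cls P (w * P.τ (op 1)) = _
    rw [op_one, map_one, mul_one]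
  mul_smul x y q := by
    obtain ⟨w, rfl⟩ := cls_surjective P q
    change cls P (w * P.τ (op (x * y))) = cls P (w * P.τ (op y) * P.τ (op x))
    rw [op_mul, map_mul P.τ, mul_assoc]
  smul_zero x := map_zero _
  smul_add x := map_add _
  add_smul x y q := by
    obtain ⟨w, rfl⟩ := cls_surjective P q
    change cls P (w * P.τ (op (x + y))) = cls P (w * P.τ (op x)) + cls P (w * P.τ (op y))
    rw [MulOpposite.op_add, map_add P.τ, mul_add, map_add]
  zero_smul q := by
    obtain ⟨w, rfl⟩ := cls_surjective P q
    change cls P (w * P.τ (op 0)) = 0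
    rw [MulOpposite.op_zero, map_zero P.τ, mul_zero, map_zero]

theorem base_smul_cls {P : RelAlg k R} [Balanced P] (x : R) (w : P) :
    x • cls P w = cls P (w * P.τ (op x)) := rfl

instance Quo.smulCommClass (P : RelAlg k R) [Balanced P] : SMulCommClass P R (Quo P) where
  smul_comm p x q := by
    obtain ⟨w, rfl⟩ := cls_surjective P q
    rw [base_smul_cls, smul_cls, smul_cls, base_smul_cls, mul_assoc]

instance Quo.isScalarTower (P : RelAlg k R) [Balanced P] : IsScalarTower k R (Quo P) where
  smul_assoc c x q := by
    obtain ⟨w, rfl⟩ := cls_surjective P q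
    rw [base_smul_cls, base_smul_cls, op_smul, map_smul, mul_smul_comm, map_smul]

instance (X : EnvAlg k R S) : Module R (Quo X.last) := Quo.module X.last

instance (X : EnvAlg k R S) : IsScalarTower k R (Quo X.last) :=
  Quo.isScalarTower X.last

/-- The pure tensor `x ⊗ q`. -/
def ten {X : EnvAlg k R S} {P : RelAlg k S} : X →ₗ[k] Quo P →ₗ[k] Quo (X ⊠ P) :=
  ((Algebra.lsmul k k (Quo (X ⊠ P))).toLinearMap.comp (inl X P).toLinearMap).compl₂
    (Quo.map (inr X P) (inr_mem X P))

theorem ten_cls {X : EnvAlg k R S} {P : RelAlg k S} (x : X) (p : P) :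
    ten x (cls P p) = cls (X ⊠ P) (tm x p) := by
  change cls (X ⊠ P) (inl X P x * inr X P p) = _
  rw [inl_apply, inr_apply, tm_mul_tm, one_mul, mul_one]

theorem ten_induction {X : EnvAlg k R S} {P : RelAlg k S} {C : Quo (X ⊠ P) → Prop} (u)
    (h1 : ∀ x q, C (ten x q)) (h2 : ∀ a b, C a → C b → C (a + b)) : C u := by
  obtain ⟨w, rfl⟩ := cls_surjective _ u
  induction w using tm_induction with
  | h0 =>
    have := h1 0 0
    rwa [map_zero, ← map_zero (cls (X ⊠ P))] at this
  | h1 x p => rw [← ten_cls]; exact h1 _ _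
  | h2 a b ha hb => rw [map_add]; exact h2 _ _ ha hb

theorem ten_smul {X : EnvAlg k R S} {P : RelAlg k S} [Balanced P] (x : X) (y : S) (q : Quo P) :
    ten x (y • q) = ten (x * X.s y) q := by
  obtain ⟨w, rfl⟩ := cls_surjective _ q
  rw [base_smul_cls, ten_cls, ten_cls, balance]

theorem smul_ten {X : EnvAlg k R S} {P : RelAlg k S} (r : R) (x : X) (q : Quo P) :
    r • ten x q = ten (x * X.t (op r)) q := by
  obtain ⟨w, rfl⟩ := cls_surjective _ q
  rw [ten_cls, ten_cls, base_smul_cls]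
  congr 1
  exact (tm_mul_tm x (X.t (op r)) w 1).trans (by rw [mul_one])

theorem tm_smul_ten {X : EnvAlg k R S} {P : RelAlg k S} (x x' : X) (p : P) (q : Quo P) :
    (tm x p : (X ⊠ P).carrier) • ten x' q = ten (x * x') (p • q) := by
  obtain ⟨w, rfl⟩ := cls_surjective _ q
  rw [ten_cls, smul_cls, smul_cls, ten_cls, tm_mul_tm]

theorem inl_smul_ten {X : EnvAlg k R S} {P : RelAlg k S} (x x' : X) (q : Quo P) :
    inl X P x • ten x' q = ten (x * x') q := by
  rw [inl_apply, tm_smul_ten, one_smul]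

theorem inr_smul_ten {X : EnvAlg k R S} {P : RelAlg k S} (x' : X) (p : P) (q : Quo P) :
    inr X P p • ten x' q = ten x' (p • q) := by
  rw [inr_apply, tm_smul_ten, one_mul]

/-- The linear map given by a balanced bilinear map. -/
def tlift {X : EnvAlg k R S} {P : RelAlg k S} [Balanced P] {V : Type v} [AddCommGroup V]
    [Module k V] (f : X →ₗ[k] Quo P →ₗ[k] V) (hf : ∀ x y q, f (x * X.s y) q = f x (y • q)) :
    Quo (X ⊠ P) →ₗ[k] V :=
  Quo.lift (lift (f.compl₂ (cls P))) (by
    intro w hw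
    refine smul_span_induction _ ?_ hw
    intro b hb c
    induction c using tm_induction with
    | h0 => rw [zero_mul, map_zero]
    | h2 c d hc hd => rw [add_mul, map_add, hc, hd, add_zero]
    | h1 x p =>
      rw [mem_rel] at hb
      obtain ⟨y, rfl⟩ | ⟨b, hb, rfl⟩ := hb
      · rw [mul_sub, inl_apply, inr_apply, tm_mul_tm, tm_mul_tm, mul_one, mul_one, map_sub,
          lift_tm, lift_tm, LinearMap.compl₂_apply, LinearMap.compl₂_apply, hf, base_smul_cls,
          sub_self]
      · rw [inr_apply, tm_mul_tm, lift_tm, LinearMap.compl₂_apply,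
          cls_eq_zero.2 (Ideal.mul_mem_left _ _ (Ideal.subset_span hb)), map_zero])

theorem tlift_ten {X : EnvAlg k R S} {P : RelAlg k S} [Balanced P] {V : Type v} [AddCommGroup V]
    [Module k V] (f : X →ₗ[k] Quo P →ₗ[k] V) (hf : ∀ x y q, f (x * X.s y) q = f x (y • q))
    (x : X) (q : Quo P) : tlift f hf (ten x q) = f x q := by
  obtain ⟨w, rfl⟩ := cls_surjective _ q
  rw [ten_cls]
  rfl

/-- A `k`-linear map on a balanced tensor product that is `R`-linear on pure tensors. -/
def mkLin {X : EnvAlg k R S} {P : RelAlg k S} {V : Type v} [AddCommGroup V] [Module k V]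
    [Module R V] (f : Quo (X ⊠ P) →ₗ[k] V) (hf : ∀ r x q, f (ten (x * X.t (op r)) q) =
      r • f (ten x q)) : Quo (X ⊠ P) →ₗ[R] V where
  toFun := f
  map_add' := map_add f
  map_smul' r u := by
    induction u using ten_induction with
    | h1 x q => rw [smul_ten, hf, RingHom.id_apply]
    | h2 a b ha hb => rw [smul_add, map_add, ha, hb, map_add, smul_add]

theorem ten_map_smul (X : EnvAlg k R S) {P P' : RelAlg k S} [Balanced P] [Balanced P']
    (φ : Quo P →ₗ[S] Quo P') (x : X) (y : S) (q : Quo P) :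
    ten.compl₂ (φ.restrictScalars k) (x * X.s y) q =
      ten.compl₂ (φ.restrictScalars k) x (y • q) :=
  ((congrArg (ten x) (φ.map_smul y q)).trans (ten_smul x y _)).symm

/-- The map `x ⊗ q ↦ x ⊗ φ q`. -/
def wl (X : EnvAlg k R S) {P P' : RelAlg k S} [Balanced P] [Balanced P']
    (φ : Quo P →ₗ[S] Quo P') : Quo (X ⊠ P) →ₗ[R] Quo (X ⊠ P') :=
  mkLin (tlift (ten.compl₂ (φ.restrictScalars k)) (ten_map_smul X φ)) (by
    intro r x q
    rw [tlift_ten, tlift_ten]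
    exact (smul_ten r x _).symm)

theorem wl_ten (X : EnvAlg k R S) {P P' : RelAlg k S} [Balanced P] [Balanced P']
    (φ : Quo P →ₗ[S] Quo P') (x : X) (q : Quo P) : wl X φ (ten x q) = ten x (φ q) :=
  tlift_ten _ (ten_map_smul X φ) x q

theorem wl_wl (X : EnvAlg k R S) {P P' P'' : RelAlg k S} [Balanced P] [Balanced P'] [Balanced P'']
    (φ : Quo P →ₗ[S] Quo P') (ψ : Quo P' →ₗ[S] Quo P'') (u) :
    wl X ψ (wl X φ u) = wl X (ψ.comp φ) u := by
  induction u using ten_induction with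
  | h1 x q => rw [wl_ten, wl_ten, wl_ten, LinearMap.comp_apply]
  | h2 a b ha hb => simp only [map_add, ha, hb]

theorem wl_id (X : EnvAlg k R S) {P : RelAlg k S} [Balanced P] (u) :
    wl X (LinearMap.id : Quo P →ₗ[S] Quo P) u = u := by
  induction u using ten_induction with
  | h1 x q => rw [wl_ten, LinearMap.id_apply]
  | h2 a b ha hb => simp only [map_add, ha, hb]

theorem wl_congr (X : EnvAlg k R S) {P P' : RelAlg k S} [Balanced P] [Balanced P']
    {φ ψ : Quo P →ₗ[S] Quo P'} (h : ∀ q, φ q = ψ q) (u) : wl X φ u = wl X ψ u := by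
  rw [LinearMap.ext h]

/-- The map `x ↦ x ⊗ q`. -/
def jmap (X : EnvAlg k R S) {P : RelAlg k S} (q : Quo P) : Quo X.last →ₗ[R] Quo (X ⊠ P) where
  toFun := Quo.lift (P := X.last) (ten.flip q) (by
    intro w hw
    have hw : w ∈ (Ideal.span ∅ : Ideal X.carrier) := hw
    rw [Ideal.span_empty, Ideal.mem_bot] at hw
    rw [hw, map_zero])
  map_add' := map_add _
  map_smul' r u := by
    obtain ⟨x, rfl⟩ := cls_surjective _ u
    rw [base_smul_cls, Quo.lift_cls, Quo.lift_cls, LinearMap.flip_apply, LinearMap.flip_apply,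
      RingHom.id_apply, smul_ten]

theorem jmap_cls (X : EnvAlg k R S) {P : RelAlg k S} (q : Quo P) (x : X) :
    jmap X q (cls X.last x) = ten x q := rfl

theorem jmap_add (X : EnvAlg k R S) {P : RelAlg k S} (q q' : Quo P) (u) :
    jmap X (q + q') u = jmap X q u + jmap X q' u := by
  obtain ⟨x, rfl⟩ := cls_surjective _ u
  rw [jmap_cls, map_add]
  rfl

theorem wl_jmap (X : EnvAlg k R S) {P P' : RelAlg k S} [Balanced P] [Balanced P']
    (φ : Quo P →ₗ[S] Quo P') (q : Quo P) (u) : wl X φ (jmap X q u) = jmap X (φ q) u := by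
  obtain ⟨x, rfl⟩ := cls_surjective _ u
  rw [jmap_cls, jmap_cls, wl_ten]

theorem cls_last_injective (X : EnvAlg k R S) : Function.Injective (cls X.last) := by
  rw [← LinearMap.ker_eq_bot, LinearMap.ker_eq_bot']
  intro m hm
  have h : m ∈ (Ideal.span ∅ : Ideal X.carrier) := cls_eq_zero.1 hm
  rwa [Ideal.span_empty, Ideal.mem_bot] at h

/-! ### Maps that are compatible with multiplication -/

/-- The Takeuchi condition for an element. -/
def IsTak (P : RelAlg k R) (u : Quo P) : Prop := ∀ b ∈ P.rel, b • u = 0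

/-- An element of the left ideal is a sum of products `c * b` with `b` a relation, and `b` already
kills `u`. Hence on Takeuchi elements left multiplication depends only on the class of the
multiplier, which is what makes their product well defined. -/
theorem IsTak.smul_eq_zero {P : RelAlg k R} {u : Quo P} (hu : IsTak P u) {w : P}
    (hw : cls P w = 0) : w • u = 0 := by
  rw [cls_eq_zero] at hw
  induction hw using Submodule.span_induction with
  | mem b hb => exact hu b hb
  | zero => rw [zero_smul]
  | add a b _ _ ha hb => rw [add_smul, ha, hb, add_zero]
  | smul c a _ ha => rw [smul_assoc, ha, smul_zero]

theorem IsTak.smul_eq {P : RelAlg k R} {u : Quo P} (hu : IsTak P u) {w w' : P}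
    (hw : cls P w = cls P w') : w • u = w' • u := by
  rw [← sub_eq_zero, ← sub_smul]
  apply hu.smul_eq_zero
  rw [map_sub, hw, sub_self]

theorem isTak_last (X : EnvAlg k R S) (u : Quo X.last) : IsTak X.last u :=
  fun _ hb => hb.elim

theorem isTak_val {P : RelAlg k R} (p : Tak P) : IsTak P (val P p) := by
  obtain ⟨w, rfl⟩ := Ideal.Quotient.mk_surjective p
  intro b hb
  rw [val_mk, smul_cls, cls_eq_zero]
  exact w.2 b hb

theorem IsTak.exists_val {P : RelAlg k R} {u : Quo P} (hu : IsTak P u) : ∃ p, val P p = u := by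
  obtain ⟨w, rfl⟩ := cls_surjective _ u
  exact ⟨Ideal.Quotient.mk _ ⟨w, fun b hb => cls_eq_zero.1 (hu b hb)⟩, rfl⟩

theorem val_one {P : RelAlg k R} : val P 1 = cls P 1 := rfl

/-- The representative `w` of the left factor is arbitrary, since the right factor satisfies
Takeuchi's condition. -/
theorem val_mul {P : RelAlg k R} (p p' : Tak P) {w : P} (hw : cls P w = val P p) :
    val P (p * p') = w • val P p' := by
  obtain ⟨a, rfl⟩ := Ideal.Quotient.mk_surjective p
  rw [(isTak_val p').smul_eq (w' := a.1) hw]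
  obtain ⟨b, rfl⟩ := Ideal.Quotient.mk_surjective p'
  rfl

theorem toQuo_one {M : Type v} [Ring M] [Algebra k M] {P : RelAlg k R} (f : M →ₐ[k] Tak P) :
    toQuo f 1 = cls P 1 :=
  congrArg (val P) (map_one f)

theorem toQuo_mul {M : Type v} [Ring M] [Algebra k M] {P : RelAlg k R} (f : M →ₐ[k] Tak P)
    (x y : M) {w : P} (hw : cls P w = toQuo f x) : toQuo f (x * y) = w • toQuo f y :=
  (congrArg (val P) (map_mul f x y)).trans (val_mul _ _ hw)

/-- The algebra map to the Takeuchi product given by a multiplicative linear map. -/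
noncomputable def takAlg {M : Type v} [Ring M] [Algebra k M] {P : RelAlg k R} (f : M →ₗ[k] Quo P)
    (h1 : f 1 = cls P 1) (ht : ∀ x, IsTak P (f x))
    (hm : ∀ x y, ∃ w, cls P w = f x ∧ f (x * y) = w • f y) : M →ₐ[k] Tak P :=
  -- The preimages are unique because `val` is injective, so the chosen ones depend on `x`
  -- additively and multiplicatively.
  have hc : ∀ x, val P (ht x).exists_val.choose = f x := fun x => (ht x).exists_val.choose_spec
  AlgHom.ofLinearMap
    { toFun := fun x => (ht x).exists_val.choose
      map_add' := fun x y => val_injective ((hc (x + y)).trans (by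
        rw [map_add (val P), hc x, hc y, map_add]))
      map_smul' := fun c x => val_injective ((hc (c • x)).trans (by
        rw [map_smul (val P), hc x, map_smul]; rfl)) }
    (val_injective ((hc 1).trans (h1.trans val_one.symm)))
    (fun x y => val_injective ((hc (x * y)).trans (by
      obtain ⟨w, hw, h⟩ := hm x y
      change _ = val P ((ht x).exists_val.choose * (ht y).exists_val.choose)
      rw [val_mul (w := w), hc y, h]
      rw [hc x, hw])))

theorem toQuo_takAlg {M : Type v} [Ring M] [Algebra k M] {P : RelAlg k R} (f : M →ₗ[k] Quo P)
    (h1 : f 1 = cls P 1) (ht : ∀ x, IsTak P (f x))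
    (hm : ∀ x y, ∃ w, cls P w = f x ∧ f (x * y) = w • f y) (x : M) :
    toQuo (takAlg f h1 ht hm) x = f x :=
  (ht x).exists_val.choose_spec

/-- A map of balanced tensor products is multiplicative if it preserves `1`, intertwines left
multiplications, and respects the left multiplications by `τ` and by the relations. -/
structure Mult {P P' : RelAlg k R} [Balanced P] [Balanced P'] (φ : Quo P →ₗ[R] Quo P') : Prop where
  one : φ (cls P 1) = cls P' 1
  mul : ∀ p : P, ∃ p' : P', ∀ u, φ (p • u) = p' • φ u
  tau : ∀ x u, φ (P.τ x • u) = P'.τ x • φ u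
  rel : ∀ b' ∈ P'.rel, ∃ b ∈ insert 0 P.rel, ∀ u, b' • φ u = φ (b • u)

namespace Mult

variable {P P' P'' : RelAlg k R} [Balanced P] [Balanced P'] [Balanced P'']
  {φ : Quo P →ₗ[R] Quo P'} {ψ : Quo P' →ₗ[R] Quo P''}

/-- Each relation of the target acts on the image through a relation of the source, or as zero; this
is the purpose of the field `rel`. -/
theorem isTak (h : Mult φ) {u : Quo P} (hu : IsTak P u) : IsTak P' (φ u) := by
  intro b' hb'
  obtain ⟨b, hb, hbu⟩ := h.rel b' hb'
  rw [hbu]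
  obtain rfl | hb := hb
  · rw [zero_smul, map_zero]
  · rw [hu b hb, map_zero]

/-- The multiplier provided by `mul` represents `φ` of the class of `p`, as one sees by applying it
to $1$. -/
theorem exists_lift (h : Mult φ) (p : P) :
    ∃ p' : P', cls P' p' = φ (cls P p) ∧ ∀ u, φ (p • u) = p' • φ u := by
  obtain ⟨p', hp'⟩ := h.mul p
  refine ⟨p', ?_, hp'⟩
  rw [← cls_smul_one p, hp', h.one, cls_smul_one]

theorem map_smul (h : Mult φ) {p : P} {p' : P'} (hp : cls P' p' = φ (cls P p)) {u : Quo P}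
    (hu : IsTak P' (φ u)) : φ (p • u) = p' • φ u := by
  obtain ⟨q, hq, hqu⟩ := h.exists_lift p
  rw [hqu]
  exact hu.smul_eq (hq.trans hp.symm)

theorem comp (h' : Mult ψ) (h : Mult φ) : Mult (ψ.comp φ) where
  one := by rw [LinearMap.comp_apply, h.one, h'.one]
  mul p := by
    obtain ⟨p', hp⟩ := h.mul p
    obtain ⟨p'', hp'⟩ := h'.mul p'
    exact ⟨p'', fun u => by rw [LinearMap.comp_apply, hp, hp', LinearMap.comp_apply]⟩
  tau x u := by rw [LinearMap.comp_apply, h.tau, h'.tau, LinearMap.comp_apply]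
  rel b'' hb'' := by
    obtain ⟨b', hb', hbu'⟩ := h'.rel b'' hb''
    obtain rfl | hb' := hb'
    · exact ⟨0, Or.inl rfl, fun u => by
        rw [LinearMap.comp_apply, hbu', zero_smul, zero_smul, map_zero, map_zero]⟩
    · obtain ⟨b, hb, hbu⟩ := h.rel b' hb'
      exact ⟨b, hb, fun u => by
        rw [LinearMap.comp_apply, hbu', hbu, LinearMap.comp_apply]⟩

/-- The equalizer of two multiplicative maps is closed under products of Takeuchi elements. This
makes $M\bullet N$ a subalgebra. -/
theorem eq_smul {φ' : Quo P →ₗ[R] Quo P'} (h : Mult φ) (h' : Mult φ') {p : P}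
    (hp : φ (cls P p) = φ' (cls P p)) {u : Quo P} (hu : IsTak P u) (huu : φ u = φ' u) :
    φ (p • u) = φ' (p • u) := by
  obtain ⟨q, hq, hqu⟩ := h.exists_lift p
  obtain ⟨q', hq', hqu'⟩ := h'.exists_lift p
  rw [hqu, hqu', huu]
  exact (h'.isTak hu).smul_eq (by rw [hq, hq', hp])

/-- If `ψ ∘ φ` and the injection `ψ` are multiplicative, then so is `φ`. -/
theorem of_injective (h' : Mult ψ) (hi : Function.Injective ψ) (h : Mult (ψ.comp φ))
    (hP : ∀ u, IsTak P u) : Mult φ := by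
  have ht : ∀ u, IsTak P'' (ψ (φ u)) := fun u => h.isTak (hP u)
  -- An injective multiplicative `ψ` reflects Takeuchi's condition: the image of a relation is
  -- represented by an element of class zero, which kills the Takeuchi element `ψ (φ u)`.
  have ht' : ∀ u, IsTak P' (φ u) := by
    intro u b hb
    obtain ⟨p, hp, hpu⟩ := h'.exists_lift b
    apply hi
    rw [hpu, map_zero]
    apply (ht u).smul_eq_zero
    rw [hp, cls_eq_zero.2 (Ideal.subset_span hb), map_zero]
  refine ⟨hi ?_, fun p => ?_, fun x u => hi ?_, fun b' hb' => ⟨0, Or.inl rfl, fun u => ?_⟩⟩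
  · rw [h'.one]
    exact h.one
  · obtain ⟨p', hp'⟩ := cls_surjective _ (φ (cls P p))
    refine ⟨p', fun u => hi ?_⟩
    obtain ⟨q, hq, hqu⟩ := h'.exists_lift p'
    rw [hqu]
    exact h.map_smul (by rw [hq, hp']; rfl) (ht u)
  · rw [h'.tau]
    exact h.tau x u
  · rw [ht' u b' hb', zero_smul, map_zero]

/-- Tensoring on the left adds one kind of relation, $s(y)\otimes1-1\otimes\tau(y)$. It is
transported to the relation of the same form because `φ` respects `τ`, which is why `tau` belongs to
`Mult`. -/
theorem wl (X : EnvAlg k T R) (h : Mult φ) : Mult (wl X φ) where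
  one := by
    rw [one_def, ← ten_cls, wl_ten, h.one, ten_cls, one_def]
  mul p := by
    induction p using tm_induction with
    | h0 => exact ⟨0, fun u => by rw [zero_smul, map_zero, zero_smul]⟩
    | h1 x p =>
      obtain ⟨p', hp⟩ := h.mul p
      refine ⟨tm x p', fun u => ?_⟩
      induction u using ten_induction with
      | h1 y q => rw [tm_smul_ten, wl_ten, wl_ten, tm_smul_ten, hp]
      | h2 a b ha hb => simp only [smul_add, map_add, ha, hb]
    | h2 a b ha hb =>
      obtain ⟨a', ha⟩ := ha
      obtain ⟨b', hb⟩ := hb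
      exact ⟨a' + b', fun u => by rw [add_smul, map_add, ha, hb, add_smul]⟩
  tau x u := by
    change Takeuchi.wl X φ (inl X P (X.t x) • u) = inl X P' (X.t x) • _
    induction u using ten_induction with
    | h1 y q => rw [inl_smul_ten, wl_ten, wl_ten, inl_smul_ten]
    | h2 a b ha hb => simp only [smul_add, map_add, ha, hb]
  rel b' hb' := by
    rw [mem_rel] at hb'
    obtain ⟨y, rfl⟩ | ⟨b', hb', rfl⟩ := hb'
    · refine ⟨inl X P (X.s y) - inr X P (P.τ (op y)), Or.inr (mem_rel.2 (Or.inl ⟨y, rfl⟩)), ?_⟩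
      intro u
      induction u using ten_induction with
      | h1 y q =>
        simp only [sub_smul, inl_smul_ten, inr_smul_ten, wl_ten, map_sub, h.tau]
      | h2 a b ha hb => simp only [smul_add, map_add, ha, hb]
    · obtain ⟨b, hb, hbu⟩ := h.rel b' hb'
      refine ⟨inr X P b, ?_, fun u => ?_⟩
      · obtain rfl | hb := hb
        · exact Or.inl (map_zero _)
        · exact Or.inr (mem_rel.2 (Or.inr ⟨b, hb, rfl⟩))
      · induction u using ten_induction with
        | h1 y q => rw [inr_smul_ten, wl_ten, wl_ten, inr_smul_ten, hbu]
        | h2 a b ha hb => simp only [smul_add, map_add, ha, hb]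

end Mult

/-- A multiplicative map intertwines the multiplications by `x` and by any lift of its image. -/
theorem Mult.last_smul {X : EnvAlg k R S} {P : RelAlg k R} [Balanced P]
    {φ : Quo X.last →ₗ[R] Quo P} (h : Mult φ) (x y : X) {w : P}
    (hw : cls P w = φ (cls X.last x)) : φ (cls X.last (x * y)) = w • φ (cls X.last y) :=
  h.map_smul (p := (x : X.last.carrier)) (u := cls X.last y) hw (h.isTak (isTak_last X _))

end Tower

/-! ### Maps to Takeuchi products and their extensions -/

section Hom

variable {k : Type u} [CommRing k]
variable {R S T Q : Type v} [Ring R] [Algebra k R] [Ring S] [Algebra k S] [Ring T] [Algebra k T]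
  [Ring Q] [Algebra k Q]

theorem wl_jmap_add (X : EnvAlg k R S) {Y : EnvAlg k S T} {P : RelAlg k T} [Balanced P]
    (q q' : Quo P) (u) :
    wl X (jmap Y (q + q')) u = wl X (jmap Y q) u + wl X (jmap Y q') u := by
  induction u using ten_induction with
  | h1 x q => rw [wl_ten, wl_ten, wl_ten, jmap_add, map_add]
  | h2 a b ha hb => rw [map_add, ha, hb, map_add, map_add]; abel

theorem wl_jmap_smul (X : EnvAlg k R S) {Y : EnvAlg k S T} {P : RelAlg k T} [Balanced P]
    (c : k) (q : Quo P) (u) : wl X (jmap Y (c • q)) u = c • wl X (jmap Y q) u := by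
  induction u using ten_induction with
  | h1 x y =>
    obtain ⟨y, rfl⟩ := cls_surjective _ y
    rw [wl_ten, wl_ten, jmap_cls, jmap_cls, map_smul, map_smul]
  | h2 a b ha hb => rw [map_add, ha, hb, map_add, smul_add]

/-- Right multiplication by `s y`. -/
def EnvAlg.rs (X : EnvAlg k R S) (y : S) : Quo X.last →ₗ[R] Quo X.last where
  toFun := Quo.lift (P := X.last) ((cls X.last).comp (LinearMap.mulRight k (X.s y))) (by
    intro w hw
    have hw : w ∈ (Ideal.span ∅ : Ideal X.carrier) := hw
    rw [Ideal.span_empty, Ideal.mem_bot] at hw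
    rw [hw, map_zero])
  map_add' := map_add _
  map_smul' r u := by
    obtain ⟨x, rfl⟩ := cls_surjective _ u
    change cls X.last (x * X.t (op r) * X.s y) = cls X.last (x * X.s y * X.t (op r))
    rw [mul_assoc, mul_assoc, X.s_mul_t]

theorem EnvAlg.rs_cls (X : EnvAlg k R S) (y : S) (x : X) :
    X.rs y (cls X.last x) = cls X.last (x * X.s y) := rfl

theorem jmap_rs (X : EnvAlg k R S) {P : RelAlg k S} [Balanced P] (y : S) (q : Quo P) (u) :
    jmap X q (X.rs y u) = jmap X (y • q) u := by
  obtain ⟨x, rfl⟩ := cls_surjective _ u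
  rw [X.rs_cls, jmap_cls, jmap_cls, ten_smul]

theorem tm_smul_jmap (X : EnvAlg k R S) {P : RelAlg k S} (x : X.last) (p : P)
    (q : Quo P) (u) : (tm (X := X) x p) • jmap X q u = jmap X (p • q) (x • u) := by
  obtain ⟨y, rfl⟩ := cls_surjective _ u
  rw [jmap_cls, tm_smul_ten]
  rfl

/-- A map of algebras over `Rᵒ ⊗ T` from `X` to the Takeuchi product of `X₁` and `X₂`. -/
structure TakHom (X : EnvAlg k R T) (X₁ : EnvAlg k R S) (X₂ : EnvAlg k S T) where
  toAlg : X.carrier →ₐ[k] Tak (X₁ ⊠ X₂.last)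
  map_t : ∀ x, toQuo toAlg (X.t x) = cls (X₁ ⊠ X₂.last) (tm (P := X₂.last) (X₁.t x) 1)
  map_s : ∀ x, toQuo toAlg (X.s x) = cls (X₁ ⊠ X₂.last) (tm (P := X₂.last) 1 (X₂.s x))

namespace TakHom

variable {X : EnvAlg k R T} {X₁ : EnvAlg k R S} {X₂ : EnvAlg k S T} (f : TakHom X X₁ X₂)

/-- The underlying linear map to the balanced tensor product. -/
def fin : Quo X.last →ₗ[R] Quo (X₁ ⊠ X₂.last) where
  toFun := Quo.lift (P := X.last) (toQuo f.toAlg) (by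
    intro w hw
    have hw : w ∈ (Ideal.span ∅ : Ideal X.carrier) := hw
    rw [Ideal.span_empty, Ideal.mem_bot] at hw
    rw [hw, map_zero])
  map_add' := map_add _
  map_smul' r u := by
    obtain ⟨x, rfl⟩ := cls_surjective _ u
    obtain ⟨w, hw⟩ := cls_surjective _ (toQuo f.toAlg x)
    change toQuo f.toAlg (x * X.t (op r)) = r • toQuo f.toAlg x
    rw [toQuo_mul f.toAlg _ _ hw, f.map_t, smul_cls, ← hw]
    rfl

theorem fin_cls (x : X) : f.fin (cls X.last x) = toQuo f.toAlg x := rfl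

/-- On a single factor there are no relations, so each relation of the target has to act as zero on
the image. It does, as the image lies in the Takeuchi product. -/
theorem fin_mult : Mult f.fin where
  one := toQuo_one _
  mul p := by
    obtain ⟨w, hw⟩ := cls_surjective _ (toQuo f.toAlg p)
    refine ⟨w, fun u => ?_⟩
    obtain ⟨x, rfl⟩ := cls_surjective _ u
    exact toQuo_mul f.toAlg p x hw
  tau y u := by
    obtain ⟨x, rfl⟩ := cls_surjective _ u
    exact toQuo_mul f.toAlg (X.t y) x (f.map_t y).symm
  rel b' hb' := by
    refine ⟨0, Or.inl rfl, fun u => ?_⟩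
    obtain ⟨x, rfl⟩ := cls_surjective _ u
    rw [zero_smul, map_zero]
    exact isTak_val _ b' hb'

theorem isTak (u) : IsTak _ (f.fin u) := f.fin_mult.isTak (isTak_last X u)

theorem fin_s_mul (y : T) (x : X) : f.fin (cls X.last (X.s y * x)) =
    inr X₁ X₂.last (X₂.s y) • f.fin (cls X.last x) :=
  toQuo_mul f.toAlg (X.s y) x (f.map_s y).symm

/-- Since $f(x\,s(y))=f(x)\,(1\otimes s(y))$, the map is linear for the right actions on the last
factor. This is the balancing condition for the extension of `f` by further factors. -/
theorem fin_rs (y : T) (u) : f.fin (X.rs y u) = wl X₁ (X₂.rs y) (f.fin u) := by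
  obtain ⟨x, rfl⟩ := cls_surjective _ u
  obtain ⟨w, hw⟩ := cls_surjective _ (f.fin (cls X.last x))
  rw [X.rs_cls, ← hw]
  refine (toQuo_mul f.toAlg x (X.s y) hw).trans ?_
  rw [f.map_s, smul_cls]
  clear hw
  induction w using tm_induction with
  | h0 => rw [zero_mul, map_zero, map_zero]
  | h1 a b =>
    rw [tm_mul_tm, ← ten_cls, ← ten_cls, wl_ten, mul_one]
    rfl
  | h2 a b ha hb => rw [add_mul, map_add, map_add, map_add, ha, hb]

/-- The bilinear map `(x, q) ↦ f x ⊗ q`. -/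
def extBilin (P : RelAlg k T) [Balanced P] : X →ₗ[k] Quo P →ₗ[k] Quo (X₁ ⊠ X₂ ⊠ P) :=
  LinearMap.mk₂ k (fun x q => wl X₁ (jmap X₂ q) (f.fin (cls X.last x)))
    (fun x y q => by rw [map_add, map_add, map_add])
    (fun c x q => by
      rw [map_smul]
      exact (congrArg _ (f.fin.map_smul_of_tower c _)).trans ((wl X₁ _).map_smul_of_tower c _))
    (fun x q q' => wl_jmap_add X₁ q q' _)
    (fun c x q => wl_jmap_smul X₁ c q _)

theorem extBilin_balanced (P : RelAlg k T) [Balanced P] (x : X) (y : T) (q : Quo P) :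
    f.extBilin P (x * X.s y) q = f.extBilin P x (y • q) := by
  change wl X₁ (jmap X₂ q) (f.fin (X.rs y (cls X.last x))) = wl X₁ (jmap X₂ (y • q)) _
  rw [f.fin_rs, wl_wl]
  refine wl_congr _ (fun u => ?_) _
  rw [LinearMap.comp_apply, jmap_rs]

/-- The extension `x ⊗ q ↦ f x ⊗ q`. -/
def ext (P : RelAlg k T) [Balanced P] : Quo (X ⊠ P) →ₗ[R] Quo (X₁ ⊠ X₂ ⊠ P) :=
  mkLin (tlift (f.extBilin P) (f.extBilin_balanced P)) (by
    intro r x q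
    rw [tlift_ten, tlift_ten]
    change wl X₁ (jmap X₂ q) (f.fin (r • cls X.last x)) = _
    rw [map_smul, map_smul]
    rfl)

theorem ext_ten {P : RelAlg k T} [Balanced P] (x : X) (q : Quo P) :
    f.ext P (ten x q) = wl X₁ (jmap X₂ q) (f.fin (cls X.last x)) :=
  tlift_ten _ (f.extBilin_balanced P) x q

theorem ext_jmap {P : RelAlg k T} [Balanced P] (u) (q : Quo P) :
    f.ext P (jmap X q u) = wl X₁ (jmap X₂ q) (f.fin u) := by
  obtain ⟨x, rfl⟩ := cls_surjective _ u
  exact f.ext_ten x q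

theorem ext_wl {P P' : RelAlg k T} [Balanced P] [Balanced P'] (φ : Quo P →ₗ[T] Quo P') (u) :
    f.ext P' (wl X φ u) = wl X₁ (wl X₂ φ) (f.ext P u) := by
  induction u using ten_induction with
  | h1 x q =>
    rw [wl_ten, ext_ten, ext_ten, wl_wl]
    refine wl_congr _ (fun u => ?_) _
    rw [LinearMap.comp_apply, wl_jmap]
  | h2 a b ha hb => rw [map_add, map_add, ha, hb, map_add, map_add]

/-- The target has one more balancing than the source. The new relation between `X₁` and `X₂` acts
as zero, because `f` takes values in the Takeuchi product; the others come from relations of the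
source. -/
theorem ext_mult (P : RelAlg k T) [Balanced P] : Mult (f.ext P) where
  one := by
    have h : f.fin (cls X.last 1) = ten 1 (cls X₂.last 1) :=
      f.fin_mult.one.trans (ten_cls (P := X₂.last) 1 1).symm
    rw [one_def, ← ten_cls, f.ext_ten, h, wl_ten, jmap_cls, ten_cls, ten_cls]
    rfl
  mul p := by
    induction p using tm_induction with
    | h0 => exact ⟨0, fun u => by rw [zero_smul, map_zero, zero_smul]⟩
    | h1 x p =>
      -- For $w=\sum a\otimes b$ the multiplier is $\sum a\otimes b\otimes p$; it depends neither on
      -- `q` nor on `v`.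
      have key : ∀ w : (X₁ ⊠ X₂.last).carrier, ∃ p' : (X₁ ⊠ X₂ ⊠ P).carrier, ∀ (q : Quo P) v,
          wl X₁ (jmap X₂ (p • q)) (w • v) = p' • wl X₁ (jmap X₂ q) v := by
        intro w
        induction w using tm_induction with
        | h0 => exact ⟨0, fun q v => by rw [zero_smul, map_zero, zero_smul]⟩
        | h1 a b =>
          refine ⟨tm a (tm (X := X₂) b p), fun q v => ?_⟩
          induction v using ten_induction with
          | h1 c d => rw [tm_smul_ten, wl_ten, wl_ten, tm_smul_ten, tm_smul_jmap]
          | h2 a b ha hb => simp only [smul_add, map_add, ha, hb]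
        | h2 a b ha hb =>
          obtain ⟨a', ha⟩ := ha
          obtain ⟨b', hb⟩ := hb
          exact ⟨a' + b', fun q v => by rw [add_smul, map_add, ha, hb, add_smul]⟩
      obtain ⟨w, hw⟩ := f.fin_mult.mul (x : X.last.carrier)
      obtain ⟨p', hp'⟩ := key w
      refine ⟨p', fun u => ?_⟩
      induction u using ten_induction with
      | h1 y q =>
        rw [tm_smul_ten, f.ext_ten, f.ext_ten, ← hp', ← hw]
        rfl
      | h2 a b ha hb => simp only [smul_add, map_add, ha, hb]
    | h2 a b ha hb =>
      obtain ⟨a', ha⟩ := ha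
      obtain ⟨b', hb⟩ := hb
      exact ⟨a' + b', fun u => by rw [add_smul, map_add, ha, hb, add_smul]⟩
  tau y u := by
    change f.ext P (inl X P (X.t y) • u) = inl X₁ (X₂ ⊠ P) (X₁.t y) • f.ext P u
    have key : ∀ (q : Quo P) v, wl X₁ (jmap X₂ q) (inl X₁ X₂.last (X₁.t y) • v) =
        inl X₁ (X₂ ⊠ P) (X₁.t y) • wl X₁ (jmap X₂ q) v := by
      intro q v
      induction v using ten_induction with
      | h1 c d => rw [inl_smul_ten, wl_ten, wl_ten, inl_smul_ten]
      | h2 a b ha hb => simp only [smul_add, map_add, ha, hb]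
    induction u using ten_induction with
    | h1 x q =>
      rw [inl_smul_ten, f.ext_ten, f.ext_ten, ← key]
      exact congrArg _ (f.fin_mult.tau y (cls X.last x))
    | h2 a b ha hb => simp only [smul_add, map_add, ha, hb]
  rel b' hb' := by
    have hinl : ∀ (a : X₁) (q : Quo P) v,
        inl X₁ (X₂ ⊠ P) a • wl X₁ (jmap X₂ q) v =
          wl X₁ (jmap X₂ q) (inl X₁ X₂.last a • v) := by
      intro a q v
      induction v using ten_induction with
      | h1 c d => simp only [inl_smul_ten, wl_ten]
      | h2 a b ha hb => simp only [smul_add, map_add, ha, hb]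
    have hinl' : ∀ (a : X₂) (q : Quo P) v,
        inr X₁ (X₂ ⊠ P) (inl X₂ P a) • wl X₁ (jmap X₂ q) v =
          wl X₁ (jmap X₂ q) (inr X₁ X₂.last a • v) := by
      intro a q v
      induction v using ten_induction with
      | h1 c d =>
        rw [inr_smul_ten, wl_ten, wl_ten, inr_smul_ten, inl_apply, tm_smul_jmap, one_smul]
      | h2 a b ha hb => simp only [smul_add, map_add, ha, hb]
    have hinr : ∀ (p : P) (q : Quo P) v,
        inr X₁ (X₂ ⊠ P) (inr X₂ P p) • wl X₁ (jmap X₂ q) v = wl X₁ (jmap X₂ (p • q)) v := by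
      intro p q v
      induction v using ten_induction with
      | h1 c d => rw [wl_ten, wl_ten, inr_smul_ten, inr_apply, tm_smul_jmap, one_smul]
      | h2 a b ha hb => simp only [smul_add, map_add, ha, hb]
    rw [mem_rel] at hb'
    obtain ⟨y, rfl⟩ | ⟨b', hb', rfl⟩ := hb'
    · refine ⟨0, Or.inl rfl, fun u => ?_⟩
      rw [zero_smul, map_zero]
      induction u using ten_induction with
      | h1 x q =>
        have h : (X₂ ⊠ P).τ (op y) = inl X₂ P (X₂.t (op y)) := rfl
        rw [f.ext_ten, sub_smul, h, hinl, hinl', ← map_sub, ← sub_smul]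
        have := f.isTak (cls X.last x) _ (mem_rel.2 (Or.inl ⟨y, rfl⟩))
        exact (congrArg _ this).trans (map_zero _)
      | h2 a b ha hb => rw [map_add, smul_add, ha, hb, add_zero]
    · rw [mem_rel] at hb'
      obtain ⟨y, rfl⟩ | ⟨b', hb', rfl⟩ := hb'
      -- The relation between `X₂` and `P` corresponds to the one between `X` and `P`, because
      -- $f(s(y)x)=(1\otimes s(y))f(x)$.
      · refine ⟨inl X P (X.s y) - inr X P (P.τ (op y)), Or.inr (mem_rel.2 (Or.inl ⟨y, rfl⟩)),
          fun u => ?_⟩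
        induction u using ten_induction with
        | h1 x q =>
          rw [map_sub, sub_smul, f.ext_ten, hinl', hinr, sub_smul, inl_smul_ten, inr_smul_ten,
            map_sub, f.ext_ten, f.ext_ten, f.fin_s_mul]
        | h2 a b ha hb => rw [map_add, smul_add, ha, hb, smul_add, map_add]
      · refine ⟨inr X P b', Or.inr (mem_rel.2 (Or.inr ⟨b', hb', rfl⟩)), fun u => ?_⟩
        induction u using ten_induction with
        | h1 x q => rw [f.ext_ten, hinr, inr_smul_ten, f.ext_ten]
        | h2 a b ha hb => rw [map_add, smul_add, ha, hb, smul_add, map_add]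

end TakHom

/-- A map of algebras over `Rᵒ ⊗ S`. -/
structure EnvHom (X Y : EnvAlg k R S) where
  toAlg : X.carrier →ₐ[k] Y.carrier
  map_t : ∀ x, toAlg (X.t x) = Y.t x
  map_s : ∀ x, toAlg (X.s x) = Y.s x

namespace EnvHom

variable {X Y : EnvAlg k R S} (f : EnvHom X Y)

/-- The underlying linear map. -/
def fin : Quo X.last →ₗ[R] Quo Y.last where
  toFun := Quo.lift (P := X.last) ((cls Y.last).comp f.toAlg.toLinearMap) (by
    intro w hw
    have hw : w ∈ (Ideal.span ∅ : Ideal X.carrier) := hw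
    rw [Ideal.span_empty, Ideal.mem_bot] at hw
    rw [hw, map_zero])
  map_add' := map_add _
  map_smul' r u := by
    obtain ⟨x, rfl⟩ := cls_surjective _ u
    change cls Y.last (f.toAlg (x * X.t (op r))) = cls Y.last (f.toAlg x * Y.t (op r))
    rw [map_mul, f.map_t]

theorem fin_cls (x : X) : f.fin (cls X.last x) = cls Y.last (f.toAlg x) := rfl

theorem fin_mult : Mult f.fin where
  one := congrArg (cls Y.last) (map_one f.toAlg)
  mul p := ⟨f.toAlg p, fun u => by
    obtain ⟨x, rfl⟩ := cls_surjective _ u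
    exact congrArg (cls Y.last) (map_mul f.toAlg p x)⟩
  tau y u := by
    obtain ⟨x, rfl⟩ := cls_surjective _ u
    refine (congrArg (cls Y.last) (map_mul f.toAlg (X.t y) x)).trans ?_
    rw [f.map_t]
    rfl
  rel b' hb' := hb'.elim

theorem extBilin_balanced (P : RelAlg k S) [Balanced P] (x : X) (y : S) (q : Quo P) :
    (ten.comp f.toAlg.toLinearMap : X →ₗ[k] Quo P →ₗ[k] Quo (Y ⊠ P)) (x * X.s y) q =
      (ten.comp f.toAlg.toLinearMap : X →ₗ[k] Quo P →ₗ[k] Quo (Y ⊠ P)) x (y • q) := by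
  change ten (f.toAlg (x * X.s y)) q = ten (f.toAlg x) (y • q)
  rw [map_mul, f.map_s, ten_smul]

/-- The extension `x ⊗ q ↦ f x ⊗ q`. -/
def ext (P : RelAlg k S) [Balanced P] : Quo (X ⊠ P) →ₗ[R] Quo (Y ⊠ P) :=
  mkLin (tlift (ten.comp f.toAlg.toLinearMap) (f.extBilin_balanced P)) (by
    intro r x q
    rw [tlift_ten, tlift_ten]
    change ten (f.toAlg (x * X.t (op r))) q = r • ten (f.toAlg x) q
    rw [map_mul, f.map_t, smul_ten])

theorem ext_ten {P : RelAlg k S} [Balanced P] (x : X) (q : Quo P) :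
    f.ext P (ten x q) = ten (f.toAlg x) q :=
  tlift_ten _ (f.extBilin_balanced P) x q

theorem ext_jmap {P : RelAlg k S} [Balanced P] (u) (q : Quo P) :
    f.ext P (jmap X q u) = jmap Y q (f.fin u) := by
  obtain ⟨x, rfl⟩ := cls_surjective _ u
  exact f.ext_ten x q

theorem ext_wl {P P' : RelAlg k S} [Balanced P] [Balanced P'] (φ : Quo P →ₗ[S] Quo P') (u) :
    f.ext P' (wl X φ u) = wl Y φ (f.ext P u) := by
  induction u using ten_induction with
  | h1 x q => rw [wl_ten, ext_ten, ext_ten, wl_ten]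
  | h2 a b ha hb => rw [map_add, map_add, ha, hb, map_add, map_add]

theorem ext_mult (P : RelAlg k S) [Balanced P] : Mult (f.ext P) where
  one := by rw [one_def, ← ten_cls, ext_ten, map_one, ten_cls]; rfl
  mul p := by
    induction p using tm_induction with
    | h0 => exact ⟨0, fun u => by rw [zero_smul, map_zero, zero_smul]⟩
    | h1 x p =>
      refine ⟨tm (f.toAlg x) p, fun u => ?_⟩
      induction u using ten_induction with
      | h1 y q => rw [tm_smul_ten, ext_ten, ext_ten, tm_smul_ten, map_mul]
      | h2 a b ha hb => simp only [smul_add, map_add, ha, hb]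
    | h2 a b ha hb =>
      obtain ⟨a', ha⟩ := ha
      obtain ⟨b', hb⟩ := hb
      exact ⟨a' + b', fun u => by rw [add_smul, map_add, ha, hb, add_smul]⟩
  tau y u := by
    change f.ext P (inl X P (X.t y) • u) = inl Y P (Y.t y) • f.ext P u
    induction u using ten_induction with
    | h1 x q => rw [inl_smul_ten, ext_ten, ext_ten, inl_smul_ten, map_mul, f.map_t]
    | h2 a b ha hb => simp only [smul_add, map_add, ha, hb]
  rel b' hb' := by
    rw [mem_rel] at hb'
    obtain ⟨y, rfl⟩ | ⟨b', hb', rfl⟩ := hb'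
    · refine ⟨inl X P (X.s y) - inr X P (P.τ (op y)), Or.inr (mem_rel.2 (Or.inl ⟨y, rfl⟩)),
        fun u => ?_⟩
      induction u using ten_induction with
      | h1 x q =>
        simp only [sub_smul, inl_smul_ten, inr_smul_ten, ext_ten, map_sub, map_mul, f.map_s]
      | h2 a b ha hb => simp only [smul_add, map_add, ha, hb]
    · refine ⟨inr X P b', Or.inr (mem_rel.2 (Or.inr ⟨b', hb', rfl⟩)), fun u => ?_⟩
      induction u using ten_induction with
      | h1 x q => rw [inr_smul_ten, ext_ten, ext_ten, inr_smul_ten]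
      | h2 a b ha hb => simp only [smul_add, map_add, ha, hb]

end EnvHom

/-! ### Counits -/

/-- The bilinear map `(a, q) ↦ e a • q`. -/
def Bialgebroid.epsBilin (A : Bialgebroid k R) (P : RelAlg k R) [Balanced P] :
    A.carrier →ₗ[k] Quo P →ₗ[k] Quo P :=
  LinearMap.mk₂ k (fun a q => A.e a • q) (fun a b q => by rw [map_add, add_smul])
    (fun c a q => by rw [map_smul, smul_assoc]) (fun a q q' => smul_add _ _ _)
    (fun c a q => smul_comm _ _ _)

theorem Bialgebroid.epsBilin_balanced (A : Bialgebroid k R) (P : RelAlg k R) [Balanced P]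
    (a : A.carrier) (y : R) (q : Quo P) :
    A.epsBilin P (a * A.s y) q = A.epsBilin P a (y • q) := by
  change A.e (a * A.s y) • q = A.e a • y • q
  rw [A.e_mul_s, mul_smul]

/-- The map `a ⊗ q ↦ e a • q`. -/
def Bialgebroid.eps (A : Bialgebroid k R) (P : RelAlg k R) [Balanced P] :
    Quo (A.toEnvAlg ⊠ P) →ₗ[R] Quo P :=
  mkLin (tlift (A.epsBilin P) (A.epsBilin_balanced P)) (by
    intro r a q
    rw [tlift_ten, tlift_ten]
    change A.e (a * A.t (op r)) • q = r • A.e a • q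
    rw [A.e_mul_t, mul_smul])

theorem Bialgebroid.eps_ten (A : Bialgebroid k R) {P : RelAlg k R} [Balanced P] (a : A.carrier)
    (q : Quo P) : A.eps P (ten a q) = A.e a • q :=
  tlift_ten _ (A.epsBilin_balanced P) a q

theorem Bialgebroid.eps_wl (A : Bialgebroid k R) {P P' : RelAlg k R} [Balanced P] [Balanced P']
    (φ : Quo P →ₗ[R] Quo P') (u) : A.eps P' (wl A.toEnvAlg φ u) = φ (A.eps P u) := by
  induction u using ten_induction with
  | h1 x q => rw [wl_ten, eps_ten, eps_ten, map_smul]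
  | h2 a b ha hb => simp only [map_add, ha, hb]

/-- The bilinear map `(m, b) ↦ m s(e b)`. -/
def Bialgebroid.epsRBilin (B : Bialgebroid k S) (M : EnvAlg k R S) :
    M →ₗ[k] Quo B.last →ₗ[k] Quo M.last :=
  LinearMap.mk₂ k (fun m q => Quo.lift (P := B.last)
      ((cls M.last).comp ((LinearMap.mulLeft k m).comp (M.s.toLinearMap.comp B.e))) (by
        intro w hw
        have hw : w ∈ (Ideal.span ∅ : Ideal B.carrier) := hw
        rw [Ideal.span_empty, Ideal.mem_bot] at hw
        rw [hw, map_zero]) q)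
    (fun m n q => by
      obtain ⟨b, rfl⟩ := cls_surjective _ q
      exact (congrArg (cls M.last) (add_mul m n (M.s (B.e b)))).trans (map_add _ _ _))
    (fun c m q => by
      obtain ⟨b, rfl⟩ := cls_surjective _ q
      exact (congrArg (cls M.last) (smul_mul_assoc c m (M.s (B.e b)))).trans (map_smul _ _ _))
    (fun m q q' => map_add _ _ _) (fun c m q => map_smul _ _ _)

theorem Bialgebroid.epsRBilin_cls (B : Bialgebroid k S) (M : EnvAlg k R S) (m : M)
    (b : B.carrier) : B.epsRBilin M m (cls B.last b) = cls M.last (m * M.s (B.e b)) := rfl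

theorem Bialgebroid.epsRBilin_balanced (B : Bialgebroid k S) (M : EnvAlg k R S) (m : M) (y : S)
    (q : Quo B.last) : B.epsRBilin M (m * M.s y) q = B.epsRBilin M m (y • q) := by
  obtain ⟨b, rfl⟩ := cls_surjective _ q
  rw [base_smul_cls]
  change B.epsRBilin M _ _ = B.epsRBilin M m (cls B.last (b * B.t (op y)))
  rw [epsRBilin_cls, epsRBilin_cls, B.e_mul_t, map_mul M.s, mul_assoc]

/-- The map `m ⊗ b ↦ m s(e b)`. -/
def Bialgebroid.epsR (B : Bialgebroid k S) (M : EnvAlg k R S) :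
    Quo (M ⊠ B.last) →ₗ[R] Quo M.last :=
  mkLin (tlift (B.epsRBilin M) (B.epsRBilin_balanced M)) (by
    intro r m q
    obtain ⟨b, rfl⟩ := cls_surjective _ q
    rw [tlift_ten, tlift_ten, epsRBilin_cls, epsRBilin_cls, base_smul_cls]
    change _ = cls M.last (m * M.s (B.e b) * M.t (op r))
    rw [mul_assoc, mul_assoc, M.s_mul_t])

theorem Bialgebroid.epsR_ten (B : Bialgebroid k S) {M : EnvAlg k R S} (m : M) (b : B.carrier) :
    B.epsR M (ten m (cls B.last b)) = cls M.last (m * M.s (B.e b)) :=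
  tlift_ten _ (B.epsRBilin_balanced M) m _

theorem TakHom.fin_epsR {X : EnvAlg k R T} {X₁ : EnvAlg k R S} {X₂ : EnvAlg k S T}
    (f : TakHom X X₁ X₂) (C : Bialgebroid k T) (u) :
    f.fin (C.epsR X u) = wl X₁ (C.epsR X₂) (f.ext C.last u) := by
  induction u using ten_induction with
  | h1 x q =>
    obtain ⟨c, rfl⟩ := cls_surjective _ q
    rw [C.epsR_ten, f.ext_ten, wl_wl, ← X.rs_cls, f.fin_rs]
    refine wl_congr _ (fun y => ?_) _
    obtain ⟨y, rfl⟩ := cls_surjective _ y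
    rw [LinearMap.comp_apply, jmap_cls, C.epsR_ten]
    rfl
  | h2 a b ha hb => simp only [map_add, ha, hb]

theorem EnvHom.fin_epsR {X Y : EnvAlg k R S} (f : EnvHom X Y) (B : Bialgebroid k S) (u) :
    f.fin (B.epsR X u) = B.epsR Y (f.ext B.last u) := by
  induction u using ten_induction with
  | h1 x q =>
    obtain ⟨b, rfl⟩ := cls_surjective _ q
    rw [B.epsR_ten, f.ext_ten, B.epsR_ten, f.fin_cls, map_mul, f.map_s]
  | h2 a b ha hb => simp only [map_add, ha, hb]

/-! ### Comparison with the insertions -/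

/-- Together with `rext_eq`, this turns formulas in representatives over $k$ into equations between
maps of balanced tensor products. It also shows that both sides depend only on the class of `w`. -/
theorem lext_eq (X : EnvAlg k R S) {Y : EnvAlg k S T} {X₂ : EnvAlg k S Q} {X₃ : EnvAlg k Q T}
    (f : TakHom Y X₂ X₃) (w) :
    lext X Y X₂ X₃ (toQuo f.toAlg) w = wl X f.fin (cls (X ⊠ Y.last) w) := by
  induction w using tm_induction with
  | h0 => rw [map_zero, map_zero, map_zero]
  | h1 x y =>
    rw [← ten_cls, wl_ten]
    rfl
  | h2 a b ha hb => simp only [map_add, ha, hb]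

theorem smul_map_put12 (X : EnvAlg k R S) (Y : EnvAlg k S T) (P : RelAlg k T) [Balanced P]
    (p : P) (u) : (inr X (Y ⊠ P) (inr Y P p)) • Quo.map (put12 X Y P) (put12_mem X Y P) u =
      wl X (jmap Y (cls P p)) u := by
  induction u using ten_induction with
  | h1 x q =>
    obtain ⟨y, rfl⟩ := cls_surjective _ q
    rw [wl_ten, jmap_cls, ten_cls, Quo.map_cls, smul_cls, ten_cls, ten_cls, put12, bimap_tm,
      inr_apply, tm_mul_tm, one_mul, inr_apply]
    change cls _ (tm x (tm 1 p * tm y 1)) = _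
    rw [tm_mul_tm, one_mul, mul_one]
  | h2 a b ha hb => simp only [map_add, smul_add, ha, hb]

theorem rext_eq {X : EnvAlg k R T} (Y : EnvAlg k T Q) {X₁ : EnvAlg k R S} {X₂ : EnvAlg k S T}
    (f : TakHom X X₁ X₂) (w) :
    rext X Y X₁ X₂ (toQuo f.toAlg) w = f.ext Y.last (cls (X ⊠ Y.last) w) := by
  induction w using tm_induction with
  | h0 => rw [map_zero, map_zero, map_zero]
  | h1 x y =>
    rw [← ten_cls, f.ext_ten]
    exact smul_map_put12 X₁ X₂ Y.last y (toQuo f.toAlg x)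
  | h2 a b ha hb => simp only [map_add, ha, hb]

/-! ### The comultiplication -/

/-- The comultiplication of a bialgebroid. -/
def Bialgebroid.com (A : Bialgebroid k R) : TakHom A.toEnvAlg A.toEnvAlg A.toEnvAlg :=
  ⟨A.Δ, A.Δ_t, A.Δ_s⟩

namespace Bialgebroid

variable (A : Bialgebroid k R)

theorem com_coassoc (u) :
    wl A.toEnvAlg A.com.fin (A.com.fin u) = A.com.ext A.last (A.com.fin u) := by
  obtain ⟨a, rfl⟩ := cls_surjective _ u
  obtain ⟨w, hw⟩ := cls_surjective _ (A.com.fin (cls A.last a))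
  rw [← hw, ← lext_eq, ← rext_eq]
  exact A.coassoc a w hw

theorem eps_com (u) : A.eps A.last (A.com.fin u) = u := by
  obtain ⟨a, rfl⟩ := cls_surjective _ u
  obtain ⟨w, hw⟩ := cls_surjective _ (A.com.fin (cls A.last a))
  refine Eq.trans ?_ (congrArg (cls A.last) (A.counit_left a w hw))
  rw [← hw]
  clear hw
  induction w using tm_induction with
  | h0 => simp only [map_zero]
  | h1 x y =>
    rw [← ten_cls, A.eps_ten, PreBialgebroid.collapseL_tm]
    rfl
  | h2 a b ha hb => simp only [map_add, ha, hb]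

theorem epsR_com (u) : A.epsR A.toEnvAlg (A.com.fin u) = u := by
  obtain ⟨a, rfl⟩ := cls_surjective _ u
  obtain ⟨w, hw⟩ := cls_surjective _ (A.com.fin (cls A.last a))
  refine Eq.trans ?_ (congrArg (cls A.last) (A.counit_right a w hw))
  rw [← hw]
  clear hw
  induction w using tm_induction with
  | h0 => simp only [map_zero]
  | h1 x y =>
    rw [← ten_cls, A.epsR_ten, PreBialgebroid.collapseR_tm]
  | h2 a b ha hb => simp only [map_add, ha, hb]

end Bialgebroid

end Hom

/-! ### One-sided coactions extracted from a comodule algebra -/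

section Comodules

variable {k : Type u} [CommRing k]
variable {R S T : Type v} [Ring R] [Algebra k R] [Ring S] [Algebra k S] [Ring T] [Algebra k T]

/-- The algebra map to the Takeuchi product given by a multiplicative map. -/
noncomputable def Mult.toTak {X : EnvAlg k R S} {P : RelAlg k R} [Balanced P]
    {φ : Quo X.last →ₗ[R] Quo P} (h : Mult φ) : X.carrier →ₐ[k] Tak P :=
  takAlg ((φ.restrictScalars k).comp (cls X.last)) h.one (fun x => h.isTak (isTak_last X _))
    (fun x y => by
      obtain ⟨w, hw⟩ := cls_surjective _ (φ (cls X.last x))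
      exact ⟨w, hw, h.last_smul x y hw⟩)

theorem Mult.toQuo_toTak {X : EnvAlg k R S} {P : RelAlg k R} [Balanced P]
    {φ : Quo X.last →ₗ[R] Quo P} (h : Mult φ) (x : X) : toQuo h.toTak x = φ (cls X.last x) :=
  toQuo_takAlg _ _ _ _ _

theorem Mult.cls_t {X : EnvAlg k R S} {P : RelAlg k R} [Balanced P]
    {φ : Quo X.last →ₗ[R] Quo P} (h : Mult φ) (x : Rᵐᵒᵖ) :
    φ (cls X.last (X.t x)) = cls P (P.τ x) := by
  have := h.tau x (cls X.last 1)
  rw [cls_smul_one, h.one] at this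
  exact this.trans (cls_smul_one _)

/-- The map to a Takeuchi product of two algebras given by a multiplicative map. -/
noncomputable def Mult.toTakHom {X : EnvAlg k R T} {X₁ : EnvAlg k R S} {X₂ : EnvAlg k S T}
    {φ : Quo X.last →ₗ[R] Quo (X₁ ⊠ X₂.last)} (h : Mult φ)
    (hs : ∀ x, φ (cls X.last (X.s x)) = cls (X₁ ⊠ X₂.last) (tm (P := X₂.last) 1 (X₂.s x))) :
    TakHom X X₁ X₂ where
  toAlg := h.toTak
  map_t x := (h.toQuo_toTak _).trans (h.cls_t x)
  map_s x := (h.toQuo_toTak _).trans (hs x)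

theorem Mult.toTakHom_fin {X : EnvAlg k R T} {X₁ : EnvAlg k R S} {X₂ : EnvAlg k S T}
    {φ : Quo X.last →ₗ[R] Quo (X₁ ⊠ X₂.last)} (h : Mult φ)
    (hs : ∀ x, φ (cls X.last (X.s x)) = cls (X₁ ⊠ X₂.last) (tm (P := X₂.last) 1 (X₂.s x))) (u) :
    (h.toTakHom hs).fin u = φ u := by
  obtain ⟨x, rfl⟩ := cls_surjective _ u
  exact h.toQuo_toTak x

/-! ### Counits and multiplication -/

namespace Bialgebroid

variable (A : Bialgebroid k R)

theorem e_mul (a b : A.carrier) : A.e (a * b) = unop (A.ε b) (A.e a) := by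
  rw [PreBialgebroid.e_apply, map_mul, unop_mul, Module.End.mul_apply, PreBialgebroid.e_apply]

theorem e_s (x : R) : A.e (A.s x) = x := by
  rw [PreBialgebroid.e_apply, A.ε_s, one_mul]

theorem e_t (x : R) : A.e (A.t (op x)) = x := by
  rw [PreBialgebroid.e_apply, A.ε_t, mul_one]

theorem e_one : A.e 1 = 1 := by
  rw [← map_one A.s, A.e_s]

/-- As $e(ab)=e(a)\cdot\varepsilon(b)$ depends on $a$ only through $e(a)$, the factor $a$ may be
replaced by any element with the same value of $e$, such as $s(e(a))$ or $t(e(a))$. -/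
theorem e_mul_eq_s (a b : A.carrier) : A.e (a * b) = A.e (A.s (A.e a) * b) := by
  rw [e_mul, e_mul, e_s]

theorem e_mul_eq_t (a b : A.carrier) : A.e (a * b) = A.e (A.t (op (A.e a)) * b) := by
  rw [e_mul, e_mul, e_t]

theorem eps_inr {P : RelAlg k R} [Balanced P] (p : P) (v : Quo (A.toEnvAlg ⊠ P)) :
    A.eps P (inr A.toEnvAlg P p • v) = p • A.eps P v := by
  induction v using ten_induction with
  | h1 a q => rw [inr_smul_ten, eps_ten, eps_ten]; exact (smul_comm p (A.e a) q).symm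
  | h2 a b ha hb => simp only [smul_add, map_add, ha, hb]

/-- Under the counit $a$ may be replaced by $s(e(a))$, and Takeuchi's condition moves this to the
next factor as $\tau(e(a))$. This is the reason why the collapse of the left factor is
multiplicative on Takeuchi elements. -/
theorem eps_inl {P : RelAlg k R} [Balanced P] (a : A.carrier) {v : Quo (A.toEnvAlg ⊠ P)}
    (hv : IsTak _ v) :
    A.eps P (inl A.toEnvAlg P a • v) = P.τ (op (A.e a)) • A.eps P v := by
  have h : inl A.toEnvAlg P (A.s (A.e a)) • v = inr A.toEnvAlg P (P.τ (op (A.e a))) • v := by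
    rw [← sub_eq_zero, ← sub_smul]
    exact hv _ (mem_rel.2 (Or.inl ⟨_, rfl⟩))
  rw [← eps_inr, ← h]
  clear h hv
  induction v using ten_induction with
  | h1 b q => rw [inl_smul_ten, inl_smul_ten, eps_ten, eps_ten, A.e_mul_eq_s]
  | h2 a b ha hb => simp only [smul_add, map_add, ha, hb]

theorem eps_one {P : RelAlg k R} [Balanced P] : A.eps P (cls (A.toEnvAlg ⊠ P) 1) = cls P 1 := by
  rw [one_def, ← ten_cls, eps_ten, e_one, one_smul]

/-- A middle factor $a$ in $x\otimes a\otimes q$ can be absorbed on either side, because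
$x\,s(e(a))\otimes q=x\otimes e(a)\cdot q$ in the balanced product. -/
theorem wl_eps_jmap {X : EnvAlg k S R} {P : RelAlg k R} [Balanced P] (q : Quo P) (v) :
    wl X (A.eps P) (wl X (jmap A.toEnvAlg q) v) = jmap X q (A.epsR X v) := by
  induction v using ten_induction with
  | h1 x u =>
    obtain ⟨a, rfl⟩ := cls_surjective _ u
    rw [wl_ten, wl_ten, jmap_cls, eps_ten, epsR_ten, jmap_cls, ten_smul]
  | h2 a b ha hb => simp only [map_add, ha, hb]

theorem eps_com_ext {P : RelAlg k R} [Balanced P] (u) :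
    A.eps (A.toEnvAlg ⊠ P) (A.com.ext P u) = u := by
  induction u using ten_induction with
  | h1 a q => rw [A.com.ext_ten, eps_wl, eps_com, jmap_cls]
  | h2 a b ha hb => simp only [map_add, ha, hb]

theorem wl_eps_com_ext {P : RelAlg k R} [Balanced P] (u) :
    wl A.toEnvAlg (A.eps P) (A.com.ext P u) = u := by
  induction u using ten_induction with
  | h1 a q => rw [A.com.ext_ten, wl_eps_jmap, epsR_com, jmap_cls]
  | h2 a b ha hb => simp only [map_add, ha, hb]

theorem epsR_rs_eps_jmap {M : EnvAlg k S R} (b : A.carrier) (v) :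
    A.epsR M (wl M (A.eps A.last) (wl M (jmap A.toEnvAlg (cls A.last b)) v)) =
      M.rs (A.e b) (A.epsR M v) := by
  rw [wl_eps_jmap]
  obtain ⟨x, hx⟩ := cls_surjective _ (A.epsR M v)
  rw [← hx, jmap_cls, epsR_ten, M.rs_cls]

theorem epsR_jmap (b : A.carrier) (v) :
    A.epsR A.toEnvAlg (jmap A.toEnvAlg (cls A.last b) v) = A.rs (A.e b) v := by
  obtain ⟨x, rfl⟩ := cls_surjective _ v
  rw [jmap_cls, epsR_ten, EnvAlg.rs_cls]

theorem eps_epsR (B : Bialgebroid k S) {M : EnvAlg k R S} (v) :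
    B.epsR M (A.eps (M ⊠ B.last) v) = A.eps M.last (wl A.toEnvAlg (B.epsR M) v) :=
  (A.eps_wl (B.epsR M) v).symm

/-- The identity `ε((a ⊗ m ⊗ b) v) = (a ⊗ m s(e b)) ε(v)` for the collapse of the right factor. -/
theorem wl_epsR_smul (B : Bialgebroid k S) (A : EnvAlg k R R) (M : EnvAlg k R S)
    (w : (A ⊠ M ⊠ B.last).carrier) {v : Quo (A ⊠ M ⊠ B.last)} (hv : IsTak _ v) :
    wl A (B.epsR M) (w • v) = B.collapse₃ A M w • wl A (B.epsR M) v := by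
  have key : ∀ (a : A) (m : M) (y : S) v,
      wl A (B.epsR M) ((tm a (tm (X := M) (P := B.last) m 1) :
        (A ⊠ M ⊠ B.last).carrier) • v) = (tm (P := M.last) a m) • wl A (B.epsR M) v := by
    intro a m y v
    induction v using ten_induction with
    | h1 c u =>
      rw [tm_smul_ten, wl_ten, wl_ten, tm_smul_ten]
      congr 1
      induction u using ten_induction with
      | h1 n q =>
        obtain ⟨b, rfl⟩ := cls_surjective _ q
        rw [tm_smul_ten, one_smul, B.epsR_ten, B.epsR_ten, mul_assoc]
        rfl
      | h2 a b ha hb => rw [smul_add, map_add, ha, hb, map_add, smul_add]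
    | h2 a b ha hb => simp only [smul_add, map_add, ha, hb]
  induction w using tm_induction₃ with
  | h0 => rw [zero_smul, map_zero, map_zero, zero_smul]
  | h1 a m b =>
    have h : inr A (M ⊠ B.last) (inl M B.last (M.s (B.e b))) • v =
        inr A (M ⊠ B.last) (inr M B.last (B.t (op (B.e b)))) • v := by
      rw [← sub_eq_zero, ← sub_smul, ← map_sub]
      exact hv _ (mem_rel.2 (Or.inr ⟨_, mem_rel.2 (Or.inl ⟨_, rfl⟩), rfl⟩))
    -- Under the counit $b$ may be replaced by $t(e(b))$; Takeuchi's condition `h` then carries it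
    -- over to $M$ as $s(e(b))$.
    have h2 : ∀ v, wl A (B.epsR M) ((tm a (tm (X := M) (P := B.last) m b) :
        (A ⊠ M ⊠ B.last).carrier) • v) = wl A (B.epsR M)
          ((tm a (tm (X := M) (P := B.last) m 1) : (A ⊠ M ⊠ B.last).carrier) •
            inr A (M ⊠ B.last) (inr M B.last (B.t (op (B.e b)))) • v) := by
      intro v
      induction v using ten_induction with
      | h1 c u =>
        rw [inr_smul_ten, tm_smul_ten, tm_smul_ten, wl_ten, wl_ten]
        congr 1
        induction u using ten_induction with
        | h1 n q =>
          obtain ⟨b', rfl⟩ := cls_surjective _ q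
          rw [inr_smul_ten, tm_smul_ten, tm_smul_ten]
          refine (B.epsR_ten (m * n) (b * b')).trans
            (Eq.trans ?_ (B.epsR_ten (m * n) (1 * (B.t (op (B.e b)) * b'))).symm)
          rw [B.e_mul_eq_t, one_mul]
        | h2 a b ha hb => simp only [smul_add, map_add, ha, hb]
      | h2 a b ha hb => simp only [smul_add, map_add, ha, hb]
    rw [h2, ← h, PreBialgebroid.collapse₃_tm, inr_apply, inl_apply, smul_smul, tm_mul_tm,
      tm_mul_tm, mul_one, mul_one]
    exact key a (m * M.s (B.e b)) 0 v
  | h2 a b ha hb => rw [add_smul, map_add, ha, hb, map_add, add_smul]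

end Bialgebroid

/-! ### The left and right coactions of a comodule algebra -/

namespace ComodAlg

variable {A : Bialgebroid k R} {B : Bialgebroid k S} (M : ComodAlg A B)

theorem cls_collapse₃ (A : EnvAlg k R R) (M : EnvAlg k R S) (B : Bialgebroid k S) (w) :
    cls (A ⊠ M.last) (B.collapse₃ A M w) = wl A (B.epsR M) (cls (A ⊠ M ⊠ B.last) w) := by
  induction w using tm_induction₃ with
  | h0 => simp only [map_zero]
  | h1 a m b =>
    rw [PreBialgebroid.collapse₃_tm, ← ten_cls, ← ten_cls, ← ten_cls, wl_ten, B.epsR_ten]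
  | h2 a b ha hb => simp only [map_add, ha, hb]

theorem cls_collapse₁ (A : Bialgebroid k R) (M : EnvAlg k R S) (B : EnvAlg k S S) (w) :
    cls (M ⊠ B.last) (A.collapse₁ M B w) = A.eps (M ⊠ B.last) (cls (A.toEnvAlg ⊠ M ⊠ B.last) w) := by
  induction w using tm_induction₃ with
  | h0 => simp only [map_zero]
  | h1 a m b =>
    rw [PreBialgebroid.collapse₁_tm, ← ten_cls, ← ten_cls, ← ten_cls, A.eps_ten, smul_ten]
  | h2 a b ha hb => simp only [map_add, ha, hb]

theorem coactL_eq_wl (m : M.carrier) :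
    M.coactL m = wl A.toEnvAlg (B.epsR M.toEnvAlg) (M.coact m) := by
  obtain ⟨w, hw⟩ := cls_surjective _ (M.coact m)
  rw [M.coactL_eq hw, cls_collapse₃, hw]

theorem coactR_eq_eps (m : M.carrier) :
    M.coactR m = A.eps (M.toEnvAlg ⊠ B.last) (M.coact m) := by
  obtain ⟨w, hw⟩ := cls_surjective _ (M.coact m)
  rw [M.coactR_eq hw, cls_collapse₁, hw]

theorem coact_one : M.coact 1 = cls _ 1 := toQuo_one _

theorem coact_mul (x y : M.carrier) {w} (hw : cls _ w = M.coact x) :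
    M.coact (x * y) = w • M.coact y := toQuo_mul M.α x y hw

theorem isTak_coact (m : M.carrier) : IsTak _ (M.coact m) := isTak_val _

theorem coact_mul_s (m : M.carrier) (y : S) : M.coact (m * M.s y) =
    wl A.toEnvAlg (wl M.toEnvAlg (B.rs y)) (M.coact m) := by
  obtain ⟨w, hw⟩ := cls_surjective _ (M.coact m)
  rw [M.coact_mul _ _ hw, M.α_s, ← hw, smul_cls]
  clear hw
  induction w using tm_induction₃ with
  | h0 => simp only [zero_mul, map_zero]
  | h1 a m b =>
    rw [tm_mul_tm, tm_mul_tm, ← ten_cls, ← ten_cls, ← ten_cls, ← ten_cls, wl_ten, wl_ten,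
      mul_one, mul_one]
    rfl
  | h2 a b ha hb => simp only [add_mul, map_add, ha, hb]

/-- The collapse along $\varepsilon_B$ carries the first Takeuchi relation of $A\otimes M\otimes B$
to that of $A\otimes M$, because $e(1)=1$. -/
theorem isTak_coactL (m : M.carrier) : IsTak _ (M.coactL m) := by
  intro b hb
  rw [mem_rel] at hb
  obtain ⟨y, rfl⟩ | ⟨b, hb, rfl⟩ := hb
  · have h := M.isTak_coact m _ (mem_rel.2 (Or.inl ⟨y, rfl⟩))
    have h2 := B.wl_epsR_smul A.toEnvAlg M.toEnvAlg
      (inl A.toEnvAlg (M.toEnvAlg ⊠ B.last) (A.s y) -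
        inr A.toEnvAlg (M.toEnvAlg ⊠ B.last) ((M.toEnvAlg ⊠ B.last).τ (op y))) (M.isTak_coact m)
    rw [h, map_zero, ← coactL_eq_wl, map_sub] at h2
    rw [h2]
    congr 2
    · refine Eq.trans ?_ (B.collapse₃_tm A.toEnvAlg M.toEnvAlg (A.s y) 1 1).symm
      rw [B.e_one, map_one, mul_one]
      rfl
    · refine Eq.trans ?_ (B.collapse₃_tm A.toEnvAlg M.toEnvAlg 1 (M.t (op y)) 1).symm
      rw [B.e_one, map_one, mul_one]
      rfl
  · exact hb.elim

theorem isTak_coactR (m : M.carrier) : IsTak _ (M.coactR m) := by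
  intro b hb
  rw [coactR_eq_eps, ← A.eps_inr]
  rw [M.isTak_coact m _ (mem_rel.2 (Or.inr ⟨b, hb, rfl⟩)), map_zero]

theorem coactL_one : M.coactL 1 = cls _ 1 := by
  rw [coactL_eq_wl, coact_one, one_def, ← ten_cls, wl_ten, one_def, ← ten_cls, B.epsR_ten, B.e_one,
    map_one M.s, mul_one, ten_cls]
  rfl

theorem coactR_one : M.coactR 1 = cls _ 1 := by
  rw [coactR_eq_eps, coact_one, A.eps_one]

theorem coactL_mul (x y : M.carrier) :
    ∃ w, cls _ w = M.coactL x ∧ M.coactL (x * y) = w • M.coactL y := by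
  obtain ⟨w, hw⟩ := cls_surjective _ (M.coact x)
  refine ⟨B.collapse₃ A.toEnvAlg M.toEnvAlg w, (M.coactL_eq hw).symm, ?_⟩
  rw [coactL_eq_wl, coactL_eq_wl, M.coact_mul x y hw, B.wl_epsR_smul _ _ _ (M.isTak_coact y)]

/-- The collapse of the left factor intertwines left multiplication by $w$ with that by the collapse
of $w$, on Takeuchi elements such as `M.coact y`. -/
theorem coactR_mul (x y : M.carrier) :
    ∃ w, cls _ w = M.coactR x ∧ M.coactR (x * y) = w • M.coactR y := by
  obtain ⟨w, hw⟩ := cls_surjective _ (M.coact x)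
  refine ⟨A.collapse₁ M.toEnvAlg B.toEnvAlg w, (M.coactR_eq hw).symm, ?_⟩
  rw [coactR_eq_eps, coactR_eq_eps, M.coact_mul x y hw]
  have h := M.isTak_coact y
  generalize M.coact y = v at h
  clear hw
  induction w using tm_induction₃ with
  | h0 => rw [zero_smul, map_zero, map_zero, zero_smul]
  | h1 a m b =>
    rw [PreBialgebroid.collapse₁_tm]
    -- The counit intertwines the factor $m\otimes b$ on every element, but the factor $a$ only on
    -- Takeuchi elements; so $a$ has to act first.
    have hab : (tm a (tm (X := M.toEnvAlg) (P := B.last) m b) :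
        (A.toEnvAlg ⊠ M.toEnvAlg ⊠ B.last).carrier) =
        inr _ _ (tm (P := B.last) m b) * inl _ _ a := by
      rw [inr_apply, inl_apply, tm_mul_tm, one_mul, mul_one]
    rw [hab, mul_smul, A.eps_inr, A.eps_inl a h, smul_smul]
    congr 1
    refine (tm_mul_tm (P := B.last) m (M.t (op (A.e a))) b 1).trans ?_
    rw [mul_one]
  | h2 a b ha hb => rw [add_smul, map_add, ha, hb, map_add, add_smul]

/-- The left coaction. -/
noncomputable def lam : TakHom M.toEnvAlg A.toEnvAlg M.toEnvAlg where
  toAlg := takAlg M.coactL M.coactL_one M.isTak_coactL M.coactL_mul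
  map_t x := by
    rw [toQuo_takAlg, coactL_eq_wl, M.α_t, ← ten_cls, wl_ten, one_def, ← ten_cls, B.epsR_ten,
      B.e_one, map_one M.s, mul_one, ten_cls]
  map_s x := by
    rw [toQuo_takAlg, coactL_eq_wl, M.α_s, ← ten_cls, wl_ten, ← ten_cls, B.epsR_ten, B.e_s, one_mul,
      ten_cls]

/-- The right coaction. -/
noncomputable def rho : TakHom M.toEnvAlg M.toEnvAlg B.toEnvAlg where
  toAlg := takAlg M.coactR M.coactR_one M.isTak_coactR M.coactR_mul
  map_t x := by
    rw [toQuo_takAlg, coactR_eq_eps, M.α_t, ← ten_cls, A.eps_ten, one_def, ← ten_cls, smul_ten,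
      ← op_unop x, A.e_t, one_mul, ten_cls]
  map_s x := by
    rw [toQuo_takAlg, coactR_eq_eps, M.α_s, ← ten_cls, A.eps_ten, A.e_one, one_smul]

theorem lam_cls (m : M.carrier) : M.lam.fin (cls M.last m) = M.coactL m :=
  toQuo_takAlg M.coactL M.coactL_one M.isTak_coactL M.coactL_mul m

theorem rho_cls (m : M.carrier) : M.rho.fin (cls M.last m) = M.coactR m :=
  toQuo_takAlg M.coactR M.coactR_one M.isTak_coactR M.coactR_mul m

end ComodAlg

/-! ### The coassociativity of a comodule algebra in terms of its two coactions -/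

theorem smul_map_put123 {R₀ R₁ R₂ R₃ : Type v} [Ring R₀] [Algebra k R₀] [Ring R₁] [Algebra k R₁]
    [Ring R₂] [Algebra k R₂] [Ring R₃] [Algebra k R₃] (X : EnvAlg k R₀ R₁) (Y : EnvAlg k R₁ R₂)
    (Z : EnvAlg k R₂ R₃) (P : RelAlg k R₃) [Balanced P] (p : P) (u) :
    (inr X (Y ⊠ Z ⊠ P) (inr Y (Z ⊠ P) (inr Z P p))) •
        Quo.map (put123 X Y Z P) (put123_mem X Y Z P) u =
      wl X (wl Y (jmap Z (cls P p))) u := by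
  induction u using ten_induction with
  | h1 x q =>
    have h : Quo.map (put123 X Y Z P) (put123_mem X Y Z P) (ten x q) =
        ten x (Quo.map (put12 Y Z P) (put12_mem Y Z P) q) := by
      obtain ⟨w, rfl⟩ := cls_surjective _ q
      rw [ten_cls, Quo.map_cls, Quo.map_cls, ten_cls, put123, bimap_tm]
      rfl
    rw [h, inr_smul_ten, smul_map_put12, wl_ten]
  | h2 a b ha hb => simp only [map_add, smul_add, ha, hb]

theorem mext_tm (A : EnvAlg k R R) (M : EnvAlg k R S) (B : EnvAlg k S S)
    (f : M →ₗ[k] Quo (A ⊠ M ⊠ B.last)) (a : A) (m : M) (b : B) :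
    mext A M B f (tm a (tm (P := B.last) m b)) =
      ten a (wl A (wl M (jmap B (cls B.last b))) (f m)) := by
  rw [← smul_map_put123]
  generalize hu : f m = u
  change inl A (A ⊠ M ⊠ B ⊠ B.last) a • (inr A (A ⊠ M ⊠ B ⊠ B.last) (inr A (M ⊠ B ⊠ B.last)
    (inr M (B ⊠ B.last) (inr B B.last b)))) • Quo.map (inr A (A ⊠ M ⊠ B ⊠ B.last)) (inr_mem A _)
      (Quo.map (put123 A M B B.last) (put123_mem A M B B.last) (f m)) = _
  rw [hu]
  obtain ⟨v, hv⟩ := cls_surjective _ (Quo.map (put123 A M B B.last) (put123_mem A M B B.last) u)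
  rw [← hv, Quo.map_cls, smul_cls, smul_cls, smul_cls, ten_cls, ← map_mul, inl_apply,
    inr_apply A (A ⊠ M ⊠ B ⊠ B.last), tm_mul_tm, mul_one, one_mul]

theorem dext_tm_eq (A : Bialgebroid k R) (M : EnvAlg k R S) (B : Bialgebroid k S) (a : A.carrier)
    (m : M) (b : B.carrier) :
    dext A M B (tm a (tm (P := B.last) m b)) =
      A.com.ext _ (ten a (ten m (B.com.fin (cls B.last b)))) := by
  rw [dext_tm, A.com.ext_ten]
  obtain ⟨u, hu⟩ := cls_surjective _ (A.δ a)
  obtain ⟨v, hv⟩ := cls_surjective _ (B.δ b)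
  have hu' : A.com.fin (cls A.last a) = cls _ u := hu.symm
  have hv' : B.com.fin (cls B.last b) = cls _ v := hv.symm
  rw [hu', hv', ten_cls, ← smul_map_put12, ← hu, ← hv, Quo.map_cls, smul_cls]
  change cls _ (inr A.toEnvAlg (A.toEnvAlg ⊠ M ⊠ B.toEnvAlg ⊠ B.last)
    (inr A.toEnvAlg (M ⊠ B.toEnvAlg ⊠ B.last) (inl M (B.toEnvAlg ⊠ B.last) m)) *
    (put12 A.toEnvAlg A.toEnvAlg (M ⊠ B.toEnvAlg ⊠ B.last) u *
      inr A.toEnvAlg (A.toEnvAlg ⊠ M ⊠ B.toEnvAlg ⊠ B.last)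
        (inr A.toEnvAlg (M ⊠ B.toEnvAlg ⊠ B.last) (inr M (B.toEnvAlg ⊠ B.last) v)))) = _
  rw [put12_comm A.toEnvAlg A.toEnvAlg (M ⊠ B.toEnvAlg ⊠ B.last) u
    (inr M (B.toEnvAlg ⊠ B.last) v), ← mul_assoc, ← map_mul, ← map_mul, inl_apply,
    inr_apply M, tm_mul_tm, mul_one, one_mul]

/-- With $\Delta\otimes1\otimes\Delta$ split into two commuting extensions, counits can be applied
on the left and on the right separately. -/
theorem dext_eq (A : Bialgebroid k R) (M : EnvAlg k R S) (B : Bialgebroid k S) (w) :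
    dext A M B w = A.com.ext _ (wl A.toEnvAlg (wl M B.com.fin) (cls _ w)) := by
  induction w using tm_induction₃ with
  | h0 => simp only [map_zero]
  | h1 a m b => rw [dext_tm_eq, ← ten_cls, ← ten_cls, wl_ten, wl_ten]
  | h2 a b ha hb => simp only [map_add, ha, hb]

namespace ComodAlg

variable {A : Bialgebroid k R} {B : Bialgebroid k S} (M : ComodAlg A B)

/-- The image of the coassociativity under a map `C` on the fivefold product, where `C` factors
through `D` on the side of `1 ⊗ α ⊗ 1`. -/
theorem collapse_mext {V : Type v} [AddCommGroup V]
    (C : Quo (A.toEnvAlg ⊠ A.toEnvAlg ⊠ M.toEnvAlg ⊠ B.toEnvAlg ⊠ B.last) →+ V)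
    (D : Quo (A.toEnvAlg ⊠ M.toEnvAlg ⊠ B.last) →+ V)
    (h : ∀ a m b, C (ten a (wl A.toEnvAlg (wl M.toEnvAlg (jmap B.toEnvAlg (cls B.last b)))
      (M.coact m))) = D (ten a (ten m (cls B.last b)))) (m : M.carrier) :
    D (M.coact m) = C (A.com.ext _ (wl A.toEnvAlg (wl M.toEnvAlg B.com.fin) (M.coact m))) := by
  obtain ⟨w, hw⟩ := cls_surjective _ (M.coact m)
  rw [← hw, ← dext_eq, ← M.coassoc m w hw]
  clear hw
  induction w using tm_induction₃ with
  | h0 => simp only [map_zero]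
  | h1 a m b => rw [mext_tm, h, ten_cls, ten_cls]
  | h2 a b ha hb => simp only [map_add, ha, hb]

theorem lam_cls' (m : M.carrier) : M.lam.fin (cls M.last m) =
    wl A.toEnvAlg (B.epsR M.toEnvAlg) (M.coact m) := by
  rw [lam_cls, coactL_eq_wl]

theorem rho_cls' (m : M.carrier) : M.rho.fin (cls M.last m) =
    A.eps (M.toEnvAlg ⊠ B.last) (M.coact m) := by
  rw [rho_cls, coactR_eq_eps]

/-- Apply the counit to both factors $B$ in the fivefold coassociativity law. -/
theorem lam_lam (u) : wl A.toEnvAlg M.lam.fin (M.lam.fin u) = A.com.ext M.last (M.lam.fin u) := by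
  obtain ⟨m, rfl⟩ := cls_surjective _ u
  rw [lam_cls']
  refine (M.collapse_mext
    ((wl A.toEnvAlg (wl A.toEnvAlg (B.epsR M.toEnvAlg ∘ₗ wl M.toEnvAlg (B.eps B.last)))).toAddMonoidHom)
    ((wl A.toEnvAlg M.lam.fin ∘ₗ wl A.toEnvAlg (B.epsR M.toEnvAlg)).toAddMonoidHom) ?_ m).trans ?_
  · intro a m b
    change wl A.toEnvAlg (wl A.toEnvAlg (B.epsR M.toEnvAlg ∘ₗ wl M.toEnvAlg (B.eps B.last))) _ =
      wl A.toEnvAlg M.lam.fin (wl A.toEnvAlg (B.epsR M.toEnvAlg) _)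
    rw [wl_ten, wl_ten, wl_ten, wl_wl, B.epsR_ten, ← M.rs_cls, M.lam.fin_rs, lam_cls', wl_wl]
    congr 1
    refine wl_congr _ (fun v => ?_) _
    exact B.epsR_rs_eps_jmap b v
  · change wl A.toEnvAlg (wl A.toEnvAlg (B.epsR M.toEnvAlg ∘ₗ wl M.toEnvAlg (B.eps B.last))) _ = _
    rw [← A.com.ext_wl, wl_wl]
    congr 1
    refine wl_congr _ (fun v => ?_) _
    rw [LinearMap.comp_apply, LinearMap.comp_apply, wl_wl]
    congr 1
    exact (wl_congr _ (fun b => B.eps_com b) v).trans (wl_id _ v)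

/-- Apply the counits to the second and the fifth factor of $A\otimes A\otimes M\otimes B\otimes B$.
On one side each comultiplication is undone and $\alpha$ remains; on the other side one gets
$(1\otimes\rho)\lambda$. -/
theorem wl_rho_lam (m : M.carrier) :
    wl A.toEnvAlg M.rho.fin (M.lam.fin (cls M.last m)) = M.coact m := by
  rw [lam_cls']
  refine (M.collapse_mext
    (((wl A.toEnvAlg (A.eps (M.toEnvAlg ⊠ B.last))) ∘ₗ
      (wl A.toEnvAlg (wl A.toEnvAlg (wl M.toEnvAlg (B.epsR B.toEnvAlg))))).toAddMonoidHom)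
    ((wl A.toEnvAlg M.rho.fin ∘ₗ wl A.toEnvAlg (B.epsR M.toEnvAlg)).toAddMonoidHom) ?_ m).trans ?_
  · intro a m b
    change wl A.toEnvAlg (A.eps (M.toEnvAlg ⊠ B.last))
      (wl A.toEnvAlg (wl A.toEnvAlg (wl M.toEnvAlg (B.epsR B.toEnvAlg))) _) =
      wl A.toEnvAlg M.rho.fin (wl A.toEnvAlg (B.epsR M.toEnvAlg) _)
    rw [wl_ten, wl_ten, wl_ten, wl_ten, wl_wl, B.epsR_ten, rho_cls', M.coact_mul_s]
    congr 2
    refine wl_congr _ (fun v => ?_) _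
    rw [LinearMap.comp_apply, wl_wl]
    exact wl_congr _ (fun v => B.epsR_jmap b v) v
  · change wl A.toEnvAlg (A.eps (M.toEnvAlg ⊠ B.last))
      (wl A.toEnvAlg (wl A.toEnvAlg (wl M.toEnvAlg (B.epsR B.toEnvAlg))) _) = _
    rw [← A.com.ext_wl, A.wl_eps_com_ext, wl_wl]
    refine (wl_congr _ (fun v => ?_) _).trans (wl_id _ _)
    rw [LinearMap.comp_apply, wl_wl]
    exact (wl_congr _ (fun b => B.epsR_com b) v).trans (wl_id _ v)

/-- Now the counits are applied to the first and the fourth factor. Together with `wl_rho_lam` this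
shows that the two coactions commute, both composites being $\alpha$. -/
theorem lam_ext_rho (m : M.carrier) :
    M.lam.ext B.last (M.rho.fin (cls M.last m)) = M.coact m := by
  rw [rho_cls']
  refine (M.collapse_mext
    ((A.eps (A.toEnvAlg ⊠ M.toEnvAlg ⊠ B.last) ∘ₗ
      (wl A.toEnvAlg (wl A.toEnvAlg (wl M.toEnvAlg (B.eps B.last))))).toAddMonoidHom)
    ((M.lam.ext B.last ∘ₗ A.eps (M.toEnvAlg ⊠ B.last)).toAddMonoidHom) ?_ m).trans ?_
  · intro a m b
    change A.eps (A.toEnvAlg ⊠ M.toEnvAlg ⊠ B.last)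
      (wl A.toEnvAlg (wl A.toEnvAlg (wl M.toEnvAlg (B.eps B.last))) _) =
      M.lam.ext B.last (A.eps (M.toEnvAlg ⊠ B.last) _)
    rw [wl_ten, A.eps_ten, A.eps_ten, map_smul, M.lam.ext_ten, lam_cls', wl_wl, wl_wl]
    congr 1
    refine wl_congr _ (fun v => ?_) _
    exact B.wl_eps_jmap _ v
  · change A.eps (A.toEnvAlg ⊠ M.toEnvAlg ⊠ B.last)
      (wl A.toEnvAlg (wl A.toEnvAlg (wl M.toEnvAlg (B.eps B.last))) _) = _
    rw [← A.com.ext_wl, A.eps_com_ext, wl_wl]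
    refine (wl_congr _ (fun v => ?_) _).trans (wl_id _ _)
    rw [LinearMap.comp_apply, wl_wl]
    exact (wl_congr _ (fun b => B.eps_com b) v).trans (wl_id _ v)

/-- Apply the counit to both factors $A$ in the fivefold coassociativity law. -/
theorem rho_rho (u) : wl M.toEnvAlg B.com.fin (M.rho.fin u) = M.rho.ext B.last (M.rho.fin u) := by
  obtain ⟨m, rfl⟩ := cls_surjective _ u
  rw [rho_cls']
  refine Eq.symm ((M.collapse_mext
    ((A.eps (M.toEnvAlg ⊠ B.toEnvAlg ⊠ B.last) ∘ₗ
      A.eps (A.toEnvAlg ⊠ M.toEnvAlg ⊠ B.toEnvAlg ⊠ B.last)).toAddMonoidHom)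
    ((M.rho.ext B.last ∘ₗ A.eps (M.toEnvAlg ⊠ B.last)).toAddMonoidHom) ?_ m).trans ?_)
  · intro a m b
    change A.eps (M.toEnvAlg ⊠ B.toEnvAlg ⊠ B.last)
      (A.eps (A.toEnvAlg ⊠ M.toEnvAlg ⊠ B.toEnvAlg ⊠ B.last) _) =
      M.rho.ext B.last (A.eps (M.toEnvAlg ⊠ B.last) _)
    rw [A.eps_ten, A.eps_ten, map_smul, map_smul, M.rho.ext_ten, rho_cls', A.eps_wl]
  · change A.eps (M.toEnvAlg ⊠ B.toEnvAlg ⊠ B.last)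
      (A.eps (A.toEnvAlg ⊠ M.toEnvAlg ⊠ B.toEnvAlg ⊠ B.last) _) = _
    rw [A.eps_com_ext, A.eps_wl]

theorem lam_rho (u) :
    wl A.toEnvAlg M.rho.fin (M.lam.fin u) = M.lam.ext B.last (M.rho.fin u) := by
  obtain ⟨m, rfl⟩ := cls_surjective _ u
  rw [wl_rho_lam, lam_ext_rho]

theorem eps_lam (u) : A.eps M.last (M.lam.fin u) = u := by
  obtain ⟨m, rfl⟩ := cls_surjective _ u
  obtain ⟨w, hw⟩ := cls_surjective _ (M.coact m)
  refine Eq.trans ?_ (congrArg (cls M.last) (M.counit m w hw))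
  rw [lam_cls, M.coactL_eq hw]
  generalize B.collapse₃ A.toEnvAlg M.toEnvAlg w = w
  induction w using tm_induction with
  | h0 => simp only [map_zero]
  | h1 x y =>
    rw [← ten_cls, A.eps_ten, PreBialgebroid.collapseL_tm]
    rfl
  | h2 a b ha hb => simp only [map_add, ha, hb]

/-- The two counits commute, so the collapse of $\rho$ along $\varepsilon_B$ equals the collapse of
$\lambda$ along $\varepsilon_A$. The single counit axiom of a comodule algebra therefore gives both
one-sided ones. -/
theorem epsR_rho (u) : B.epsR M.toEnvAlg (M.rho.fin u) = u := by
  obtain ⟨m, rfl⟩ := cls_surjective _ u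
  rw [rho_cls', A.eps_epsR, ← lam_cls', eps_lam]

end ComodAlg

end Comodules

section Bicomodules

variable {k : Type u} [CommRing k]
variable {R S T Q U : Type v} [Ring R] [Algebra k R] [Ring S] [Algebra k S] [Ring T] [Algebra k T]
  [Ring Q] [Algebra k Q] [Ring U] [Algebra k U]

/-! ### Extending identities between maps to further factors -/

theorem TakHom.wl_ext_jmap {X : EnvAlg k R T} {X₁ : EnvAlg k R S} {X₂ : EnvAlg k S T}
    (f : TakHom X X₁ X₂) {Y₁ : EnvAlg k S Q} {Y₂ : EnvAlg k Q T} (g : TakHom X₂ Y₁ Y₂)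
    {P : RelAlg k T} [Balanced P] (q : Quo P) (u) :
    wl X₁ (g.ext P) (f.ext P (jmap X q u)) =
      wl X₁ (wl Y₁ (jmap Y₂ q)) (wl X₁ g.fin (f.fin u)) := by
  rw [f.ext_jmap, wl_wl, wl_wl]
  refine wl_congr _ (fun v => ?_) _
  rw [LinearMap.comp_apply, g.ext_jmap, LinearMap.comp_apply]

theorem TakHom.ext_ext_jmap {X : EnvAlg k R T} {X₁ : EnvAlg k R S} {X₂ : EnvAlg k S T}
    (f : TakHom X X₁ X₂) {Y₁ : EnvAlg k R Q} {Y₂ : EnvAlg k Q S} (g : TakHom X₁ Y₁ Y₂)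
    {P : RelAlg k T} [Balanced P] (q : Quo P) (u) :
    g.ext (X₂ ⊠ P) (f.ext P (jmap X q u)) =
      wl Y₁ (wl Y₂ (jmap X₂ q)) (g.ext X₂.last (f.fin u)) := by
  rw [f.ext_jmap, g.ext_wl]

theorem quo_induction {X : EnvAlg k R S} {P : RelAlg k S} {C : Quo (X ⊠ P) → Prop} (u)
    (h1 : ∀ q v, C (jmap X q v)) (h2 : ∀ a b, C a → C b → C (a + b)) : C u := by
  induction u using ten_induction with
  | h1 x q => exact h1 q (cls X.last x)
  | h2 a b ha hb => exact h2 a b ha hb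

/-- An equation between maps on `X` can be tensored with `P` on the right, since $X\otimes P$ is
spanned by the images of the maps `jmap X q`. The following lemmas do the same for other shapes of
equations. -/
theorem TakHom.assoc_ext {X : EnvAlg k R T} {X₁ : EnvAlg k R S} {X₂ : EnvAlg k S T}
    {Y : EnvAlg k S Q} {Z : EnvAlg k Q T} {W : EnvAlg k R Q}
    {f : TakHom X X₁ X₂} {g : TakHom X₂ Y Z} {f' : TakHom X W Z} {g' : TakHom W X₁ Y}
    (h : ∀ u, wl X₁ g.fin (f.fin u) = g'.ext Z.last (f'.fin u))
    {P : RelAlg k T} [Balanced P] (u) :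
    wl X₁ (g.ext P) (f.ext P u) = g'.ext (Z ⊠ P) (f'.ext P u) := by
  induction u using quo_induction with
  | h1 q v => rw [f.wl_ext_jmap, f'.ext_ext_jmap, h]
  | h2 a b ha hb => simp only [map_add, ha, hb]

theorem EnvHom.wl_ext_of_fin {X X' : EnvAlg k R T} {X₁ : EnvAlg k R S} {X₂ X₂' : EnvAlg k S T}
    {p : EnvHom X X'} {r : EnvHom X₂ X₂'} {f : TakHom X X₁ X₂} {f' : TakHom X' X₁ X₂'}
    (h : ∀ u, wl X₁ r.fin (f.fin u) = f'.fin (p.fin u)) {P : RelAlg k T} [Balanced P] (u) :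
    wl X₁ (r.ext P) (f.ext P u) = f'.ext P (p.ext P u) := by
  induction u using quo_induction with
  | h1 q v =>
    rw [f.ext_jmap, p.ext_jmap, f'.ext_jmap, ← h, wl_wl, wl_wl]
    refine wl_congr _ (fun v => ?_) _
    rw [LinearMap.comp_apply, r.ext_jmap, LinearMap.comp_apply]
  | h2 a b ha hb => simp only [map_add, ha, hb]

theorem EnvHom.ext_ext_of_fin {X X' : EnvAlg k R T} {X₁ X₁' : EnvAlg k R S} {X₂ : EnvAlg k S T}
    {p : EnvHom X X'} {r : EnvHom X₁ X₁'} {f : TakHom X X₁ X₂} {f' : TakHom X' X₁' X₂}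
    (h : ∀ u, r.ext X₂.last (f.fin u) = f'.fin (p.fin u)) {P : RelAlg k T} [Balanced P] (u) :
    r.ext (X₂ ⊠ P) (f.ext P u) = f'.ext P (p.ext P u) := by
  induction u using quo_induction with
  | h1 q v => rw [f.ext_jmap, p.ext_jmap, f'.ext_jmap, ← h, r.ext_wl]
  | h2 a b ha hb => simp only [map_add, ha, hb]

theorem EnvHom.ext_comp {X Y Z : EnvAlg k R S} {f : EnvHom X Y} {g : EnvHom Y Z} {h : EnvHom X Z}
    (hh : ∀ u, g.fin (f.fin u) = h.fin u) {P : RelAlg k S} [Balanced P] (u) :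
    g.ext P (f.ext P u) = h.ext P u := by
  induction u using quo_induction with
  | h1 q v => rw [f.ext_jmap, g.ext_jmap, h.ext_jmap, hh]
  | h2 a b ha hb => simp only [map_add, ha, hb]

theorem TakHom.ext_eq {X : EnvAlg k R T} {X₁ : EnvAlg k R S} {X₂ : EnvAlg k S T}
    {f g : TakHom X X₁ X₂} (h : ∀ u, f.fin u = g.fin u) {P : RelAlg k T} [Balanced P] (u) :
    f.ext P u = g.ext P u := by
  induction u using quo_induction with
  | h1 q v => rw [f.ext_jmap, g.ext_jmap, h]
  | h2 a b ha hb => simp only [map_add, ha, hb]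

theorem Bialgebroid.eps_ext {A : Bialgebroid k R} {X : EnvAlg k R S} {f : TakHom X A.toEnvAlg X}
    (h : ∀ u, A.eps X.last (f.fin u) = u) {P : RelAlg k S} [Balanced P] (u) :
    A.eps (X ⊠ P) (f.ext P u) = u := by
  induction u using quo_induction with
  | h1 q v => rw [f.ext_jmap, A.eps_wl, h]
  | h2 a b ha hb => simp only [map_add, ha, hb]

theorem cls_collapseL (A : Bialgebroid k R) (X : EnvAlg k R S) (w) :
    cls X.last (A.collapseL X w) = A.eps X.last (cls (A.toEnvAlg ⊠ X.last) w) := by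
  induction w using tm_induction with
  | h0 => simp only [map_zero]
  | h1 x y =>
    rw [← ten_cls, A.eps_ten, PreBialgebroid.collapseL_tm]
    rfl
  | h2 a b ha hb => simp only [map_add, ha, hb]

/-! ### Comodule algebras in terms of a left and a right coaction -/

/-- Commuting left and right coactions on an algebra. -/
structure Coactions (A : Bialgebroid k R) (B : Bialgebroid k S) (X : EnvAlg k R S) where
  lam : TakHom X A.toEnvAlg X
  rho : TakHom X X B.toEnvAlg
  lam_lam : ∀ u, wl A.toEnvAlg lam.fin (lam.fin u) = A.com.ext X.last (lam.fin u)
  rho_rho : ∀ u, wl X B.com.fin (rho.fin u) = rho.ext B.last (rho.fin u)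
  lam_rho : ∀ u, wl A.toEnvAlg rho.fin (lam.fin u) = lam.ext B.last (rho.fin u)
  eps_lam : ∀ u, A.eps X.last (lam.fin u) = u
  epsR_rho : ∀ u, B.epsR X (rho.fin u) = u

namespace Coactions

variable {A : Bialgebroid k R} {B : Bialgebroid k S} {X : EnvAlg k R S} (c : Coactions A B X)

theorem mult : Mult (wl A.toEnvAlg c.rho.fin ∘ₗ c.lam.fin) :=
  (c.rho.fin_mult.wl A.toEnvAlg).comp c.lam.fin_mult

/-- The underlying data of the comodule algebra. -/
@[reducible] noncomputable def preComodAlg : PreComodAlg A B where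
  toEnvAlg := X
  α := c.mult.toTak

theorem preComodAlg_coact (x : X) :
    c.preComodAlg.coact x = wl A.toEnvAlg c.rho.fin (c.lam.fin (cls X.last x)) :=
  c.mult.toQuo_toTak x

/-- The middle $\alpha$ is taken in the form $(\lambda\otimes1)\rho$, although it is defined as
$(1\otimes\rho)\lambda$. This separates $\rho$, which acts first, from $\lambda$. -/
theorem mext_eq (f : X →ₗ[k] Quo (A.toEnvAlg ⊠ X ⊠ B.last))
    (hf : ∀ x, f x = wl A.toEnvAlg c.rho.fin (c.lam.fin (cls X.last x))) (w) :
    mext A.toEnvAlg X B.toEnvAlg f w =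
    wl A.toEnvAlg (c.lam.ext (B.toEnvAlg ⊠ B.last)) (wl A.toEnvAlg (c.rho.ext B.last)
      (cls (A.toEnvAlg ⊠ X ⊠ B.last) w)) := by
  induction w using tm_induction₃ with
  | h0 => simp only [map_zero]
  | h1 a m b =>
    rw [mext_tm, ← ten_cls, ← ten_cls, wl_ten, wl_ten, hf, c.lam_rho,
      c.rho.ext_ten, c.lam.ext_wl]
  | h2 a b ha hb => simp only [map_add, ha, hb]

/-- The coassociativity of $\lambda$ removes $\Delta_A$ and that of $\rho$ removes $\Delta_B$. What
remains is the commutation of $\lambda$ with $\rho$. -/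
theorem coassoc (u) : wl A.toEnvAlg (c.lam.ext (B.toEnvAlg ⊠ B.last)) (wl A.toEnvAlg
      (c.rho.ext B.last) (wl A.toEnvAlg c.rho.fin (c.lam.fin u))) =
    A.com.ext _ (wl A.toEnvAlg (wl X B.com.fin) (wl A.toEnvAlg c.rho.fin (c.lam.fin u))) := by
  rw [A.com.ext_wl, A.com.ext_wl, ← c.lam_lam]
  simp only [wl_wl]
  refine wl_congr _ (fun v => ?_) _
  simp only [LinearMap.comp_apply]
  rw [← c.rho_rho, c.lam.ext_wl, ← c.lam_rho, wl_wl]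

/-- The comodule algebra given by commuting left and right coactions. -/
@[reducible] noncomputable def comodAlg : ComodAlg A B where
  toPreComodAlg := c.preComodAlg
  α_t x := (c.preComodAlg_coact _).trans (c.mult.cls_t x)
  α_s x := by
    refine (c.preComodAlg_coact (X.s x)).trans ?_
    rw [c.lam.fin_cls, c.lam.map_s, ← ten_cls, wl_ten, c.rho.fin_cls, c.rho.map_s, ten_cls]
  coassoc m w hw := by
    rw [dext_eq, hw]
    refine (c.mext_eq _ c.preComodAlg_coact w).trans ?_
    exact (congrArg _ (congrArg _ (hw.trans (c.preComodAlg_coact m)))).trans ((c.coassoc _).trans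
      (congrArg _ (congrArg _ (c.preComodAlg_coact m).symm)))
  counit m w hw := by
    have hw : cls (A.toEnvAlg ⊠ X ⊠ B.last) w = _ := hw.trans (c.preComodAlg_coact m)
    refine cls_last_injective X ?_
    refine (cls_collapseL A X _).trans ?_
    rw [ComodAlg.cls_collapse₃, hw, wl_wl]
    refine Eq.trans (congrArg _ ?_) (c.eps_lam _)
    exact (wl_congr _ (fun u => c.epsR_rho u) _).trans (wl_id _ _)

theorem coact_eq (x : X) :
    c.comodAlg.coact x = wl A.toEnvAlg c.rho.fin (c.lam.fin (cls X.last x)) :=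
  c.preComodAlg_coact x

/-- Collapsing $B$ in $(1\otimes\rho)\lambda$ leaves $\lambda$, by the counit law of $\rho$. Thus
the passage from coactions to comodule algebras loses nothing. -/
theorem lam_fin (u) : c.comodAlg.lam.fin u = c.lam.fin u := by
  obtain ⟨x, rfl⟩ := cls_surjective _ u
  rw [ComodAlg.lam_cls', coact_eq]
  refine (wl_wl _ _ _ _).trans ?_
  exact (wl_congr _ (fun u => c.epsR_rho u) _).trans (wl_id _ _)

theorem rho_fin (u) : c.comodAlg.rho.fin u = c.rho.fin u := by
  obtain ⟨x, rfl⟩ := cls_surjective _ u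
  rw [ComodAlg.rho_cls', coact_eq]
  refine (A.eps_wl c.rho.fin _).trans ?_
  rw [c.eps_lam]

end Coactions

/-! ### Maps of comodule algebras -/

section Maps

variable {A : Bialgebroid k R} {B : Bialgebroid k S} {M N : ComodAlg A B}

theorem cls_ext_bimap (f : EnvHom M.toEnvAlg N.toEnvAlg) (w) :
    cls (A.toEnvAlg ⊠ N.toEnvAlg ⊠ B.last)
        (ext A.toEnvAlg (bimap (P := B.last) (P' := B.last) f.toAlg (AlgHom.id k B.carrier)) w) =
      wl A.toEnvAlg (f.ext B.last) (cls (A.toEnvAlg ⊠ M.toEnvAlg ⊠ B.last) w) := by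
  induction w using tm_induction₃ with
  | h0 => simp only [map_zero]
  | h1 a m b =>
    rw [← ten_cls, ← ten_cls, wl_ten, f.ext_ten, ten_cls, ten_cls]
    rfl
  | h2 a b ha hb => simp only [map_add, ha, hb]

/-- The map of comodule algebras given by a map that respects both coactions. -/
def EnvHom.comodAlgHom (f : EnvHom M.toEnvAlg N.toEnvAlg)
    (hl : ∀ u, wl A.toEnvAlg f.fin (M.lam.fin u) = N.lam.fin (f.fin u))
    (hr : ∀ u, f.ext B.last (M.rho.fin u) = N.rho.fin (f.fin u)) : ComodAlgHom M N where
  toAlgHom := f.toAlg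
  map_η x := by
    -- The structure map is determined by its two restrictions, through $\eta(a\otimes b)=t(a)s(b)$.
    have h : f.toAlg.comp M.η = N.η := Algebra.TensorProduct.ext'
      (fun a b => by
        have ha : ∀ X : EnvAlg k R S, X.η (a ⊗ₜ b) = X.t a * X.s b := fun X => by
          rw [EnvAlg.t, EnvAlg.s, AlgHom.comp_apply, AlgHom.comp_apply, ← map_mul]
          simp
        rw [AlgHom.comp_apply, ha, ha, map_mul, f.map_t, f.map_s])
    exact DFunLike.congr_fun h x
  map_α m w hw := by
    rw [cls_ext_bimap, hw, ← M.wl_rho_lam, ← N.wl_rho_lam, ← f.fin_cls, ← hl, wl_wl, wl_wl]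
    refine wl_congr _ (fun u => ?_) _
    rw [LinearMap.comp_apply, hr, LinearMap.comp_apply]

/-- The underlying map of algebras over `Rᵒ ⊗ S`. -/
def ComodAlgHom.envHom (f : ComodAlgHom M N) : EnvHom M.toEnvAlg N.toEnvAlg where
  toAlg := f.toAlgHom
  map_t _ := f.map_η _
  map_s _ := f.map_η _

theorem ComodAlgHom.wl_ext_coact (f : ComodAlgHom M N) (m : M.carrier) :
    wl A.toEnvAlg (f.envHom.ext B.last) (M.coact m) = N.coact (f.toAlgHom m) := by
  obtain ⟨w, hw⟩ := cls_surjective _ (M.coact m)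
  rw [← f.map_α m w hw, ← hw]
  exact (cls_ext_bimap f.envHom w).symm

/-- Collapse the factor $B$ in the compatibility with $\alpha$; the right counit is natural in the
algebra. -/
theorem ComodAlgHom.lam_fin (f : ComodAlgHom M N) (u) :
    wl A.toEnvAlg f.envHom.fin (M.lam.fin u) = N.lam.fin (f.envHom.fin u) := by
  obtain ⟨m, rfl⟩ := cls_surjective _ u
  rw [M.lam_cls', f.envHom.fin_cls, N.lam_cls']
  refine Eq.trans ?_ (congrArg _ (f.wl_ext_coact m))
  rw [wl_wl, wl_wl]
  refine wl_congr _ (fun u => ?_) _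
  rw [LinearMap.comp_apply, f.envHom.fin_epsR, LinearMap.comp_apply]

theorem ComodAlgHom.rho_fin (f : ComodAlgHom M N) (u) :
    f.envHom.ext B.last (M.rho.fin u) = N.rho.fin (f.envHom.fin u) := by
  obtain ⟨m, rfl⟩ := cls_surjective _ u
  rw [M.rho_cls', f.envHom.fin_cls, N.rho_cls']
  refine Eq.trans ?_ (congrArg _ (f.wl_ext_coact m))
  rw [A.eps_wl]

theorem ComodAlgHom.ext_fin {f g : ComodAlgHom M N}
    (h : ∀ u, f.envHom.fin u = g.envHom.fin u) : f = g := by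
  apply ComodAlgHom.ext
  refine AlgHom.ext fun m => ?_
  exact cls_last_injective N.toEnvAlg (h (cls _ m))

end Maps

end Bicomodules

/-! ### Flatness of balanced tensor products -/

/-- `R` is hereditary. -/
class Hereditary (R : Type v) [Ring R] : Prop where
  out : IsHereditary R

section Flatness

variable {k : Type u} [CommRing k]
variable {R S T Q : Type v} [Ring R] [Algebra k R] [Ring S] [Algebra k S] [Ring T] [Algebra k T]
  [Ring Q] [Algebra k Q]

/-- Left multiplication by an element of `P`. -/
def lsm (P : RelAlg k R) [Balanced P] (p : P) : Quo P →ₗ[R] Quo P :=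
  DistribSMul.toLinearMap R (Quo P) p

theorem lsm_apply (P : RelAlg k R) [Balanced P] (p : P) (u : Quo P) : lsm P p u = p • u := rfl

/-- The right action on a single factor. -/
@[reducible] def rightLast (X : EnvAlg k R S) : Module Sᵐᵒᵖ (Quo X.last) where
  smul y u := X.rs (unop y) u
  one_smul u := by
    obtain ⟨x, rfl⟩ := cls_surjective _ u
    change cls X.last (x * X.s 1) = _
    rw [map_one, mul_one]
  mul_smul y z u := by
    obtain ⟨x, rfl⟩ := cls_surjective _ u
    change cls X.last (x * X.s (unop z * unop y)) = cls X.last (x * X.s (unop z) * X.s (unop y))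
    rw [map_mul X.s, mul_assoc]
  smul_zero y := map_zero (X.rs (unop y))
  smul_add y := map_add (X.rs (unop y))
  add_smul y z u := by
    obtain ⟨x, rfl⟩ := cls_surjective _ u
    change cls X.last (x * X.s (unop y + unop z)) =
      cls X.last (x * X.s (unop y)) + cls X.last (x * X.s (unop z))
    rw [map_add, mul_add, map_add]
  zero_smul u := by
    obtain ⟨x, rfl⟩ := cls_surjective _ u
    change cls X.last (x * X.s 0) = 0
    rw [map_zero, mul_zero, map_zero]

attribute [local instance] rightLast

theorem op_smul_last (X : EnvAlg k R S) (y : Sᵐᵒᵖ) (u : Quo X.last) : y • u = X.rs (unop y) u := rfl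

instance (X : EnvAlg k R S) : SMulCommClass Sᵐᵒᵖ R (Quo X.last) :=
  ⟨fun y r u => (X.rs (unop y)).map_smul r u⟩

/-- The right action on the last factor. -/
@[reducible] def rightCons (X : EnvAlg k R S) (P : RelAlg k S) [Balanced P] [Module Tᵐᵒᵖ (Quo P)]
    [SMulCommClass Tᵐᵒᵖ S (Quo P)] : Module Tᵐᵒᵖ (Quo (X ⊠ P)) where
  smul y u := wl X (DistribSMul.toLinearMap S (Quo P) y) u
  one_smul u := (wl_congr X (fun q => one_smul Tᵐᵒᵖ q) u).trans (wl_id X u)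
  mul_smul y z u := (wl_congr X (fun q => mul_smul y z q) u).trans (wl_wl X _ _ u).symm
  smul_zero y := map_zero (wl X _)
  smul_add y := map_add (wl X _)
  add_smul y z u := by
    change wl X _ u = wl X _ u + wl X _ u
    induction u using ten_induction with
    | h1 x q =>
      rw [wl_ten, wl_ten, wl_ten, ← map_add]
      exact congrArg _ (add_smul y z q)
    | h2 a b ha hb => simp only [map_add, ha, hb]; abel
  zero_smul u := by
    change wl X _ u = 0
    induction u using ten_induction with
    | h1 x q =>
      rw [wl_ten]
      exact (congrArg _ (zero_smul Tᵐᵒᵖ q)).trans (map_zero _)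
    | h2 a b ha hb => rw [map_add, ha, hb, add_zero]

attribute [local instance] rightCons

instance (X : EnvAlg k R S) (P : RelAlg k S) [Balanced P] [Module Tᵐᵒᵖ (Quo P)]
    [SMulCommClass Tᵐᵒᵖ S (Quo P)] : SMulCommClass Tᵐᵒᵖ R (Quo (X ⊠ P)) :=
  ⟨fun y r u => (wl X (DistribSMul.toLinearMap S (Quo P) y)).map_smul r u⟩

theorem op_smul_cons (X : EnvAlg k R S) (P : RelAlg k S) [Balanced P] [Module Tᵐᵒᵖ (Quo P)]
    [SMulCommClass Tᵐᵒᵖ S (Quo P)] (y : Tᵐᵒᵖ) (u : Quo (X ⊠ P)) :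
    y • u = wl X (DistribSMul.toLinearMap S (Quo P) y) u := rfl

/-- The identification of right `S`-modules with modules over `Sᵐᵒᵖ`. -/
abbrev rid (S : Type v) [Ring S] : Sᵐᵒᵖ →+* Sᵐᵒᵖ := RingHom.id _

/-- The identification of left `S`-modules with right modules over `Sᵐᵒᵖ`. -/
abbrev lid (S : Type v) [Ring S] : S →+* Sᵐᵒᵖᵐᵒᵖ := RingEquiv.opOp S

theorem unop_lid (y : Sᵐᵒᵖ) : unop (lid S (unop (rid S y))) = y := rfl

theorem unop_rid (y : S) : unop (rid S (unop (lid S y))) = y := rfl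

/-- The comparison of the two constructions of the balanced tensor product. -/
def toB (X : EnvAlg k R S) (P : RelAlg k S) [Balanced P] :
    Quo (X ⊠ P) →+ BTensor (rid S) (Quo X.last) (Quo P) :=
  let f : X →+ P →+ BTensor (rid S) (Quo X.last) (Quo P) :=
    ((BTensor.tmul (rid S)).compl₂ (cls P).toAddMonoidHom).comp (cls X.last).toAddMonoidHom
  let g : (X ⊠ P).carrier →+ BTensor (rid S) (Quo X.last) (Quo P) :=
    TensorProduct.liftAddHom f (by
      intro c x p
      -- Balancing over `S` includes balancing over `k`, since scalars act through the image of `k`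
      -- in `S`.
      have h1 : cls X.last (c • x) = op (algebraMap k S c) • cls X.last x := by
        rw [op_smul_last, unop_op, X.rs_cls, AlgHom.commutes, ← Algebra.commutes, Algebra.smul_def]
      have h2 : cls P (c • p) = algebraMap k S c • cls P p := by
        rw [map_smul, algebraMap_smul]
      change BTensor.tmul (rid S) (cls X.last (c • x)) (cls P p) =
        BTensor.tmul (rid S) (cls X.last x) (cls P (c • p))
      rw [h1, BTensor.smul_tmul, h2]
      rfl)
  have hg : ∀ w ∈ Ideal.span (X ⊠ P).rel, g w = 0 := by
    intro w hw
    suffices H : ∀ c, g (c * w) = 0 by simpa using H 1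
    induction hw using Submodule.span_induction with
    | zero => simp
    | add x y _ _ hx hy => intro c; rw [mul_add, map_add, hx, hy, add_zero]
    | smul a x _ hx => intro c; rw [smul_eq_mul, ← mul_assoc]; exact hx _
    | mem b hb =>
      intro c
      have hfg : ∀ x p, g (tm x p) = BTensor.tmul (rid S) (cls X.last x) (cls P p) :=
        fun x p => rfl
      induction c using tm_induction with
      | h0 => rw [zero_mul, map_zero]
      | h2 c d hc hd => rw [add_mul, map_add, hc, hd, add_zero]
      | h1 x p =>
        rw [mem_rel] at hb
        obtain ⟨y, rfl⟩ | ⟨b, hb, rfl⟩ := hb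
        · rw [mul_sub, inl_apply, inr_apply, tm_mul_tm, tm_mul_tm, mul_one, mul_one, map_sub,
            hfg, hfg, ← base_smul_cls, ← X.rs_cls, sub_eq_zero]
          exact BTensor.smul_tmul (rid S) (op y) (cls X.last x) (cls P p)
        · rw [inr_apply, tm_mul_tm, hfg,
            cls_eq_zero.2 (Ideal.mul_mem_left _ _ (Ideal.subset_span hb)), map_zero]
  (Submodule.liftQ ((Ideal.span (X ⊠ P).rel).restrictScalars ℤ) g.toIntLinearMap
    hg).toAddMonoidHom

theorem toB_jmap (X : EnvAlg k R S) {P : RelAlg k S} [Balanced P] (q : Quo P) (u : Quo X.last) :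
    toB X P (jmap X q u) = BTensor.tmul (rid S) u q := by
  obtain ⟨x, rfl⟩ := cls_surjective _ u
  obtain ⟨p, rfl⟩ := cls_surjective _ q
  rw [jmap_cls, ten_cls]
  rfl

/-- A left inverse comes from the universal property of the module-theoretic tensor product. -/
theorem toB_injective (X : EnvAlg k R S) (P : RelAlg k S) [Balanced P] :
    Function.Injective (toB X P) := by
  let g : Quo X.last →+ Quo P →+ Quo (X ⊠ P) := AddMonoidHom.mk'
    (fun u => AddMonoidHom.mk' (fun q => jmap X q u) (fun q q' => jmap_add X q q' u))
    (fun u u' => AddMonoidHom.ext fun q => map_add (jmap X q) u u')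
  have hg : ∀ (y : Sᵐᵒᵖ) u q, g (y • u) q = g u (unop (rid S y) • q) :=
    fun y u q => jmap_rs X (unop y) q u
  refine Function.LeftInverse.injective (g := BTensor.lift (rid S) g hg) fun w => ?_
  induction w using quo_induction with
  | h1 q u => rw [toB_jmap, BTensor.lift_tmul]; rfl
  | h2 a b ha hb => rw [map_add, map_add, ha, hb]

/-- `Q₁` is the balanced tensor product of `Q₀` and `P`. -/
structure Extension (P : RelAlg k T) [Balanced P] (Q₀ Q₁ : RelAlg k R) [Balanced Q₀] [Balanced Q₁]
    [Module Tᵐᵒᵖ (Quo Q₀)] where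
  j : Quo P → Quo Q₀ →ₗ[R] Quo Q₁
  toB : Quo Q₁ →+ BTensor (rid T) (Quo Q₀) (Quo P)
  toB_j : ∀ q u, toB (j q u) = BTensor.tmul (rid T) u q
  toB_injective : Function.Injective toB

/-- The extension of a single factor. -/
def Extension.last (X : EnvAlg k R T) (P : RelAlg k T) [Balanced P] :
    Extension P X.last (X ⊠ P) where
  j q := jmap X q
  toB := Takeuchi.toB X P
  toB_j q u := toB_jmap X q u
  toB_injective := Takeuchi.toB_injective X P

namespace Extension

variable {P : RelAlg k T} [Balanced P] {Q₀ Q₁ : RelAlg k S} [Balanced Q₀] [Balanced Q₁]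
  [Module Tᵐᵒᵖ (Quo Q₀)] [SMulCommClass Tᵐᵒᵖ S (Quo Q₀)] (e : Extension P Q₀ Q₁)

theorem toB_surjective : Function.Surjective e.toB := by
  intro z
  induction z using BTensor.induction_on with
  | h1 u q => exact ⟨e.j q u, e.toB_j q u⟩
  | h2 a b ha hb =>
    obtain ⟨a, rfl⟩ := ha
    obtain ⟨b, rfl⟩ := hb
    exact ⟨a + b, map_add _ _ _⟩

theorem induction {C : Quo Q₁ → Prop} (w) (h1 : ∀ q u, C (e.j q u))
    (h2 : ∀ a b, C a → C b → C (a + b)) : C w := by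
  suffices H : ∀ z w, e.toB w = z → C w from H _ w rfl
  intro z
  induction z using BTensor.induction_on with
  | h1 u q =>
    intro w hw
    rw [← e.toB_j] at hw
    rw [e.toB_injective hw]
    exact h1 q u
  | h2 a b ha hb =>
    intro w hw
    obtain ⟨a', rfl⟩ := e.toB_surjective a
    obtain ⟨b', rfl⟩ := e.toB_surjective b
    rw [← map_add] at hw
    rw [e.toB_injective hw]
    exact h2 _ _ (ha a' rfl) (hb b' rfl)

/-- The left action as a map of right modules. -/
def lsr (Q₀ : RelAlg k S) [Balanced Q₀] [Module Tᵐᵒᵖ (Quo Q₀)] [SMulCommClass Tᵐᵒᵖ S (Quo Q₀)]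
    (y : S) : Quo Q₀ →ₗ[Tᵐᵒᵖ] Quo Q₀ where
  toFun u := y • u
  map_add' := smul_add y
  map_smul' t u := (smul_comm t y u).symm

theorem toB_smul (y : S) (v : Quo Q₁) : e.toB (y • v) =
    BTensor.map (rid T) (lsr Q₀ y) LinearMap.id (e.toB v) := by
  induction v using e.induction with
  | h1 q u => rw [← (e.j q).map_smul, e.toB_j, e.toB_j, BTensor.map_tmul]; rfl
  | h2 a b ha hb => rw [smul_add, map_add, ha, hb, map_add, map_add]

/-- The map `q ↦ u ⊗ q`. -/
def jr (X : EnvAlg k R S) (u : Quo X.last) : Quo Q₀ →ₗ[Tᵐᵒᵖ] Quo (X ⊠ Q₀) where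
  toFun q := jmap X q u
  map_add' q q' := jmap_add X q q' u
  map_smul' y q := (wl_jmap X (DistribSMul.toLinearMap S (Quo Q₀) y) q u).symm

/-- The bilinear map `(u, v) ↦ u ⊗ v`. -/
def consBilin (X : EnvAlg k R S) :
    Quo X.last →+ Quo Q₁ →+ BTensor (rid T) (Quo (X ⊠ Q₀)) (Quo P) :=
  AddMonoidHom.mk' (fun u => (BTensor.map (rid T) (jr X u) LinearMap.id).comp e.toB) (by
    intro u u'
    refine AddMonoidHom.ext fun v => ?_
    induction v using e.induction with
    | h1 q w =>
      change BTensor.map _ _ _ _ = BTensor.map _ _ _ _ + BTensor.map _ _ _ _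
      rw [e.toB_j, BTensor.map_tmul, BTensor.map_tmul, BTensor.map_tmul, ← AddMonoidHom.add_apply,
        ← map_add]
      congr 2
      exact map_add (jmap X w) u u'
    | h2 a b ha hb => rw [map_add, map_add, ha, hb])

theorem consBilin_balanced (X : EnvAlg k R S) (y : Sᵐᵒᵖ) (u : Quo X.last) (v : Quo Q₁) :
    e.consBilin X (y • u) v = e.consBilin X u (unop (rid S y) • v) := by
  change BTensor.map _ _ _ (e.toB v) = BTensor.map _ _ _ (e.toB _)
  rw [e.toB_smul]
  generalize e.toB v = z
  induction z using BTensor.induction_on with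
  | h1 q w =>
    rw [BTensor.map_tmul, BTensor.map_tmul, BTensor.map_tmul]
    congr 2
    exact jmap_rs X (unop y) q u
  | h2 a b ha hb => simp only [map_add, ha, hb]

/-- The extension of a product. -/
def cons (X : EnvAlg k R S) : Extension P (X ⊠ Q₀) (X ⊠ Q₁) where
  j q := wl X (e.j q)
  -- This is the reassociation $u\otimes(q_0\otimes q)\mapsto(u\otimes q_0)\otimes q$. Products are
  -- bracketed to the right, whereas kernels on $M\otimes N$ are to be tensored with a last factor.
  toB := (BTensor.lift (rid S) (e.consBilin X) (e.consBilin_balanced X)).comp (Takeuchi.toB X Q₁)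
  toB_j q u := by
    induction u using quo_induction with
    | h1 w v =>
      rw [wl_jmap, AddMonoidHom.comp_apply, toB_jmap, BTensor.lift_tmul]
      change BTensor.map _ _ _ (e.toB _) = _
      rw [e.toB_j, BTensor.map_tmul]
      rfl
    | h2 a b ha hb => simp only [map_add, ha, hb, AddMonoidHom.add_apply]
  toB_injective := by
    have hj : ∀ q q' u, e.j (q + q') u = e.j q u + e.j q' u := fun q q' u =>
      e.toB_injective (by rw [map_add, e.toB_j, e.toB_j, e.toB_j, map_add])
    have hj' : ∀ (y : T) q u, e.j (y • q) u = e.j q (op y • u) := fun y q u =>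
      e.toB_injective (by rw [e.toB_j, e.toB_j, BTensor.smul_tmul]; rfl)
    let g : Quo (X ⊠ Q₀) →+ Quo P →+ Quo (X ⊠ Q₁) := AddMonoidHom.mk'
      (fun u => AddMonoidHom.mk' (fun q => wl X (e.j q) u) (fun q q' => by
        induction u using quo_induction with
        | h1 w v => rw [wl_jmap, wl_jmap, wl_jmap, hj, jmap_add]
        | h2 a b ha hb => simp only [map_add, ha, hb]; abel))
      (fun u u' => AddMonoidHom.ext fun q => map_add (wl X (e.j q)) u u')
    have hg : ∀ (y : Tᵐᵒᵖ) u q, g (y • u) q = g u (unop (rid T y) • q) := fun y u q => by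
      change wl X (e.j q) (wl X _ u) = wl X (e.j _) u
      rw [wl_wl]
      refine wl_congr _ (fun v => ?_) u
      exact (hj' (unop y) q v).symm
    refine Function.LeftInverse.injective (g := BTensor.lift (rid T) g hg) fun w => ?_
    induction w using quo_induction with
    | h1 v u =>
      rw [AddMonoidHom.comp_apply, toB_jmap, BTensor.lift_tmul]
      change BTensor.lift _ _ _ (BTensor.map _ _ _ (e.toB v)) = _
      induction v using e.induction with
      | h1 q w =>
        rw [e.toB_j, BTensor.map_tmul, BTensor.lift_tmul]
        exact wl_jmap X (e.j q) w u
      | h2 a b ha hb => rw [map_add, map_add, map_add, ha, hb, jmap_add]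
    | h2 a b ha hb => simp only [map_add, ha, hb]

end Extension

end Flatness

/-! ### Local projectivity of tensor products and preservation of the conditions defining composites
-/

section Kernels

variable {k : Type u} [CommRing k]
variable {R S T Q : Type v} [Ring R] [Algebra k R] [Ring S] [Algebra k S] [Ring T] [Algebra k T]
  [Ring Q] [Algebra k Q]

attribute [local instance] rightLast rightCons

/-- All finitely generated submodules of `X` are projective, on both sides. -/
class EnvAlg.Flat (X : EnvAlg k R S) : Prop where
  right : @LocProj Sᵐᵒᵖ X _ _ X.rightModule
  left : @LocProj R X _ _ X.leftModule

/-- All finitely generated submodules of the left module `Quo P` are projective. -/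
class LeftFlat (P : RelAlg k R) [Balanced P] : Prop where
  out : LocProj R (Quo P)

/-- All finitely generated submodules of the right module `Quo P` are projective. -/
class RightFlat (T : Type v) [Ring T] (P : RelAlg k R) [Module Tᵐᵒᵖ (Quo P)] : Prop where
  out : LocProj Tᵐᵒᵖ (Quo P)

theorem EnvAlg.UnionOfProjectives.flat {X : EnvAlg k R S} (h : X.UnionOfProjectives) [hR : Hereditary R]
    [hS : Hereditary S] : X.Flat where
  right := @IsUnionOfProjectives.locProj Sᵐᵒᵖ X _ _ X.rightModule hS.out.2 h.1
  left := @IsUnionOfProjectives.locProj R X _ _ X.leftModule hR.out.1 h.2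

theorem EnvAlg.Flat.unionOfProjectives {X : EnvAlg k R S} (h : X.Flat) : X.UnionOfProjectives :=
  ⟨@LocProj.isUnionOfProjectives Sᵐᵒᵖ X _ _ X.rightModule h.right,
    @LocProj.isUnionOfProjectives R X _ _ X.leftModule h.left⟩

/-- The inverse of the class map of a single factor. -/
noncomputable def unlast (X : EnvAlg k R S) (u : Quo X.last) : X := (cls_surjective X.last u).choose

theorem cls_unlast (X : EnvAlg k R S) (u : Quo X.last) : cls X.last (unlast X u) = u :=
  (cls_surjective X.last u).choose_spec

theorem unlast_cls (X : EnvAlg k R S) (x : X) : unlast X (cls X.last x) = x :=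
  cls_last_injective X (cls_unlast X _)

theorem unlast_add (X : EnvAlg k R S) (u u' : Quo X.last) :
    unlast X (u + u') = unlast X u + unlast X u' :=
  cls_last_injective X (by rw [cls_unlast, map_add, cls_unlast, cls_unlast])

theorem unlast_injective (X : EnvAlg k R S) : Function.Injective (unlast X) :=
  Function.LeftInverse.injective (cls_unlast X)

instance (X : EnvAlg k R S) [h : X.Flat] : LeftFlat X.last where
  out := by
    let : Module R X := X.leftModule
    exact h.left.of_injective
      { toFun := unlast X
        map_add' := unlast_add X
        map_smul' := fun r u => cls_last_injective X (by
          obtain ⟨x, rfl⟩ := cls_surjective _ u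
          rw [cls_unlast, unlast_cls]
          rfl) } (unlast_injective X)

instance (X : EnvAlg k R S) [h : X.Flat] : RightFlat S X.last where
  out := by
    let : Module Sᵐᵒᵖ X := X.rightModule
    exact h.right.of_injective
      { toFun := unlast X
        map_add' := unlast_add X
        map_smul' := fun r u => cls_last_injective X (by
          obtain ⟨x, rfl⟩ := cls_surjective _ u
          rw [cls_unlast, unlast_cls]
          rfl) } (unlast_injective X)

theorem flat_of_last {X : EnvAlg k R S} (hl : LocProj R (Quo X.last))
    (hr : LocProj Sᵐᵒᵖ (Quo X.last)) : X.Flat where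
  right := by
    let : Module Sᵐᵒᵖ X := X.rightModule
    exact hr.of_injective
      { toFun := cls X.last
        map_add' := map_add _
        map_smul' := fun r u => rfl } (cls_last_injective X)
  left := by
    let : Module R X := X.leftModule
    exact hl.of_injective
      { toFun := cls X.last
        map_add' := map_add _
        map_smul' := fun r u => rfl } (cls_last_injective X)

/-- The interchange of the factors of a balanced tensor product over `S`. -/
abbrev flipB {S : Type v} [Ring S] (X V : Type v) [AddCommGroup X] [AddCommGroup V]
    [Module Sᵐᵒᵖ X] [Module S V] : BTensor (rid S) X V ≃+ BTensor (lid S) V X :=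
  BTensor.flip (rid S) (lid S) unop_lid unop_rid

/-- The left action on $X\otimes P$ comes from `X` and the second factor is locally projective over
`S`, so `BTensor.locProj` applies to the identification with the balanced tensor product. -/
instance (X : EnvAlg k R S) (P : RelAlg k S) [Balanced P] [hR : Hereditary R] [X.Flat]
    [hP : LeftFlat P] : LeftFlat (X ⊠ P) where
  out := by
    have : SMulCommClass R Sᵐᵒᵖ (Quo X.last) := SMulCommClass.symm _ _ _
    refine BTensor.locProj (unop_lid (S := S)) (unop_rid (S := S)) hR.out.1
      (RightFlat.out (T := S) (P := X.last)) (LeftFlat.out (P := X.last)) hP.out (toB X P)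
      (toB_injective X P) fun r w => ?_
    induction w using quo_induction with
    | h1 q u => rw [← (jmap X q).map_smul, toB_jmap, toB_jmap, BTensor.map_tmul]; rfl
    | h2 a b ha hb => rw [smul_add, map_add, ha, hb, map_add, map_add]

/-- The same with the factors interchanged, since the right action comes from `P`. -/
instance (X : EnvAlg k R S) (P : RelAlg k S) [Balanced P] [Module Tᵐᵒᵖ (Quo P)]
    [SMulCommClass Tᵐᵒᵖ S (Quo P)] [hT : Hereditary T] [X.Flat]
    [hP : LeftFlat P] [hP' : RightFlat T P] : RightFlat T (X ⊠ P) where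
  out := by
    refine BTensor.locProj (unop_rid (S := S)) (unop_lid (S := S)) hT.out.2
      hP.out hP'.out (RightFlat.out (T := S) (P := X.last))
      ((flipB (Quo X.last) (Quo P)).toAddMonoidHom.comp (toB X P))
      ((flipB (Quo X.last) (Quo P)).injective.comp (toB_injective X P))
      fun r w => ?_
    change flipB _ _ (toB X P _) = BTensor.map _ _ _ (flipB _ _ (toB X P _))
    induction w using quo_induction with
    | h1 q u =>
      rw [op_smul_cons, wl_jmap, toB_jmap, toB_jmap, BTensor.flip_tmul, BTensor.flip_tmul,
        BTensor.map_tmul]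
      rfl
    | h2 a b ha hb => rw [smul_add, map_add, map_add, ha, hb, map_add, map_add, map_add]

theorem toB_wl (X : EnvAlg k R S) {P P' : RelAlg k S} [Balanced P] [Balanced P']
    (φ : Quo P →ₗ[S] Quo P') (u) :
    toB X P' (wl X φ u) = BTensor.map (rid S) LinearMap.id φ (toB X P u) := by
  induction u using quo_induction with
  | h1 q u => rw [wl_jmap, toB_jmap, toB_jmap, BTensor.map_tmul]; rfl
  | h2 a b ha hb => simp only [map_add, ha, hb]

theorem wl_injective (X : EnvAlg k R S) [X.Flat] {P P' : RelAlg k S} [Balanced P] [Balanced P']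
    {φ : Quo P →ₗ[S] Quo P'} (hφ : Function.Injective φ) : Function.Injective (wl X φ) := by
  intro a b hab
  apply toB_injective X P
  apply BTensor.map_injective (rid S) (RightFlat.out (T := S) (P := X.last)) φ hφ
  rw [← toB_wl, ← toB_wl, hab]

theorem toB_surjective (X : EnvAlg k R S) (P : RelAlg k S) [Balanced P] :
    Function.Surjective (toB X P) := (Extension.last X P).toB_surjective

theorem exists_wl_eq (X : EnvAlg k R S) [X.Flat] {P P' Z Z' : RelAlg k S} [Balanced P]
    [Balanced P'] [Balanced Z] [Balanced Z'] [hZ : LeftFlat Z] [hZ' : LeftFlat Z'] {ι : Type*}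
    (θ : ι → Quo P →ₗ[S] Quo Z) (θ' : Quo P →ₗ[S] Quo Z') (f : Quo P' →ₗ[S] Quo P)
    (hf : ∀ v, (∀ i, θ i v = 0) → θ' v = 0 → ∃ v', f v' = v) (w : Quo (X ⊠ P))
    (hw : ∀ i, wl X (θ i) w = 0) (hw' : wl X θ' w = 0) : ∃ w', wl X f w' = w := by
  obtain ⟨z, hz⟩ := BTensor.mem_range_map (rid S) unop_lid unop_rid
    (RightFlat.out (T := S) (P := X.last)) hZ.out hZ'.out θ θ' f hf (toB X P w)
    (fun i => by rw [← toB_wl, hw, map_zero]) (by rw [← toB_wl, hw', map_zero])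
  obtain ⟨w', rfl⟩ := toB_surjective X P' z
  exact ⟨w', toB_injective X P (by rw [toB_wl, hz])⟩

namespace Extension

variable {P : RelAlg k T} [Balanced P]
  {Q₀ Q₁ Q₀' Q₁' : RelAlg k S} [Balanced Q₀] [Balanced Q₁] [Balanced Q₀'] [Balanced Q₁']
  [Module Tᵐᵒᵖ (Quo Q₀)] [SMulCommClass Tᵐᵒᵖ S (Quo Q₀)]
  [Module Tᵐᵒᵖ (Quo Q₀')] [SMulCommClass Tᵐᵒᵖ S (Quo Q₀')]

/-- `Φ` is the extension of the map of right modules `φ`. -/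
structure Maps (e : Extension P Q₀ Q₁) (e' : Extension P Q₀' Q₁') (φ : Quo Q₀ →ₗ[S] Quo Q₀')
    (Φ : Quo Q₁ →ₗ[S] Quo Q₁') : Prop where
  smul : ∀ (y : Tᵐᵒᵖ) u, φ (y • u) = y • φ u
  j : ∀ q u, Φ (e.j q u) = e'.j q (φ u)

namespace Maps

variable {e : Extension P Q₀ Q₁} {e' : Extension P Q₀' Q₁'} {φ : Quo Q₀ →ₗ[S] Quo Q₀'}
  {Φ : Quo Q₁ →ₗ[S] Quo Q₁'} (h : Maps e e' φ Φ)

/-- The map of right modules. -/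
def right : Quo Q₀ →ₗ[Tᵐᵒᵖ] Quo Q₀' where
  toFun := φ
  map_add' := map_add φ
  map_smul' := h.smul

theorem toB (w) : e'.toB (Φ w) = BTensor.map (rid T) h.right LinearMap.id (e.toB w) := by
  induction w using e.induction with
  | h1 q u => rw [h.j, e.toB_j, e'.toB_j, BTensor.map_tmul]; rfl
  | h2 a b ha hb => simp only [map_add, ha, hb]

theorem flip_toB (w) : flipB _ _ (e'.toB (Φ w)) =
    BTensor.map (lid T) LinearMap.id h.right
      (flipB _ _ (e.toB w)) := by
  rw [h.toB]
  generalize e.toB w = z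
  induction z using BTensor.induction_on with
  | h1 u q => simp only [BTensor.map_tmul, BTensor.flip_tmul]
  | h2 a b ha hb => simp only [map_add, ha, hb]

/-- Up to the identifications `toB`, the map `Φ` is $\varphi\otimes P$, and `P` is flat. -/
theorem injective (h : Maps e e' φ Φ) [hP : LeftFlat P] (hφ : Function.Injective φ) : Function.Injective Φ := by
  intro a b hab
  apply e.toB_injective
  apply BTensor.map_injective_left (rid T) unop_lid unop_rid hP.out h.right hφ
  rw [← h.toB, ← h.toB, hab]

theorem sub (h : Maps e e' φ Φ) {φ' : Quo Q₀ →ₗ[S] Quo Q₀'} {Φ' : Quo Q₁ →ₗ[S] Quo Q₁'}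
    (h' : Maps e e' φ' Φ') :
    Maps e e' (φ - φ') (Φ - Φ') where
  smul y u := by
    rw [LinearMap.sub_apply, h.smul, h'.smul, LinearMap.sub_apply, smul_sub]
  j q u := by
    rw [LinearMap.sub_apply, h.j, h'.j, LinearMap.sub_apply, map_sub]

theorem wl (h : Maps e e' φ Φ) (X : EnvAlg k R S) :
    Maps (e.cons X) (e'.cons X) (Takeuchi.wl X φ) (Takeuchi.wl X Φ) where
  smul y u := by
    rw [op_smul_cons, op_smul_cons, wl_wl, wl_wl]
    exact wl_congr X (fun v => h.smul y v) u
  j q u := by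
    change Takeuchi.wl X Φ (Takeuchi.wl X (e.j q) u) = Takeuchi.wl X (e'.j q) (Takeuchi.wl X φ u)
    rw [wl_wl, wl_wl]
    exact wl_congr X (fun v => h.j q v) u

theorem inl (X : EnvAlg k R S) (e : Extension P Q₀ Q₁) (x : X) :
    Maps (e.cons X) (e.cons X) (lsm (X ⊠ Q₀) (Takeuchi.inl X Q₀ x))
      (lsm (X ⊠ Q₁) (Takeuchi.inl X Q₁ x)) := by
  have key : ∀ {P P' : RelAlg k S} [Balanced P] [Balanced P'] (φ : Quo P →ₗ[S] Quo P') u,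
      Takeuchi.wl X φ (lsm (X ⊠ P) (Takeuchi.inl X P x) u) =
        lsm (X ⊠ P') (Takeuchi.inl X P' x) (Takeuchi.wl X φ u) := by
    intro P P' _ _ φ u
    rw [lsm_apply, lsm_apply]
    induction u using ten_induction with
    | h1 a q => rw [inl_smul_ten, wl_ten, wl_ten, inl_smul_ten]
    | h2 a b ha hb => simp only [smul_add, map_add, ha, hb]
  exact ⟨fun y u => (key _ u).symm, fun q u => (key _ u).symm⟩

end Maps

theorem lsm_inr (X : EnvAlg k R S) (P : RelAlg k S) [Balanced P] (p : P) (u) :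
    lsm (X ⊠ P) (Takeuchi.inr X P p) u = wl X (lsm P p) u := by
  rw [lsm_apply]
  induction u using ten_induction with
  | h1 a q => rw [inr_smul_ten, wl_ten, lsm_apply]
  | h2 a b ha hb => simp only [smul_add, map_add, ha, hb]

theorem Maps.inr (X : EnvAlg k R S) {e : Extension P Q₀ Q₁} {p : Q₀} {p' : Q₁}
    (h : Maps e e (lsm Q₀ p) (lsm Q₁ p')) :
    Maps (e.cons X) (e.cons X) (lsm (X ⊠ Q₀) (Takeuchi.inr X Q₀ p))
      (lsm (X ⊠ Q₁) (Takeuchi.inr X Q₁ p')) := by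
  rw [LinearMap.ext (lsm_inr X Q₀ p), LinearMap.ext (lsm_inr X Q₁ p')]
  exact h.wl X

theorem Maps.lsm_last (X : EnvAlg k R T) (x : X) : Maps (Extension.last X P) (Extension.last X P)
    (lsm X.last x) (lsm (X ⊠ P) (Takeuchi.inl X P x)) where
  smul y u := by
    obtain ⟨a, rfl⟩ := cls_surjective _ u
    change cls X.last (x * (a * X.s (unop y))) = cls X.last (x * a * X.s (unop y))
    rw [mul_assoc]
  j q u := by
    obtain ⟨a, rfl⟩ := cls_surjective _ u
    exact inl_smul_ten x a q

theorem Maps.fin {X : EnvAlg k R T} {X₁ : EnvAlg k R Q} {X₂ : EnvAlg k Q T}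
    (f : TakHom X X₁ X₂) : Maps (Extension.last X P) ((Extension.last X₂ P).cons X₁)
      f.fin (f.ext P) where
  smul y u := f.fin_rs (unop y) u
  j q u := f.ext_jmap u q

theorem Maps.ext {X : EnvAlg k R S} {X₁ : EnvAlg k R Q} {X₂ : EnvAlg k Q S}
    (f : TakHom X X₁ X₂) (e : Extension P Q₀ Q₁) :
    Maps (e.cons X) ((e.cons X₂).cons X₁) (f.ext Q₀) (f.ext Q₁) where
  smul _ u := f.ext_wl _ u
  j _ u := f.ext_wl _ u

end Extension

open Extension in
theorem TakHom.ext_injective {X : EnvAlg k R T} {X₁ : EnvAlg k R S} {X₂ : EnvAlg k S T}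
    {f : TakHom X X₁ X₂} (hf : Function.Injective f.fin) (P : RelAlg k T) [Balanced P]
    [LeftFlat P] : Function.Injective (f.ext P) :=
  (Maps.fin f).injective hf

/-- Takeuchi's condition at the first tensor sign. -/
def IsCentral (X : EnvAlg k R S) (P : RelAlg k S) (u : Quo (X ⊠ P)) : Prop :=
  ∀ y : S, inl X P (X.s y) • u = inr X P (P.τ (op y)) • u

theorem IsTak.isCentral {X : EnvAlg k R S} {P : RelAlg k S} {u : Quo (X ⊠ P)} (hu : IsTak _ u) :
    IsCentral X P u := by
  intro y
  rw [← sub_eq_zero, ← sub_smul]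
  exact hu _ (mem_rel.2 (Or.inl ⟨y, rfl⟩))

theorem isTak_of_isCentral {X : EnvAlg k R S} {Y : EnvAlg k S T} {u : Quo (X ⊠ Y.last)}
    (hu : IsCentral X Y.last u) : IsTak _ u := by
  intro b hb
  rw [mem_rel] at hb
  obtain ⟨y, rfl⟩ | ⟨b, hb, rfl⟩ := hb
  · rw [sub_smul, hu y, sub_self]
  · exact hb.elim

/-- The map whose kernel is Takeuchi's condition for `y`. -/
def centralMap (X : EnvAlg k R S) (P : RelAlg k S) [Balanced P] (y : S) :
    Quo (X ⊠ P) →ₗ[R] Quo (X ⊠ P) :=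
  lsm (X ⊠ P) (inl X P (X.s y)) - lsm (X ⊠ P) (inr X P (P.τ (op y)))

theorem centralMap_eq_zero {X : EnvAlg k R S} {P : RelAlg k S} [Balanced P] {u : Quo (X ⊠ P)} :
    (∀ y, centralMap X P y u = 0) ↔ IsCentral X P u :=
  forall_congr' fun y => by
    rw [centralMap, LinearMap.sub_apply, lsm_apply, lsm_apply, sub_eq_zero]

-- Tensoring on the right preserves composites. The Takeuchi conditions for all $y$ and the
-- difference of the two coactions on $M\otimes N\otimes P$ are extensions of maps on $M\otimes N$
-- that are linear on the right, so `BTensor.mem_range_map` applies with the locally projective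
-- factor `P`.
open Extension in
theorem TakHom.exists_ext_eq {X : EnvAlg k R T} {M : EnvAlg k R S} {N : EnvAlg k S T}
    {B : EnvAlg k S S} [M.Flat] [N.Flat] [B.Flat] [Hereditary S] [hT : Hereditary T]
    {f : TakHom X M N} (r : TakHom M M B) (l : TakHom N B N)
    (hf : ∀ u, IsCentral M N.last u → r.ext N.last u = wl M l.fin u → ∃ v, f.fin v = u)
    {P : RelAlg k T} [Balanced P] [hP : LeftFlat P] {w : Quo (M ⊠ N ⊠ P)}
    (hw : IsCentral M (N ⊠ P) w) (hw' : r.ext (N ⊠ P) w = wl M (l.ext P) w) :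
    ∃ v, f.ext P v = w := by
  let e := Extension.last N P
  -- Both conditions involve only left multiplications and maps of the factors $M$, $N$, hence they
  -- commute with the right action on $N$.
  have h1 : ∀ y, Maps (e.cons M) (e.cons M) (centralMap M N.last y) (centralMap M (N ⊠ P) y) :=
    fun y => (Maps.inl M e (M.s y)).sub (Maps.inr M (Maps.lsm_last N (N.t (op y))))
  have h2 : Maps (e.cons M) ((e.cons B).cons M) (r.ext N.last - wl M l.fin)
      (r.ext (N ⊠ P) - wl M (l.ext P)) := (Maps.ext r e).sub ((Maps.fin l).wl M)
  have h3 := Maps.fin (P := P) f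
  obtain ⟨z, hz⟩ := BTensor.mem_range_map (lid T) unop_rid unop_lid hP.out
    (RightFlat.out (T := T) (P := M ⊠ N.last)) (RightFlat.out (T := T) (P := M ⊠ B ⊠ N.last))
    (fun y => (h1 y).right) h2.right h3.right
    (fun v hv hv' => hf v (centralMap_eq_zero.1 hv) (sub_eq_zero.1 hv'))
    (flipB _ _ ((e.cons M).toB w))
    (fun y => by
      rw [← (h1 y).flip_toB, centralMap_eq_zero.2 hw, map_zero, map_zero])
    (by
      rw [← h2.flip_toB, LinearMap.sub_apply, hw', sub_self, map_zero, map_zero])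
  obtain ⟨z, rfl⟩ := (flipB _ _).surjective z
  obtain ⟨v, rfl⟩ := (Extension.last X P).toB_surjective z
  refine ⟨v, (e.cons M).toB_injective
    ((flipB _ _).injective ?_)⟩
  rw [← hz]
  exact h3.flip_toB v

/-- Tensoring on the left preserves composites. Here no reassociation is needed, as the added factor
is already the outermost one. -/
theorem TakHom.exists_wl_eq {X : EnvAlg k R T} {M : EnvAlg k R S} {N : EnvAlg k S T}
    {B : EnvAlg k S S} [M.Flat] [N.Flat] [B.Flat] [Hereditary R] [Hereditary S]
    {f : TakHom X M N} (r : TakHom M M B) (l : TakHom N B N)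
    (hf : ∀ u, IsCentral M N.last u → r.ext N.last u = wl M l.fin u → ∃ v, f.fin v = u)
    (Y : EnvAlg k Q R) [Y.Flat] {w : Quo (Y ⊠ M ⊠ N.last)}
    (hw : ∀ y, wl Y (centralMap M N.last y) w = 0)
    (hw' : wl Y (r.ext N.last) w = wl Y (wl M l.fin) w) :
    ∃ v, wl Y f.fin v = w := by
  refine Takeuchi.exists_wl_eq Y (centralMap M N.last) (r.ext N.last - wl M l.fin) f.fin
    (fun v hv hv' => hf v (centralMap_eq_zero.1 hv) (sub_eq_zero.1 hv')) w hw ?_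
  rw [← sub_eq_zero] at hw'
  rw [← hw']
  clear hw hw'
  induction w using ten_induction with
  | h1 x q => rw [wl_ten, wl_ten, wl_ten, LinearMap.sub_apply, map_sub]
  | h2 a b ha hb => simp only [map_add, ha, hb]; abel

theorem wl_centralMap_of_isTak (Y : EnvAlg k Q R) {M : EnvAlg k R S} {P : RelAlg k S} [Balanced P]
    {w : Quo (Y ⊠ M ⊠ P)} (hw : IsTak _ w) (y : S) : wl Y (centralMap M P y) w = 0 := by
  have h := hw _ (mem_rel.2 (Or.inr ⟨_, mem_rel.2 (Or.inl ⟨y, rfl⟩), rfl⟩))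
  rw [← h, ← lsm_apply, Extension.lsm_inr]
  refine wl_congr Y (fun v => ?_) w
  rw [lsm_apply, sub_smul]
  rfl

end Kernels

/-! ### Restriction of the outer coactions to the composite -/

section Composite

variable {k : Type u} [CommRing k]
variable {R S T : Type v} [Ring R] [Algebra k R] [Ring S] [Algebra k S] [Ring T] [Algebra k T]
variable {A : Bialgebroid k R} {B : Bialgebroid k S} {C : Bialgebroid k T}

/-- The factorization of a linear map through an injective linear map. -/
noncomputable def factor {U V W : Type v} [AddCommGroup U] [Module R U] [AddCommGroup V]
    [Module R V] [AddCommGroup W] [Module R W] (f : U →ₗ[R] W) {g : V →ₗ[R] W}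
    (hg : Function.Injective g) (h : ∀ u, ∃ v, g v = f u) : U →ₗ[R] V where
  toFun u := (h u).choose
  map_add' a b := hg ((h (a + b)).choose_spec.trans (by
    rw [map_add f, map_add g, (h a).choose_spec, (h b).choose_spec]))
  map_smul' r a := hg ((h (r • a)).choose_spec.trans (by
    rw [RingHom.id_apply, map_smul f, map_smul g, (h a).choose_spec]))

theorem factor_spec {U V W : Type v} [AddCommGroup U] [Module R U] [AddCommGroup V]
    [Module R V] [AddCommGroup W] [Module R W] (f : U →ₗ[R] W) {g : V →ₗ[R] W}
    (hg : Function.Injective g) (h : ∀ u, ∃ v, g v = f u) (u : U) : g (factor f hg h u) = f u :=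
  (h u).choose_spec

/-! ### The algebra underlying the composite -/

/-- The elements of the Takeuchi product on which the two coactions of `B` agree. -/
def bulletSub (M : ComodAlg A B) (N : ComodAlg B C) :
    Subalgebra k (Tak (M.toEnvAlg ⊠ N.last)) where
  carrier := {q | M.rho.ext N.last (val (M.toEnvAlg ⊠ N.last) q) = wl M.toEnvAlg N.lam.fin (val (M.toEnvAlg ⊠ N.last) q)}
  mul_mem' {p q} hp hq := by
    obtain ⟨w, hw⟩ := cls_surjective _ (val (M.toEnvAlg ⊠ N.last) p)
    have hp : M.rho.ext N.last (val (M.toEnvAlg ⊠ N.last) p) = wl M.toEnvAlg N.lam.fin (val (M.toEnvAlg ⊠ N.last) p) := hp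
    rw [← hw] at hp
    change M.rho.ext N.last (val (M.toEnvAlg ⊠ N.last) (p * q)) = wl M.toEnvAlg N.lam.fin (val (M.toEnvAlg ⊠ N.last) (p * q))
    rw [val_mul p q hw]
    -- Only the right factor has to satisfy Takeuchi's condition; the left one enters through an
    -- arbitrary representative.
    exact (M.rho.ext_mult N.last).eq_smul (N.lam.fin_mult.wl M.toEnvAlg) hp (isTak_val q) hq
  add_mem' {p q} hp hq := by
    change M.rho.ext N.last (val (M.toEnvAlg ⊠ N.last) (p + q)) = wl M.toEnvAlg N.lam.fin (val (M.toEnvAlg ⊠ N.last) (p + q))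
    rw [map_add, map_add, map_add]
    exact congrArg₂ _ hp hq
  algebraMap_mem' c := by
    change M.rho.ext N.last (val (M.toEnvAlg ⊠ N.last) (algebraMap k _ c)) =
      wl M.toEnvAlg N.lam.fin (val (M.toEnvAlg ⊠ N.last) (algebraMap k _ c))
    rw [Algebra.algebraMap_eq_smul_one, map_smul, val_one, LinearMap.map_smul_of_tower,
      LinearMap.map_smul_of_tower, (M.rho.ext_mult N.last).one,
      (N.lam.fin_mult.wl M.toEnvAlg).one]

/-- An algebra map to the Takeuchi product. -/
def toTak {Y : Type v} [Ring Y] [Algebra k Y] {P : RelAlg k R} (f : Y →ₐ[k] P)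
    (hf : ∀ y, ∀ b ∈ P.rel, b * f y ∈ Ideal.span P.rel) : Y →ₐ[k] Tak P :=
  (Ideal.Quotient.mkₐ k (takIdeal P)).comp (f.codRestrict (takSub P) hf)

/-- The elements $1\otimes s(y)$ commute with the relations, because $s$ and $t$ commute in `Y`; so
they lie in the Takeuchi product. -/
theorem rel_mul_inr (X : EnvAlg k R S) (Y : EnvAlg k S T) (y : T) :
    ∀ b ∈ (X ⊠ Y.last).rel, b * inr X Y.last (Y.s y) ∈ Ideal.span (X ⊠ Y.last).rel := by
  intro b hb
  have h : b * inr X Y.last (Y.s y) = inr X Y.last (Y.s y) * b := by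
    rw [mem_rel] at hb
    obtain ⟨x, rfl⟩ | ⟨b', hb, -⟩ := hb
    · rw [sub_mul, mul_sub, tm_one_comm]
      congr 1
      rw [← map_mul, ← map_mul]
      congr 1
      exact (Y.s_mul_t y (op x)).symm
    · exact hb.elim
  rw [h]
  exact Ideal.mul_mem_left _ _ (Ideal.subset_span hb)

/-- The left structure map of the composite. -/
def bulletT (M : ComodAlg A B) (N : ComodAlg B C) : Rᵐᵒᵖ →ₐ[k] bulletSub M N :=
  (toTak ((M.toEnvAlg ⊠ N.last).τ)
    (fun y b hb => Balanced.rel_mul_τ b hb y)).codRestrict (bulletSub M N) (by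
    intro x
    change M.rho.ext N.last (cls (M.toEnvAlg ⊠ N.last) ((M.toEnvAlg ⊠ N.last).τ x)) =
      wl M.toEnvAlg N.lam.fin (cls (M.toEnvAlg ⊠ N.last) ((M.toEnvAlg ⊠ N.last).τ x))
    rw [← cls_smul_one, (M.rho.ext_mult N.last).tau, (N.lam.fin_mult.wl M.toEnvAlg).tau,
      (M.rho.ext_mult N.last).one, (N.lam.fin_mult.wl M.toEnvAlg).one])

/-- The right structure map of the composite. -/
def bulletS (M : ComodAlg A B) (N : ComodAlg B C) : T →ₐ[k] bulletSub M N :=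
  (toTak ((inr M.toEnvAlg N.last).comp N.s)
    (fun y b hb => rel_mul_inr M.toEnvAlg N.toEnvAlg y b hb)).codRestrict (bulletSub M N) (by
    intro x
    change M.rho.ext N.last (cls (M.toEnvAlg ⊠ N.last) (tm (P := N.last) 1 (N.s x))) =
      wl M.toEnvAlg N.lam.fin (cls (M.toEnvAlg ⊠ N.last) (tm (P := N.last) 1 (N.s x)))
    have h : M.rho.fin (cls M.last 1) = ten 1 (cls B.last 1) :=
      M.rho.fin_mult.one.trans (ten_cls (P := B.last) 1 1).symm
    rw [← ten_cls, wl_ten, M.rho.ext_ten, h, wl_ten, jmap_cls, N.lam.fin_cls, N.lam.map_s,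
      ← ten_cls])

theorem bullet_commute (M : ComodAlg A B) (N : ComodAlg B C) (x : Rᵐᵒᵖ) (y : T) :
    Commute (bulletT M N x) (bulletS M N y) := by
  refine Subtype.ext (val_injective ?_)
  change cls (M.toEnvAlg ⊠ N.last) (inl _ _ (M.t x) * inr _ _ (N.s y)) =
    cls (M.toEnvAlg ⊠ N.last) (inr _ _ (N.s y) * inl _ _ (M.t x))
  rw [tm_one_comm]

/-- The algebra underlying the composite. -/
@[reducible] def bulletAlg (M : ComodAlg A B) (N : ComodAlg B C) : EnvAlg k R T where
  carrier := bulletSub M N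
  η := Algebra.TensorProduct.lift (bulletT M N) (bulletS M N) (bullet_commute M N)

/-- The inclusion of the composite in the Takeuchi product. -/
def bulletHom (M : ComodAlg A B) (N : ComodAlg B C) :
    TakHom (bulletAlg M N) M.toEnvAlg N.toEnvAlg where
  toAlg := (bulletSub M N).val
  map_t x := by
    have h : (bulletAlg M N).t x = bulletT M N x := by
      change Algebra.TensorProduct.lift (bulletT M N) (bulletS M N) (bullet_commute M N) (x ⊗ₜ 1) = _
      rw [Algebra.TensorProduct.lift_tmul, map_one, mul_one]
    rw [h]
    rfl
  map_s x := by
    have h : (bulletAlg M N).s x = bulletS M N x := by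
      change Algebra.TensorProduct.lift (bulletT M N) (bulletS M N) (bullet_commute M N) (1 ⊗ₜ x) = _
      rw [Algebra.TensorProduct.lift_tmul, map_one, one_mul]
    rw [h]
    rfl

/-- `ι` exhibits `X` as the algebra underlying the composite of `M` and `N`. -/
structure IsComposite (M : ComodAlg A B) (N : ComodAlg B C) {X : EnvAlg k R T}
    (ι : TakHom X M.toEnvAlg N.toEnvAlg) : Prop where
  injective : Function.Injective ι.fin
  equalizes : ∀ u, M.rho.ext N.last (ι.fin u) = wl M.toEnvAlg N.lam.fin (ι.fin u)
  exists_eq : ∀ u, IsCentral M.toEnvAlg N.last u →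
    M.rho.ext N.last u = wl M.toEnvAlg N.lam.fin u → ∃ v, ι.fin v = u

theorem isComposite_bulletHom (M : ComodAlg A B) (N : ComodAlg B C) :
    IsComposite M N (bulletHom M N) where
  injective a b hab := by
    obtain ⟨a, rfl⟩ := cls_surjective _ a
    obtain ⟨b, rfl⟩ := cls_surjective _ b
    exact congrArg _ (Subtype.ext (val_injective hab))
  equalizes u := by
    obtain ⟨u, rfl⟩ := cls_surjective _ u
    exact u.2
  exists_eq u hu hu' := by
    obtain ⟨q, rfl⟩ := (isTak_of_isCentral hu).exists_val
    exact ⟨cls _ (⟨q, hu'⟩ : bulletSub M N), rfl⟩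

/-! ### The coactions on the composite -/

namespace IsComposite

variable {M : ComodAlg A B} {N : ComodAlg B C} {X : EnvAlg k R T}
  {ι : TakHom X M.toEnvAlg N.toEnvAlg} (h : IsComposite M N ι)

-- The composite embeds in $M\otimes N$ linearly on both sides, and $M\otimes N$ is locally
-- projective on both sides.
attribute [local instance] rightLast rightCons in
theorem flat (h : IsComposite M N ι) [M.Flat] [N.Flat] [Hereditary R] [Hereditary T] : X.Flat :=
  flat_of_last ((LeftFlat.out (P := M.toEnvAlg ⊠ N.last)).of_injective ι.fin h.injective)
    ((RightFlat.out (T := T) (P := M.toEnvAlg ⊠ N.last)).of_injective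
      { toFun := ι.fin
        map_add' := map_add _
        map_smul' := fun y u => ι.fin_rs (unop y) u } h.injective)

/-- The image of $\lambda_M\otimes1$ meets the conditions that define $A\otimes(M\bullet N)$ in
$A\otimes M\otimes N$. Takeuchi's conditions hold because $\lambda_M\otimes1$ is multiplicative, and
the coactions of $B$ agree because $\lambda_M$ commutes with $\rho_M$. -/
theorem exists_lam (h : IsComposite M N ι) [A.Flat] [B.Flat] [M.Flat] [N.Flat] [Hereditary R]
    [Hereditary S] (u) :
    ∃ v, wl A.toEnvAlg ι.fin v = M.lam.ext N.last (ι.fin u) := by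
  refine TakHom.exists_wl_eq M.rho N.lam h.exists_eq A.toEnvAlg
    (wl_centralMap_of_isTak _ ((M.lam.ext_mult N.last).isTak (ι.isTak u))) ?_
  rw [TakHom.assoc_ext M.lam_rho, h.equalizes, M.lam.ext_wl]

/-- The mirror image: the coactions of $B$ agree after $1\otimes\rho_N$ because $\lambda_N$ commutes
with $\rho_N$. -/
theorem exists_rho (h : IsComposite M N ι) [B.Flat] [C.Flat] [M.Flat] [N.Flat]
    [Hereditary S] [Hereditary T] (u) :
    ∃ v, ι.ext C.last v = wl M.toEnvAlg N.rho.fin (ι.fin u) := by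
  refine TakHom.exists_ext_eq M.rho N.lam h.exists_eq
    ((N.rho.fin_mult.wl M.toEnvAlg).isTak (ι.isTak u)).isCentral ?_
  rw [M.rho.ext_wl, h.equalizes, wl_wl, wl_wl]
  refine wl_congr _ (fun v => ?_) _
  rw [LinearMap.comp_apply, LinearMap.comp_apply, N.lam_rho]

variable [A.Flat] [B.Flat] [C.Flat] [M.Flat] [N.Flat] [Hereditary R] [Hereditary S] [Hereditary T]

/-- The left coaction on the composite, as a linear map. -/
noncomputable def lamFin : Quo X.last →ₗ[R] Quo (A.toEnvAlg ⊠ X.last) :=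
  factor (M.lam.ext N.last ∘ₗ ι.fin)
    (wl_injective A.toEnvAlg h.injective) h.exists_lam

theorem wl_lamFin (u) : wl A.toEnvAlg ι.fin (h.lamFin u) = M.lam.ext N.last (ι.fin u) :=
  factor_spec _ _ _ u

/-- The right coaction on the composite, as a linear map. -/
noncomputable def rhoFin : Quo X.last →ₗ[R] Quo (X ⊠ C.last) :=
  factor (wl M.toEnvAlg N.rho.fin ∘ₗ ι.fin)
    (ι.ext_injective h.injective C.last) h.exists_rho

theorem ext_rhoFin (u) : ι.ext C.last (h.rhoFin u) = wl M.toEnvAlg N.rho.fin (ι.fin u) :=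
  factor_spec _ _ _ u

/-- Multiplicativity descends from $\lambda_M\otimes1$ along the injection $A\otimes X\to A\otimes
M\otimes N$. -/
theorem lamFin_mult : Mult h.lamFin := by
  refine Mult.of_injective (ι.fin_mult.wl A.toEnvAlg) (wl_injective A.toEnvAlg h.injective) ?_
    (isTak_last X)
  rw [LinearMap.ext (f := wl A.toEnvAlg ι.fin ∘ₗ h.lamFin) (g := M.lam.ext N.last ∘ₗ ι.fin)
    h.wl_lamFin]
  exact (M.lam.ext_mult N.last).comp ι.fin_mult

theorem rhoFin_mult : Mult h.rhoFin := by
  refine Mult.of_injective (ι.ext_mult C.last) (ι.ext_injective h.injective C.last) ?_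
    (isTak_last X)
  rw [LinearMap.ext (f := ι.ext C.last ∘ₗ h.rhoFin) (g := wl M.toEnvAlg N.rho.fin ∘ₗ ι.fin)
    h.ext_rhoFin]
  exact (N.rho.fin_mult.wl M.toEnvAlg).comp ι.fin_mult

/-- The left coaction on the composite. -/
noncomputable def lam : TakHom X A.toEnvAlg X :=
  h.lamFin_mult.toTakHom (by
    intro y
    apply wl_injective A.toEnvAlg h.injective
    have h1 : M.lam.fin (cls M.last 1) = ten 1 (cls M.last 1) :=
      M.lam.fin_mult.one.trans (ten_cls (P := M.last) 1 1).symm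
    rw [h.wl_lamFin, ι.fin_cls, ι.map_s, ← ten_cls, M.lam.ext_ten, h1, wl_ten, jmap_cls, ← ten_cls,
      wl_ten, ι.fin_cls, ι.map_s, ten_cls])

theorem wl_lam (u) : wl A.toEnvAlg ι.fin (h.lam.fin u) = M.lam.ext N.last (ι.fin u) := by
  rw [lam, Mult.toTakHom_fin, h.wl_lamFin]

/-- The right coaction on the composite. -/
noncomputable def rho : TakHom X X C.toEnvAlg :=
  h.rhoFin_mult.toTakHom (by
    intro y
    apply ι.ext_injective h.injective C.last
    have h1 : ι.fin (cls X.last 1) = ten 1 (cls N.last 1) :=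
      ι.fin_mult.one.trans (ten_cls (P := N.last) 1 1).symm
    rw [h.ext_rhoFin, ι.fin_cls, ι.map_s, ← ten_cls, wl_ten, N.rho.fin_cls, N.rho.map_s, ← ten_cls,
      ← ten_cls, ι.ext_ten, h1, wl_ten, jmap_cls])

theorem ext_rho (u) : ι.ext C.last (h.rho.fin u) = wl M.toEnvAlg N.rho.fin (ι.fin u) := by
  rw [rho, Mult.toTakHom_fin, h.ext_rhoFin]

/-- The coactions on the composite. -/
noncomputable def coactions : Coactions A C X where
  lam := h.lam
  rho := h.rho
  -- Each law is checked after an injection: here into $A\otimes A\otimes M\otimes N$, for `rho_rho`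
  -- into $M\otimes N\otimes C\otimes C$, for `lam_rho` into $A\otimes M\otimes N\otimes C$, and for
  -- the counits into $M\otimes N$.
  lam_lam u := by
    apply wl_injective A.toEnvAlg (wl_injective A.toEnvAlg h.injective)
    rw [← A.com.ext_wl, h.wl_lam, ← TakHom.assoc_ext M.lam_lam, ← h.wl_lam, wl_wl, wl_wl]
    refine wl_congr _ (fun v => ?_) _
    rw [LinearMap.comp_apply, LinearMap.comp_apply, h.wl_lam]
  rho_rho u := by
    apply ι.ext_injective h.injective (C.toEnvAlg ⊠ C.last)
    rw [ι.ext_wl, ← TakHom.assoc_ext (fun u => (h.ext_rho u).symm), h.ext_rho, wl_wl, wl_wl]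
    refine wl_congr _ (fun v => ?_) _
    simp only [LinearMap.comp_apply]
    exact N.rho_rho v
  lam_rho u := by
    apply wl_injective A.toEnvAlg (ι.ext_injective h.injective C.last)
    rw [TakHom.assoc_ext h.wl_lam, h.ext_rho, M.lam.ext_wl, ← h.wl_lam, wl_wl, wl_wl]
    refine wl_congr _ (fun v => ?_) _
    simp only [LinearMap.comp_apply]
    exact h.ext_rho v
  eps_lam u := by
    apply h.injective
    rw [← A.eps_wl, h.wl_lam, A.eps_ext M.eps_lam]
  epsR_rho u := by
    apply h.injective
    rw [ι.fin_epsR, h.ext_rho, wl_wl]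
    exact (wl_congr _ (fun v => N.epsR_rho v) _).trans (wl_id _ _)

/-- The composite. -/
@[reducible] noncomputable def comodAlg : ComodAlg A C := h.coactions.comodAlg

theorem wl_comodAlg_lam (u) :
    wl A.toEnvAlg ι.fin (h.comodAlg.lam.fin u) = M.lam.ext N.last (ι.fin u) :=
  (congrArg _ (h.coactions.lam_fin u)).trans (h.wl_lam u)

theorem ext_comodAlg_rho (u) :
    ι.ext C.last (h.comodAlg.rho.fin u) = wl M.toEnvAlg N.rho.fin (ι.fin u) :=
  (congrArg _ (h.coactions.rho_fin u)).trans (h.ext_rho u)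

end IsComposite

/-! ### Comparison with the explicit formula for the coaction of a composite -/

theorem glue4_eq {R₀ R₁ R₂ R₃ R₄ : Type v} [Ring R₀] [Algebra k R₀] [Ring R₁] [Algebra k R₁]
    [Ring R₂] [Algebra k R₂] [Ring R₃] [Algebra k R₃] [Ring R₄] [Algebra k R₄]
    (X : EnvAlg k R₀ R₁) (Y : EnvAlg k R₁ R₂) (Z : EnvAlg k R₂ R₃) (U : EnvAlg k R₃ R₄) (u v) :
    glue4 X Y Z U u v = wl X (jmap Y v) u := by
  obtain ⟨u, rfl⟩ := cls_surjective _ u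
  obtain ⟨v, rfl⟩ := cls_surjective _ v
  rw [← smul_map_put12, Quo.map_cls, smul_cls, ← put12_comm]
  rfl

theorem coactL_eq_toQuo (M : ComodAlg A B) : M.coactL = toQuo M.lam.toAlg :=
  LinearMap.ext fun m => (M.lam_cls m).symm

theorem coactR_eq_toQuo (M : ComodAlg A B) : M.coactR = toQuo M.rho.toAlg :=
  LinearMap.ext fun m => (M.rho_cls m).symm

/-- The expression $\sum\lambda(m)\otimes\rho(n)$ is obtained by applying $\lambda_M\otimes1$ and
then $1\otimes1\otimes\rho_N$. -/
theorem lift_glue4_eq (M : ComodAlg A B) (N : ComodAlg B C) (w) :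
    lift (P := N.last) ((glue4 A.toEnvAlg M.toEnvAlg N.toEnvAlg C.toEnvAlg).compl₁₂
      M.coactL N.coactR) w =
    wl A.toEnvAlg (wl M.toEnvAlg N.rho.fin) (M.lam.ext N.last (cls (M.toEnvAlg ⊠ N.last) w)) := by
  induction w using tm_induction with
  | h0 => simp only [map_zero]
  | h1 m n =>
    rw [lift_tm, LinearMap.compl₁₂_apply, glue4_eq, ← ten_cls, M.lam.ext_ten, wl_wl,
      ← M.lam_cls, ← N.rho_cls]
    refine wl_congr _ (fun v => ?_) _
    rw [LinearMap.comp_apply, wl_jmap]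
  | h2 a b ha hb => simp only [map_add, ha, hb]

theorem actL_ins23of4_eq (A : EnvAlg k R R) {X : EnvAlg k R T} {M : EnvAlg k R S}
    {N : EnvAlg k S T} (ι : TakHom X M N) (C : EnvAlg k T T) (u) :
    actL (inl A (M ⊠ N ⊠ C.last)) (actR (P := C.last) ((inr A (M ⊠ N ⊠ C.last)).comp
        ((inr M (N ⊠ C.last)).comp (inr N C.last))) ((ins23of4 A M N C).comp (toQuo ι.toAlg))) u =
    wl A (ι.ext C.last) (cls (A ⊠ X ⊠ C.last) u) := by
  induction u using tm_induction₃ with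
  | h0 => simp only [map_zero]
  | h1 a x c =>
    rw [actL_tm, actR_tm, ← ten_cls, ← ten_cls, wl_ten, ι.ext_ten, ι.fin_cls, ← smul_map_put12]
    obtain ⟨v, hv⟩ := cls_surjective _ (Quo.map (put12 M N C.last) (put12_mem M N C.last)
      (toQuo ι.toAlg x))
    change inl A (M ⊠ N ⊠ C.last) a • (inr A (M ⊠ N ⊠ C.last) (inr M (N ⊠ C.last)
      (inr N C.last c)) • Quo.map (inr A (M ⊠ N ⊠ C.last)) (inr_mem A _)
        (Quo.map (put12 M N C.last) (put12_mem M N C.last) (toQuo ι.toAlg x))) = _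
    rw [← hv, Quo.map_cls, smul_cls, smul_cls, smul_cls, ten_cls, ← map_mul, inl_apply,
      inr_apply A, tm_mul_tm, mul_one, one_mul]
  | h2 a b ha hb => simp only [map_add, ha, hb]

theorem IsComposite.isBullet {M : ComodAlg A B} {N : ComodAlg B C} {X : EnvAlg k R T}
    {ι : TakHom X M.toEnvAlg N.toEnvAlg} (h : IsComposite M N ι) [A.Flat] [B.Flat] [C.Flat]
    [M.Flat] [N.Flat] [Hereditary R] [Hereditary S] [Hereditary T] :
    IsBullet M N h.comodAlg ι.toAlg where
  map_t := ι.map_t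
  map_s := ι.map_s
  injective a b hab := cls_last_injective X (h.injective (congrArg (val (M.toEnvAlg ⊠ N.last)) hab))
  mem_range q := by
    constructor
    · rintro ⟨x, rfl⟩ w hw
      rw [coactR_eq_toQuo, coactL_eq_toQuo, rext_eq, lext_eq, hw]
      exact h.equalizes (cls X.last x)
    · intro hq
      obtain ⟨w, hw⟩ := cls_surjective _ (val (M.toEnvAlg ⊠ N.last) q)
      have := hq w hw
      rw [coactR_eq_toQuo, coactL_eq_toQuo, rext_eq, lext_eq, hw] at this
      obtain ⟨v, hv⟩ := h.exists_eq _ (isTak_val q).isCentral this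
      obtain ⟨x, rfl⟩ := cls_surjective _ v
      exact ⟨x, val_injective hv⟩
  coact p u w hu hw := by
    refine (actL_ins23of4_eq A.toEnvAlg ι C.toEnvAlg u).trans ?_
    have hu : cls (A.toEnvAlg ⊠ X ⊠ C.last) u = _ := hu.trans (h.coactions.coact_eq p)
    rw [lift_glue4_eq, hw, hu]
    refine Eq.trans ?_ (congrArg (wl A.toEnvAlg (wl M.toEnvAlg N.rho.fin))
      (h.wl_lam (cls X.last p)))
    -- The coaction of the composite is $(1\otimes\rho)\lambda$, and under the inclusion $\rho$
    -- becomes $1\otimes\rho_N$ and $\lambda$ becomes $\lambda_M\otimes1$.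
    rw [wl_wl, wl_wl]
    exact wl_congr _ (fun v => h.ext_rho v) _

end Composite

section Maps

variable {k : Type u} [CommRing k]
variable {R S T : Type v} [Ring R] [Algebra k R] [Ring S] [Algebra k S] [Ring T] [Algebra k T]

/-! ### Constructions of maps -/

/-- The map of algebras over `Rᵒ ⊗ S` given by a multiplicative map. -/
noncomputable def Mult.toEnvHom {X Y : EnvAlg k R S} {φ : Quo X.last →ₗ[R] Quo Y.last}
    (h : Mult φ) (hs : ∀ y, φ (cls X.last (X.s y)) = cls Y.last (Y.s y)) : EnvHom X Y where
  toAlg := AlgHom.ofLinearMap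
    { toFun := fun x => unlast Y (φ (cls X.last x))
      map_add' := fun x y => by rw [map_add, map_add, unlast_add]
      map_smul' := fun c x => cls_last_injective Y ((cls_unlast Y _).trans
        ((congrArg φ (_root_.map_smul (cls X.last) c x)).trans ((φ.map_smul_of_tower c _).trans
          ((congrArg (c • ·) (cls_unlast Y _).symm).trans (_root_.map_smul (cls Y.last) c _).symm)))) }
    (cls_last_injective Y ((cls_unlast Y _).trans h.one))
    (fun x y => cls_last_injective Y ((cls_unlast Y _).trans (by
      rw [h.last_smul x y (cls_unlast Y (φ (cls X.last x))),
        ← cls_unlast Y (φ (cls X.last y))]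
      rfl)))
  map_t x := cls_last_injective Y ((cls_unlast Y _).trans (h.cls_t x))
  map_s y := cls_last_injective Y ((cls_unlast Y _).trans (hs y))

theorem Mult.toEnvHom_fin {X Y : EnvAlg k R S} {φ : Quo X.last →ₗ[R] Quo Y.last}
    (h : Mult φ) (hs : ∀ y, φ (cls X.last (X.s y)) = cls Y.last (Y.s y)) (u) :
    (h.toEnvHom hs).fin u = φ u := by
  obtain ⟨x, rfl⟩ := cls_surjective _ u
  exact cls_unlast Y _

/-- All maps into composites arise in this way: a multiplicative map whose image lies in that of an
injective multiplicative one factors through it multiplicatively. -/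
theorem factor_mult {X Y : EnvAlg k R S} {P : RelAlg k R} [Balanced P]
    {f : Quo X.last →ₗ[R] Quo P} {g : Quo Y.last →ₗ[R] Quo P} (hf : Mult f) (hg : Mult g)
    (hi : Function.Injective g) (h : ∀ u, ∃ v, g v = f u) : Mult (factor f hi h) := by
  refine Mult.of_injective hg hi ?_ (isTak_last X)
  rw [LinearMap.ext (f := g ∘ₗ factor f hi h) (g := f) (factor_spec f hi h)]
  exact hf

/-- The factorization of one multiplicative map through another one. -/
noncomputable def factorHom {X Y : EnvAlg k R S} {P : RelAlg k R} [Balanced P]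
    {f : Quo X.last →ₗ[R] Quo P} {g : Quo Y.last →ₗ[R] Quo P} (hf : Mult f) (hg : Mult g)
    (hi : Function.Injective g) (h : ∀ u, ∃ v, g v = f u)
    (hs : ∀ y, f (cls X.last (X.s y)) = g (cls Y.last (Y.s y))) : EnvHom X Y :=
  (factor_mult hf hg hi h).toEnvHom (fun y => hi ((factor_spec f hi h _).trans (hs y)))

theorem factorHom_spec {X Y : EnvAlg k R S} {P : RelAlg k R} [Balanced P]
    {f : Quo X.last →ₗ[R] Quo P} {g : Quo Y.last →ₗ[R] Quo P} (hf : Mult f) (hg : Mult g)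
    (hi : Function.Injective g) (h : ∀ u, ∃ v, g v = f u)
    (hs : ∀ y, f (cls X.last (X.s y)) = g (cls Y.last (Y.s y))) (u) :
    g ((factorHom hf hg hi h hs).fin u) = f u := by
  rw [factorHom, Mult.toEnvHom_fin, factor_spec]

variable {A : Bialgebroid k R} {B : Bialgebroid k S}

theorem ComodAlgHom.bijective_toAlgHom {M N : ComodAlg A B} (f : ComodAlgHom M N)
    (hf : Function.Bijective f.envHom.fin) : Function.Bijective f.toAlgHom :=
  ⟨fun x y hxy => cls_last_injective M.toEnvAlg (hf.1 (congrArg (cls N.last) hxy)), fun y => by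
    obtain ⟨u, hu⟩ := hf.2 (cls N.last y)
    obtain ⟨x, rfl⟩ := cls_surjective _ u
    exact ⟨x, cls_last_injective N.toEnvAlg hu⟩⟩

/-- The inverse of a bijective map of comodule algebras. -/
noncomputable def ComodAlgHom.inv {M N : ComodAlg A B} (f : ComodAlgHom M N)
    (hf : Function.Bijective f.envHom.fin) : ComodAlgHom N M :=
  let e : M.carrier ≃ₐ[k] N.carrier := AlgEquiv.ofBijective f.toAlgHom (f.bijective_toAlgHom hf)
  let g : EnvHom N.toEnvAlg M.toEnvAlg :=
    { toAlg := e.symm.toAlgHom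
      map_t := fun x => (e.symm_apply_eq).2 (f.envHom.map_t x).symm
      map_s := fun x => (e.symm_apply_eq).2 (f.envHom.map_s x).symm }
  have hgf : ∀ u, g.fin (f.envHom.fin u) = LinearMap.id u := fun u => by
    obtain ⟨x, rfl⟩ := cls_surjective _ u
    exact congrArg (cls M.last) (e.symm_apply_apply x)
  g.comodAlgHom
    (fun u => by
      obtain ⟨u, rfl⟩ := hf.2 u
      rw [hgf, ← f.lam_fin, wl_wl]
      exact (wl_congr _ hgf _).trans (wl_id _ _))
    (fun u => by
      obtain ⟨u, rfl⟩ := hf.2 u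
      rw [hgf, ← f.rho_fin]
      generalize M.rho.fin u = v
      induction v using quo_induction with
      | h1 q u => rw [f.envHom.ext_jmap, g.ext_jmap, hgf]; rfl
      | h2 a b ha hb => simp only [map_add, ha, hb])

theorem ComodAlgHom.inv_fin {M N : ComodAlg A B} (f : ComodAlgHom M N)
    (hf : Function.Bijective f.envHom.fin) (u) : (f.inv hf).envHom.fin (f.envHom.fin u) = u := by
  obtain ⟨x, rfl⟩ := cls_surjective _ u
  exact congrArg (cls M.last) 
    (AlgEquiv.symm_apply_apply (AlgEquiv.ofBijective f.toAlgHom (f.bijective_toAlgHom hf)) x)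

/-- The regular comodule algebra. -/
@[reducible] def Bialgebroid.regularCoactions (A : Bialgebroid k R) : Coactions A A A.toEnvAlg where
  lam := A.com
  rho := A.com
  lam_lam := A.com_coassoc
  rho_rho := A.com_coassoc
  lam_rho := A.com_coassoc
  eps_lam := A.eps_com
  epsR_rho := A.epsR_com

end Maps

/-! ### The bicategory -/

section Cells

variable {k : Type u} [CommRing k]

instance (a : Obj.{u, v} k) : Hereditary a.base := ⟨a.hereditary⟩

instance (a : Obj.{u, v} k) : a.bialgebroid.Flat := a.union.flat

variable {a b c d : Obj.{u, v} k}

instance (M : Cell a b) : M.Flat := M.union.flat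

/-- The map of algebras over `Rᵒ ⊗ S` underlying a 2-cell. -/
def env {M N : Cell a b} (f : M ⟶ N) : EnvHom M.toEnvAlg N.toEnvAlg := ComodAlgHom.envHom f

theorem env_comp_fin {M N L : Cell a b} (f : M ⟶ N) (g : N ⟶ L) (u) :
    (env (f ≫ g)).fin u = (env g).fin ((env f).fin u) := by
  obtain ⟨x, rfl⟩ := cls_surjective _ u
  rfl

theorem env_id_fin (M : Cell a b) (u) : (env (𝟙 M)).fin u = u := by
  obtain ⟨x, rfl⟩ := cls_surjective _ u
  rfl

theorem cell_hom_ext {M N : Cell a b} {f g : M ⟶ N} (h : ∀ u, (env f).fin u = (env g).fin u) :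
    f = g :=
  ComodAlgHom.ext_fin (f := f) (g := g) h

theorem env_lam {M N : Cell a b} (f : M ⟶ N) (u) :
    wl a.bialgebroid.toEnvAlg (env f).fin (M.lam.fin u) = N.lam.fin ((env f).fin u) :=
  ComodAlgHom.lam_fin f u

theorem env_rho {M N : Cell a b} (f : M ⟶ N) (u) :
    (env f).ext b.bialgebroid.last (M.rho.fin u) = N.rho.fin ((env f).fin u) :=
  ComodAlgHom.rho_fin f u

/-- The 2-cell given by a map that respects the coactions. -/
def mkHom {M N : Cell a b} (f : EnvHom M.toEnvAlg N.toEnvAlg)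
    (hl : ∀ u, wl a.bialgebroid.toEnvAlg f.fin (M.lam.fin u) = N.lam.fin (f.fin u))
    (hr : ∀ u, f.ext b.bialgebroid.last (M.rho.fin u) = N.rho.fin (f.fin u)) : M ⟶ N :=
  f.comodAlgHom hl hr

/-- The isomorphism given by a bijective 2-cell. -/
noncomputable def mkIso {M N : Cell a b} (f : M ⟶ N) (hf : Function.Bijective (env f).fin) :
    M ≅ N where
  hom := f
  inv := ComodAlgHom.inv f hf
  hom_inv_id := cell_hom_ext fun u => by
    rw [env_comp_fin, env_id_fin]
    exact ComodAlgHom.inv_fin f hf u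
  inv_hom_id := cell_hom_ext fun u => by
    obtain ⟨u, rfl⟩ := hf.2 u
    rw [env_comp_fin, env_id_fin]
    exact congrArg _ (ComodAlgHom.inv_fin f hf u)

/-- The composite of two 1-cells, with its inclusion in the Takeuchi product. -/
structure Composite (M : Cell a b) (N : Cell b c) where
  cell : Cell a c
  ι : TakHom cell.toEnvAlg M.toEnvAlg N.toEnvAlg
  isComposite : IsComposite M.toComodAlg N.toComodAlg ι
  wl_lam : ∀ u, wl a.bialgebroid.toEnvAlg ι.fin (cell.lam.fin u) = M.lam.ext N.last (ι.fin u)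
  ext_rho : ∀ u, ι.ext c.bialgebroid.last (cell.rho.fin u) = wl M.toEnvAlg N.rho.fin (ι.fin u)
  isBullet : IsBullet M.toComodAlg N.toComodAlg cell.toComodAlg ι.toAlg

/-- The composite of two 1-cells. -/
noncomputable def composite (M : Cell a b) (N : Cell b c) : Composite M N :=
  let h := isComposite_bulletHom M.toComodAlg N.toComodAlg
  { cell :=
      { toComodAlg := h.comodAlg
        union := h.flat.unionOfProjectives }
    ι := bulletHom M.toComodAlg N.toComodAlg
    isComposite := h
    wl_lam := h.wl_comodAlg_lam
    ext_rho := h.ext_comodAlg_rho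
    isBullet := h.isBullet }

attribute [irreducible] composite

/-- The composite of two 1-cells. -/
noncomputable def bul (M : Cell a b) (N : Cell b c) : Cell a c := (composite M N).cell

/-- The inclusion of the composite in the Takeuchi product. -/
noncomputable def inc (M : Cell a b) (N : Cell b c) :
    TakHom (bul M N).toEnvAlg M.toEnvAlg N.toEnvAlg := (composite M N).ι

theorem isComposite_inc (M : Cell a b) (N : Cell b c) :
    IsComposite M.toComodAlg N.toComodAlg (inc M N) := (composite M N).isComposite

theorem inc_injective (M : Cell a b) (N : Cell b c) : Function.Injective (inc M N).fin :=
  (isComposite_inc M N).injective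

theorem inc_equalizes (M : Cell a b) (N : Cell b c) (u) :
    M.rho.ext N.last ((inc M N).fin u) = wl M.toEnvAlg N.lam.fin ((inc M N).fin u) :=
  (isComposite_inc M N).equalizes u

theorem inc_lam (M : Cell a b) (N : Cell b c) (u) :
    wl a.bialgebroid.toEnvAlg (inc M N).fin ((bul M N).lam.fin u) =
      M.lam.ext N.last ((inc M N).fin u) := (composite M N).wl_lam u

theorem inc_rho (M : Cell a b) (N : Cell b c) (u) :
    (inc M N).ext c.bialgebroid.last ((bul M N).rho.fin u) =
      wl M.toEnvAlg N.rho.fin ((inc M N).fin u) := (composite M N).ext_rho u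

theorem inc_s (M : Cell a b) (N : Cell b c) (y : c.base) :
    (inc M N).fin (cls (bul M N).last ((bul M N).s y)) = ten 1 (cls N.last (N.s y)) :=
  ((inc M N).map_s y).trans (ten_cls (P := N.last) 1 _).symm

/-! ### Horizontal composition -/

section Horizontal

variable {M M' : Cell a b} {N N' : Cell b c} (f : M ⟶ M') (g : N ⟶ N')

/-- The map $f\otimes g$ is multiplicative, so it preserves Takeuchi's condition. It preserves the
equalizer condition because `f` respects the right coactions and `g` the left ones. -/
theorem exists_hcomp (u) : ∃ v, (inc M' N').fin v =
    (env f).ext N'.last (wl M.toEnvAlg (env g).fin ((inc M N).fin u)) := by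
  refine (isComposite_inc M' N').exists_eq _
    (((env f).ext_mult _).isTak (((env g).fin_mult.wl _).isTak ((inc M N).isTak u))).isCentral ?_
  rw [← EnvHom.ext_ext_of_fin (env_rho f), M.rho.ext_wl, inc_equalizes, ← (env f).ext_wl, wl_wl,
    wl_wl]
  congr 1
  refine wl_congr _ (fun v => ?_) _
  rw [LinearMap.comp_apply, LinearMap.comp_apply, env_lam]

/-- The horizontal composite of two 2-cells, as a map of algebras over `Rᵒ ⊗ T`. -/
noncomputable def hcompEnv : EnvHom (bul M N).toEnvAlg (bul M' N').toEnvAlg :=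
  factorHom (((env f).ext_mult N'.last).comp
      (((env g).fin_mult.wl M.toEnvAlg).comp (inc M N).fin_mult))
    (inc M' N').fin_mult (inc_injective M' N') (exists_hcomp f g) (fun y => by
      simp only [LinearMap.comp_apply]
      rw [inc_s, inc_s, wl_ten, (env f).ext_ten, map_one, (env g).fin_cls, (env g).map_s])

theorem inc_hcompEnv (u) : (inc M' N').fin ((hcompEnv f g).fin u) =
    (env f).ext N'.last (wl M.toEnvAlg (env g).fin ((inc M N).fin u)) :=
  factorHom_spec _ _ _ _ _ u

theorem inc_ext_hcompEnv {P : RelAlg k c.base} [Balanced P] (u) :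
    (inc M' N').ext P ((hcompEnv f g).ext P u) =
      (env f).ext (N'.toEnvAlg ⊠ P) (wl M.toEnvAlg ((env g).ext P) ((inc M N).ext P u)) := by
  induction u using quo_induction with
  | h1 q v =>
    have h : wl M.toEnvAlg ((env g).ext P) (wl M.toEnvAlg (jmap N.toEnvAlg q) ((inc M N).fin v)) =
        wl M.toEnvAlg (jmap N'.toEnvAlg q) (wl M.toEnvAlg (env g).fin ((inc M N).fin v)) := by
      rw [wl_wl, wl_wl]
      exact wl_congr _ (fun v => (env g).ext_jmap v q) _
    rw [(hcompEnv f g).ext_jmap, (inc M' N').ext_jmap, inc_hcompEnv, (inc M N).ext_jmap, h]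
    exact ((env f).ext_wl (jmap N'.toEnvAlg q) _).symm
  | h2 a b ha hb => simp only [map_add, ha, hb]

/-- The horizontal composite of two 2-cells. -/
noncomputable def hcomp : bul M N ⟶ bul M' N' :=
  mkHom (hcompEnv f g)
    (fun u => by
      apply wl_injective _ (inc_injective M' N')
      rw [inc_lam, inc_hcompEnv, ← EnvHom.wl_ext_of_fin (env_lam f), M.lam.ext_wl, ← inc_lam,
        wl_wl, wl_wl, wl_wl]
      refine wl_congr _ (fun v => ?_) _
      simp only [LinearMap.comp_apply]
      exact inc_hcompEnv f g v)
    (fun u => by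
      apply (inc M' N').ext_injective (inc_injective M' N')
      rw [inc_rho, inc_hcompEnv, inc_ext_hcompEnv, inc_rho, ← (env f).ext_wl, wl_wl, wl_wl]
      congr 1
      refine wl_congr _ (fun v => ?_) _
      rw [LinearMap.comp_apply, LinearMap.comp_apply, env_rho])

end Horizontal

end Cells

/-! ### Reflection of Takeuchi's condition along injections -/

section Reflect

variable {k : Type u} [CommRing k] {R S : Type v} [Ring R] [Algebra k R] [Ring S] [Algebra k S]

/-- An injective multiplicative map reflects Takeuchi's condition. -/
theorem Mult.isTak_of_injective {P P' : RelAlg k R} [Balanced P] [Balanced P']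
    {φ : Quo P →ₗ[R] Quo P'} (h : Mult φ) (hi : Function.Injective φ) {u : Quo P}
    (hu : IsTak P' (φ u)) : IsTak P u := by
  intro b hb
  obtain ⟨p, hp, hpu⟩ := h.exists_lift b
  apply hi
  rw [hpu, map_zero]
  apply hu.smul_eq_zero
  rw [hp, cls_eq_zero.2 (Ideal.subset_span hb), map_zero]

theorem EnvHom.ext_id {X : EnvAlg k R S} {f : EnvHom X X} (h : ∀ u, f.fin u = u)
    {P : RelAlg k S} [Balanced P] (u) : f.ext P u = u := by
  induction u using quo_induction with
  | h1 q v => rw [f.ext_jmap, h]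
  | h2 a b ha hb => rw [map_add, ha, hb]

end Reflect

section Cells

variable {k : Type u} [CommRing k] {a b c d : Obj.{u, v} k}

/-! ### Whiskering -/

section Whiskering

variable (M : Cell a b) {N N' : Cell b c} (g : N ⟶ N')

/-- Whiskering on the left. -/
noncomputable def wL : bul M N ⟶ bul M N' := hcomp (𝟙 M) g

theorem inc_wL (u) : (inc M N').fin ((env (wL M g)).fin u) =
    wl M.toEnvAlg (env g).fin ((inc M N).fin u) :=
  (inc_hcompEnv (𝟙 M) g u).trans (EnvHom.ext_id (env_id_fin M) _)

theorem inc_ext_wL {P : RelAlg k c.base} [Balanced P] (u) :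
    (inc M N').ext P ((env (wL M g)).ext P u) =
      wl M.toEnvAlg ((env g).ext P) ((inc M N).ext P u) :=
  (inc_ext_hcompEnv (𝟙 M) g u).trans (EnvHom.ext_id (env_id_fin M) _)

variable {M} {M' : Cell a b} (f : M ⟶ M') (N)

/-- Whiskering on the right. -/
noncomputable def wR : bul M N ⟶ bul M' N := hcomp f (𝟙 N)

theorem inc_wR (u) : (inc M' N).fin ((env (wR N f)).fin u) =
    (env f).ext N.last ((inc M N).fin u) :=
  (inc_hcompEnv f (𝟙 N) u).trans (congrArg _
    ((wl_congr M.toEnvAlg (ψ := LinearMap.id) (env_id_fin N) _).trans (wl_id _ _)))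

theorem inc_ext_wR {P : RelAlg k c.base} [Balanced P] (u) :
    (inc M' N).ext P ((env (wR N f)).ext P u) =
      (env f).ext (N.toEnvAlg ⊠ P) ((inc M N).ext P u) :=
  (inc_ext_hcompEnv f (𝟙 N) u).trans (congrArg _
    ((wl_congr M.toEnvAlg (ψ := LinearMap.id)
      (fun _ => EnvHom.ext_id (env_id_fin N) _) _).trans (wl_id _ _)))

end Whiskering

/-! ### Associativity -/

section Associator

variable (M : Cell a b) (N : Cell b c) (L : Cell c d)

/-- The inclusion of `(M • N) • L` in `M ⊗ N ⊗ L`. -/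
noncomputable def incL : Quo (bul (bul M N) L).last →ₗ[a.base]
    Quo (M.toEnvAlg ⊠ N.toEnvAlg ⊠ L.last) :=
  (inc M N).ext L.last ∘ₗ (inc (bul M N) L).fin

/-- The inclusion of `M • (N • L)` in `M ⊗ N ⊗ L`. -/
noncomputable def incR : Quo (bul M (bul N L)).last →ₗ[a.base]
    Quo (M.toEnvAlg ⊠ N.toEnvAlg ⊠ L.last) :=
  wl M.toEnvAlg (inc N L).fin ∘ₗ (inc M (bul N L)).fin

theorem incL_apply (u) : incL M N L u = (inc M N).ext L.last ((inc (bul M N) L).fin u) := rfl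

theorem incR_apply (u) :
    incR M N L u = wl M.toEnvAlg (inc N L).fin ((inc M (bul N L)).fin u) := rfl

theorem incL_mult : Mult (incL M N L) :=
  ((inc M N).ext_mult L.last).comp (inc (bul M N) L).fin_mult

theorem incR_mult : Mult (incR M N L) :=
  ((inc N L).fin_mult.wl M.toEnvAlg).comp (inc M (bul N L)).fin_mult

theorem incL_injective : Function.Injective (incL M N L) :=
  ((inc M N).ext_injective (inc_injective M N) L.last).comp (inc_injective _ L)

theorem incR_injective : Function.Injective (incR M N L) :=
  (wl_injective M.toEnvAlg (inc_injective N L)).comp (inc_injective M _)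

/-- The conditions that single out the triple composite in `M ⊗ N ⊗ L`. -/
structure IsTriple (w : Quo (M.toEnvAlg ⊠ N.toEnvAlg ⊠ L.last)) : Prop where
  isTak : IsTak _ w
  left : M.rho.ext (N.toEnvAlg ⊠ L.last) w = wl M.toEnvAlg (N.lam.ext L.last) w
  right : wl M.toEnvAlg (N.rho.ext L.last) w = wl M.toEnvAlg (wl N.toEnvAlg L.lam.fin) w

/-- The condition `left` is the one defining $M\bullet N$, tensored with $L$. The condition `right`
is the one defining $(M\bullet N)\bullet L$, as the right coaction of $M\bullet N$ is induced by
$1\otimes\rho_N$. -/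
theorem isTriple_incL (u) : IsTriple M N L (incL M N L u) where
  isTak := (incL_mult M N L).isTak (isTak_last _ u)
  left := (TakHom.assoc_ext (f := inc M N) (g := N.lam) (f' := inc M N) (g' := M.rho)
    (fun v => (inc_equalizes M N v).symm) _).symm
  right := by
    rw [incL_apply, ← (inc M N).ext_wl, ← inc_equalizes]
    exact TakHom.assoc_ext (f := inc M N) (g := N.rho) (f' := (bul M N).rho) (g' := inc M N)
      (fun v => (inc_rho M N v).symm) _

theorem isTriple_incR (u) : IsTriple M N L (incR M N L u) where
  isTak := (incR_mult M N L).isTak (isTak_last _ u)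
  left := by
    rw [incR_apply, M.rho.ext_wl, inc_equalizes, wl_wl, wl_wl]
    refine wl_congr _ (fun v => ?_) _
    rw [LinearMap.comp_apply, inc_lam, LinearMap.comp_apply]
  right := by
    rw [incR_apply, wl_wl, wl_wl]
    exact wl_congr _ (inc_equalizes N L) _

variable {M N L}

/-- First `left` and Takeuchi's condition place `w` in $(M\bullet N)\otimes L$, since tensoring with
$L$ preserves the composite. The remaining conditions are then reflected along the injection
$(M\bullet N)\otimes L\to M\otimes N\otimes L$. -/
theorem IsTriple.exists_incL {w} (hw : IsTriple M N L w) : ∃ u, incL M N L u = w := by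
  obtain ⟨v, rfl⟩ := TakHom.exists_ext_eq M.rho N.lam (isComposite_inc M N).exists_eq
    hw.isTak.isCentral hw.left
  obtain ⟨u, rfl⟩ := (isComposite_inc (bul M N) L).exists_eq v
    (((inc M N).ext_mult L.last).isTak_of_injective
      ((inc M N).ext_injective (inc_injective M N) L.last) hw.isTak).isCentral (by
    -- The equalizer condition for $(M\bullet N)\bullet L$ is tested in $M\otimes N\otimes C\otimes
    -- L$, with $C$ the bialgebroid of `c`, where it becomes `right`.
    apply (inc M N).ext_injective (inc_injective M N)
    rw [(inc M N).ext_wl]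
    refine Eq.trans ?_ hw.right
    exact (TakHom.assoc_ext (f := inc M N) (g := N.rho) (f' := (bul M N).rho) (g' := inc M N)
      (fun v => (inc_rho M N v).symm) _).symm)
  exact ⟨u, rfl⟩

/-- The mirror image: `right` places `w` in $M\otimes(N\bullet L)$, and `left` is the remaining
equalizer condition, tested in $M\otimes B\otimes N\otimes L$. -/
theorem IsTriple.exists_incR {w} (hw : IsTriple M N L w) : ∃ u, incR M N L u = w := by
  obtain ⟨v, rfl⟩ := TakHom.exists_wl_eq N.rho L.lam (isComposite_inc N L).exists_eq M.toEnvAlg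
    (wl_centralMap_of_isTak M.toEnvAlg hw.isTak) hw.right
  obtain ⟨u, rfl⟩ := (isComposite_inc M (bul N L)).exists_eq v
    (((inc N L).fin_mult.wl M.toEnvAlg).isTak_of_injective
      (wl_injective M.toEnvAlg (inc_injective N L)) hw.isTak).isCentral (by
    apply wl_injective M.toEnvAlg (wl_injective b.bialgebroid.toEnvAlg (inc_injective N L))
    refine (M.rho.ext_wl _ _).symm.trans (hw.left.trans ?_)
    rw [wl_wl, wl_wl]
    refine wl_congr _ (fun v => ?_) _
    rw [LinearMap.comp_apply, LinearMap.comp_apply, inc_lam])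
  exact ⟨u, rfl⟩

variable (M N L)

/-- The associativity map, as a map of algebras over `Rᵒ ⊗ T`. -/
noncomputable def assocEnv : EnvHom (bul (bul M N) L).toEnvAlg (bul M (bul N L)).toEnvAlg :=
  factorHom (incL_mult M N L) (incR_mult M N L) (incR_injective M N L)
    (fun u => (isTriple_incL M N L u).exists_incR) (fun y => by
      rw [incL_apply, incR_apply, inc_s, inc_s, wl_ten, inc_s, (inc M N).ext_ten]
      refine (congrArg _ ((inc M N).fin_mult.one.trans (ten_cls (P := N.last) 1 1).symm)).trans ?_
      rw [wl_ten, jmap_cls])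

theorem incR_assocEnv (u) : incR M N L ((assocEnv M N L).fin u) = incL M N L u :=
  factorHom_spec _ _ _ _ _ u

theorem incR_ext_assocEnv {P : RelAlg k d.base} [Balanced P] (u) :
    wl M.toEnvAlg ((inc N L).ext P) ((inc M (bul N L)).ext P ((assocEnv M N L).ext P u)) =
      (inc M N).ext (L.toEnvAlg ⊠ P) ((inc (bul M N) L).ext P u) := by
  induction u using quo_induction with
  | h1 q v =>
    rw [(assocEnv M N L).ext_jmap, TakHom.wl_ext_jmap, TakHom.ext_ext_jmap]
    exact congrArg _ (incR_assocEnv M N L v)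
  | h2 a b ha hb => simp only [map_add, ha, hb]

/-- The associativity map. -/
noncomputable def assocHom : bul (bul M N) L ⟶ bul M (bul N L) :=
  mkHom (assocEnv M N L)
    (fun u => by
      -- Compatibility with the left coactions is checked in $A\otimes M\otimes N\otimes L$, where
      -- both sides are induced by $\lambda_M$; the right coactions are treated in the same way with
      -- $\rho_L$.
      apply wl_injective _ (incR_injective M N L)
      rw [wl_wl]
      refine (wl_congr _ (incR_assocEnv M N L) _).trans ?_
      rw [incL, incR, ← wl_wl, ← wl_wl, inc_lam, inc_lam, ← M.lam.ext_wl, ← incR_apply,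
        incR_assocEnv]
      exact TakHom.assoc_ext (f := (bul M N).lam) (g := inc M N) (f' := inc M N) (g' := M.lam)
        (inc_lam M N) _)
    (fun u => by
      apply (inc M (bul N L)).ext_injective (inc_injective M (bul N L))
      apply wl_injective M.toEnvAlg
        ((inc N L).ext_injective (inc_injective N L) d.bialgebroid.last)
      rw [incR_ext_assocEnv, inc_rho, inc_rho, (inc M N).ext_wl, ← incL_apply, ← incR_assocEnv,
        incR_apply, wl_wl, wl_wl]
      refine wl_congr _ (fun v => ?_) _
      rw [LinearMap.comp_apply, LinearMap.comp_apply, inc_rho])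

theorem incR_assocHom (u) : incR M N L ((env (assocHom M N L)).fin u) = incL M N L u :=
  incR_assocEnv M N L u

theorem incR_ext_assocHom {P : RelAlg k d.base} [Balanced P] (u) :
    wl M.toEnvAlg ((inc N L).ext P)
        ((inc M (bul N L)).ext P ((env (assocHom M N L)).ext P u)) =
      (inc M N).ext (L.toEnvAlg ⊠ P) ((inc (bul M N) L).ext P u) :=
  incR_ext_assocEnv M N L u

theorem assocHom_bijective : Function.Bijective (env (assocHom M N L)).fin := by
  refine ⟨fun u v h => incL_injective M N L ?_, fun v => ?_⟩
  · rw [← incR_assocHom, h, incR_assocHom]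
  · obtain ⟨u, hu⟩ := (isTriple_incR M N L v).exists_incL
    exact ⟨u, incR_injective M N L ((incR_assocHom M N L u).trans hu)⟩

/-- The associativity isomorphism. -/
noncomputable def assoc : bul (bul M N) L ≅ bul M (bul N L) :=
  mkIso (assocHom M N L) (assocHom_bijective M N L)

end Associator

end Cells

section Cells

variable {k : Type u} [CommRing k] {a b c d e : Obj.{u, v} k}

/-! ### Units -/

section Lift

variable {M : Cell a b} {N : Cell b c} {X : Cell a c}
  (F : TakHom X.toEnvAlg M.toEnvAlg N.toEnvAlg)
  (h : ∀ u, M.rho.ext N.last (F.fin u) = wl M.toEnvAlg N.lam.fin (F.fin u))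

/-- The map to the composite given by a map to the Takeuchi product. -/
noncomputable def liftEnv : EnvHom X.toEnvAlg (bul M N).toEnvAlg :=
  factorHom F.fin_mult (inc M N).fin_mult (inc_injective M N)
    (fun u => (isComposite_inc M N).exists_eq _ (F.isTak u).isCentral (h u))
    (fun y => (F.map_s y).trans ((inc M N).map_s y).symm)

theorem inc_liftEnv (u) : (inc M N).fin ((liftEnv F h).fin u) = F.fin u :=
  factorHom_spec _ _ _ _ _ u

theorem inc_ext_liftEnv {P : RelAlg k c.base} [Balanced P] (u) :
    (inc M N).ext P ((liftEnv F h).ext P u) = F.ext P u := by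
  induction u using quo_induction with
  | h1 q v => rw [(liftEnv F h).ext_jmap, (inc M N).ext_jmap, F.ext_jmap, inc_liftEnv]
  | h2 a b ha hb => simp only [map_add, ha, hb]

/-- The 2-cell to the composite given by a map to the Takeuchi product that respects the
coactions. -/
noncomputable def liftHom
    (hl : ∀ u, wl a.bialgebroid.toEnvAlg F.fin (X.lam.fin u) = M.lam.ext N.last (F.fin u))
    (hr : ∀ u, F.ext c.bialgebroid.last (X.rho.fin u) = wl M.toEnvAlg N.rho.fin (F.fin u)) :
    X ⟶ bul M N :=
  mkHom (liftEnv F h)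
    (fun u => by
      apply wl_injective _ (inc_injective M N)
      rw [inc_lam, inc_liftEnv, ← hl, wl_wl]
      exact wl_congr _ (inc_liftEnv F h) _)
    (fun u => by
      apply (inc M N).ext_injective (inc_injective M N)
      rw [inc_rho, inc_liftEnv, inc_ext_liftEnv, hr])

variable (hl : ∀ u, wl a.bialgebroid.toEnvAlg F.fin (X.lam.fin u) = M.lam.ext N.last (F.fin u))
  (hr : ∀ u, F.ext c.bialgebroid.last (X.rho.fin u) = wl M.toEnvAlg N.rho.fin (F.fin u))

theorem inc_liftHom (u) : (inc M N).fin ((env (liftHom F h hl hr)).fin u) = F.fin u :=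
  inc_liftEnv F h u

theorem inc_ext_liftHom {P : RelAlg k c.base} [Balanced P] (u) :
    (inc M N).ext P ((env (liftHom F h hl hr)).ext P u) = F.ext P u :=
  inc_ext_liftEnv F h u

end Lift

/-- The identity 1-cell. -/
noncomputable abbrev regular (a : Obj.{u, v} k) : Cell a a where
  toComodAlg := a.bialgebroid.regularCoactions.comodAlg
  union := a.union

theorem regular_lam (u) : (regular a).lam.fin u = a.bialgebroid.com.fin u :=
  a.bialgebroid.regularCoactions.lam_fin u

theorem regular_rho (u) : (regular a).rho.fin u = a.bialgebroid.com.fin u :=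
  a.bialgebroid.regularCoactions.rho_fin u

variable (M : Cell a b)

theorem regular_rho_ext {P : RelAlg k a.base} [Balanced P] (u) :
    (regular a).rho.ext P u = a.bialgebroid.com.ext P u :=
  TakHom.ext_eq regular_rho u

theorem regular_lam_ext {P : RelAlg k a.base} [Balanced P] (u) :
    (regular a).lam.ext P u = a.bialgebroid.com.ext P u :=
  TakHom.ext_eq regular_lam u

/-- The left coaction, as a map to the Takeuchi product with the identity 1-cell. -/
noncomputable def lamRegular : TakHom M.toEnvAlg (regular a).toEnvAlg M.toEnvAlg := M.lam

/-- The right coaction, as a map to the Takeuchi product with the identity 1-cell. -/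
noncomputable def rhoRegular : TakHom M.toEnvAlg M.toEnvAlg (regular b).toEnvAlg := M.rho

theorem lamRegular_equalizes (u) : (regular a).rho.ext M.last ((lamRegular M).fin u) =
    wl (regular a).toEnvAlg M.lam.fin ((lamRegular M).fin u) :=
  (regular_rho_ext _).trans (M.lam_lam u).symm

theorem wl_lamRegular (u) : wl a.bialgebroid.toEnvAlg (lamRegular M).fin (M.lam.fin u) =
    (regular a).lam.ext M.last ((lamRegular M).fin u) :=
  (M.lam_lam u).trans (regular_lam_ext _).symm

theorem lamRegular_ext (u) : (lamRegular M).ext b.bialgebroid.last (M.rho.fin u) =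
    wl (regular a).toEnvAlg M.rho.fin ((lamRegular M).fin u) :=
  (M.lam_rho u).symm

theorem rhoRegular_equalizes (u) : M.rho.ext (regular b).last ((rhoRegular M).fin u) =
    wl M.toEnvAlg (regular b).lam.fin ((rhoRegular M).fin u) :=
  (M.rho_rho u).symm.trans (wl_congr _ (fun v => (regular_lam v).symm) _)

theorem wl_rhoRegular (u) : wl a.bialgebroid.toEnvAlg (rhoRegular M).fin (M.lam.fin u) =
    M.lam.ext (regular b).last ((rhoRegular M).fin u) :=
  M.lam_rho u

theorem rhoRegular_ext (u) : (rhoRegular M).ext b.bialgebroid.last (M.rho.fin u) =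
    wl M.toEnvAlg (regular b).rho.fin ((rhoRegular M).fin u) :=
  (M.rho_rho u).symm.trans (wl_congr _ (fun v => (regular_rho v).symm) _)

/-- The map `M → A • M` given by the left coaction. -/
noncomputable def unitL : M ⟶ bul (regular a) M :=
  liftHom (lamRegular M) (lamRegular_equalizes M) (wl_lamRegular M) (lamRegular_ext M)

theorem inc_unitL (u) :
    (inc (regular a) M).fin ((env (unitL M)).fin u) = (lamRegular M).fin u :=
  inc_liftHom (lamRegular M) (lamRegular_equalizes M) (wl_lamRegular M) (lamRegular_ext M) u

/-- The map `M → M • B` given by the right coaction. -/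
noncomputable def unitR : M ⟶ bul M (regular b) :=
  liftHom (rhoRegular M) (rhoRegular_equalizes M) (wl_rhoRegular M) (rhoRegular_ext M)

theorem inc_unitR (u) :
    (inc M (regular b)).fin ((env (unitR M)).fin u) = (rhoRegular M).fin u :=
  inc_liftHom (rhoRegular M) (rhoRegular_equalizes M) (wl_rhoRegular M) (rhoRegular_ext M) u

theorem inc_ext_unitR {P : RelAlg k b.base} [Balanced P] (u) :
    (inc M (regular b)).ext P ((env (unitR M)).ext P u) = (rhoRegular M).ext P u :=
  inc_ext_liftHom (rhoRegular M) (rhoRegular_equalizes M) (wl_rhoRegular M) (rhoRegular_ext M) u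

theorem eps_lamRegular (u) : a.bialgebroid.eps M.last ((lamRegular M).fin u) = u := M.eps_lam u

theorem epsR_rhoRegular (u) : b.bialgebroid.epsR M.toEnvAlg ((rhoRegular M).fin u) = u :=
  M.epsR_rho u

/-- On $A\bullet M$ one has $(1\otimes\lambda)v=(\Delta\otimes1)v$. Applying $\varepsilon$ to the
first factor turns the left side into $\lambda(\varepsilon(v))$ and the right side into $v$. -/
theorem lamRegular_eps (v) :
    (lamRegular M).fin (a.bialgebroid.eps M.last ((inc (regular a) M).fin v)) =
      (inc (regular a) M).fin v := by
  refine (a.bialgebroid.eps_wl M.lam.fin _).symm.trans ?_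
  refine (congrArg _ ((inc_equalizes (regular a) M v).symm.trans (regular_rho_ext _))).trans ?_
  exact a.bialgebroid.eps_com_ext _

/-- On $M\bullet B$ one has $(\rho\otimes1)v=(1\otimes\Delta)v$; apply $\varepsilon$ to the last
factor. -/
theorem rhoRegular_epsR (v) :
    (rhoRegular M).fin (b.bialgebroid.epsR M.toEnvAlg ((inc M (regular b)).fin v)) =
      (inc M (regular b)).fin v := by
  refine (M.rho.fin_epsR b.bialgebroid _).trans ?_
  refine (congrArg _ (inc_equalizes M (regular b) v)).trans ((wl_wl _ _ _ _).trans ?_)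
  refine (wl_congr _ (ψ := LinearMap.id) (fun u => ?_) _).trans (wl_id _ _)
  exact (congrArg _ (regular_lam u)).trans (b.bialgebroid.epsR_com u)

theorem unitL_bijective : Function.Bijective (env (unitL M)).fin := by
  refine ⟨fun u v h => ?_, fun v => ⟨_, inc_injective _ _ ((inc_unitL M _).trans
    (lamRegular_eps M v))⟩⟩
  rw [← eps_lamRegular M u, ← inc_unitL, h, inc_unitL, eps_lamRegular]

theorem unitR_bijective : Function.Bijective (env (unitR M)).fin := by
  refine ⟨fun u v h => ?_, fun v => ⟨_, inc_injective _ _ ((inc_unitR M _).trans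
    (rhoRegular_epsR M v))⟩⟩
  rw [← epsR_rhoRegular M u, ← inc_unitR, h, inc_unitR, epsR_rhoRegular]

/-- The left unit isomorphism. -/
noncomputable def unitLIso : M ≅ bul (regular a) M := mkIso (unitL M) (unitL_bijective M)

/-- The right unit isomorphism. -/
noncomputable def unitRIso : M ≅ bul M (regular b) := mkIso (unitR M) (unitR_bijective M)

/-! ### Naturality and coherence -/

section Naturality

variable {M} (M' : Cell a b) {N N' : Cell b c} {L L' : Cell c d}

theorem wL_id (M : Cell a b) (N : Cell b c) : wL M (𝟙 N) = 𝟙 (bul M N) :=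
  cell_hom_ext fun u => inc_injective _ _ (by
    rw [inc_wL, env_id_fin]
    exact (wl_congr _ (ψ := LinearMap.id) (env_id_fin N) _).trans (wl_id _ _))

theorem wR_id (M : Cell a b) (N : Cell b c) : wR N (𝟙 M) = 𝟙 (bul M N) :=
  cell_hom_ext fun u => inc_injective _ _ (by
    rw [inc_wR, env_id_fin]
    exact EnvHom.ext_id (env_id_fin M) _)

theorem wL_comp (M : Cell a b) {N₁ N₂ N₃ : Cell b c} (f : N₁ ⟶ N₂) (g : N₂ ⟶ N₃) :
    wL M (f ≫ g) = wL M f ≫ wL M g :=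
  cell_hom_ext fun u => inc_injective _ _ (by
    rw [env_comp_fin, inc_wL, inc_wL, inc_wL, wl_wl]
    exact wl_congr _ (env_comp_fin f g) _)

theorem wR_comp {M₁ M₂ M₃ : Cell a b} (f : M₁ ⟶ M₂) (g : M₂ ⟶ M₃) (N : Cell b c) :
    wR N (f ≫ g) = wR N f ≫ wR N g :=
  cell_hom_ext fun u => inc_injective _ _ (by
    rw [env_comp_fin, inc_wR, inc_wR, inc_wR]
    exact (EnvHom.ext_comp (fun u => (env_comp_fin f g u).symm) _).symm)

theorem wL_wR {M M' : Cell a b} (f : M ⟶ M') (g : N ⟶ N') :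
    wL M g ≫ wR N' f = wR N f ≫ wL M' g :=
  cell_hom_ext fun u => inc_injective _ _ (by
    rw [env_comp_fin, env_comp_fin, inc_wR, inc_wL, inc_wL, inc_wR]
    exact (env f).ext_wl _ _)

theorem unitL_naturality {M M' : Cell a b} (f : M ⟶ M') :
    unitL M ≫ wL (regular a) f = f ≫ unitL M' :=
  cell_hom_ext fun u => inc_injective _ _ (by
    rw [env_comp_fin, env_comp_fin, inc_wL, inc_unitL, inc_unitL]
    exact env_lam f u)

theorem unitR_naturality {M M' : Cell a b} (f : M ⟶ M') :
    unitR M ≫ wR (regular b) f = f ≫ unitR M' :=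
  cell_hom_ext fun u => inc_injective _ _ (by
    rw [env_comp_fin, env_comp_fin, inc_wR, inc_unitR, inc_unitR]
    exact env_rho f u)

theorem assocHom_naturality_left {M M' : Cell a b} (f : M ⟶ M') (N : Cell b c) (L : Cell c d) :
    assocHom M N L ≫ wR (bul N L) f = wR L (wR N f) ≫ assocHom M' N L :=
  cell_hom_ext fun u => incR_injective _ _ _ (by
    rw [env_comp_fin, env_comp_fin, incR_assocHom, incR_apply, incL_apply, inc_wR, inc_wR,
      inc_ext_wR, ← (env f).ext_wl, ← incR_apply, incR_assocHom, incL_apply])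

theorem assocHom_naturality_middle (M : Cell a b) (g : N ⟶ N') (L : Cell c d) :
    assocHom M N L ≫ wL M (wR L g) = wR L (wL M g) ≫ assocHom M N' L :=
  cell_hom_ext fun u => incR_injective _ _ _ (by
    rw [env_comp_fin, env_comp_fin, incR_assocHom, incR_apply, incL_apply, inc_wL, inc_wR,
      inc_ext_wL, ← incL_apply, ← incR_assocHom, incR_apply, wl_wl, wl_wl]
    exact wl_congr _ (inc_wR L g) _)

theorem assocHom_naturality_right (M : Cell a b) (N : Cell b c) (g : L ⟶ L') :
    assocHom M N L ≫ wL M (wL N g) = wL (bul M N) g ≫ assocHom M N L' :=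
  cell_hom_ext fun u => incR_injective _ _ _ (by
    rw [env_comp_fin, env_comp_fin, incR_assocHom, incR_apply, incL_apply, inc_wL, inc_wL,
      (inc M N).ext_wl, ← incL_apply, ← incR_assocHom, incR_apply, wl_wl, wl_wl]
    exact wl_congr _ (inc_wL N g) _)

/-- Inside $M\otimes B\otimes N$ this is the equation $\rho_M\otimes1=1\otimes\lambda_N$ that
defines $M\bullet N$. -/
theorem assocHom_unit (M : Cell a b) (N : Cell b c) :
    wR N (unitR M) ≫ assocHom M (regular b) N = wL M (unitL N) :=
  cell_hom_ext fun u => incR_injective _ _ _ (by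
    rw [env_comp_fin, incR_assocHom, incR_apply, incL_apply, inc_wR, inc_wL, inc_ext_unitR, wl_wl]
    exact (inc_equalizes M N u).trans (wl_congr _ (fun v => (inc_unitL N v).symm) _))

/-- All five associativity maps are induced by the identity of $M\otimes N\otimes L\otimes K$, into
which the target embeds. -/
theorem assocHom_pentagon (M : Cell a b) (N : Cell b c) (L : Cell c d) (K : Cell d e) :
    wR K (assocHom M N L) ≫ assocHom M (bul N L) K ≫ wL M (assocHom N L K) =
      assocHom (bul M N) L K ≫ assocHom M N (bul L K) :=
  cell_hom_ext fun u => inc_injective _ _ (wl_injective M.toEnvAlg (incR_injective N L K) (by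
    rw [env_comp_fin, env_comp_fin, env_comp_fin, inc_wL, wl_wl]
    refine (wl_congr _ (incR_assocHom N L K) _).trans ?_
    rw [incL, ← wl_wl, ← incR_apply, incR_assocHom, incL_apply, inc_wR, incR_ext_assocHom,
      incR, ← wl_wl, ← incR_apply, incR_assocHom, incL_apply, ← (inc M N).ext_wl, ← incR_apply,
      incR_assocHom, incL_apply]))

theorem wL_bul (M : Cell a b) (N : Cell b c) (g : L ⟶ L') :
    wL (bul M N) g = (assoc M N L).hom ≫ wL M (wL N g) ≫ (assoc M N L').inv := by
  rw [← Category.assoc, Iso.eq_comp_inv]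
  exact (assocHom_naturality_right M N g).symm

theorem wR_wL (M : Cell a b) (g : N ⟶ N') (L : Cell c d) :
    wR L (wL M g) = (assoc M N L).hom ≫ wL M (wR L g) ≫ (assoc M N' L).inv := by
  rw [← Category.assoc, Iso.eq_comp_inv]
  exact (assocHom_naturality_middle M g L).symm

end Naturality

/-- The bicategory uses the inverses of the unit maps; the triangle follows from `assocHom_unit` by
cancelling invertible whiskerings. -/
theorem unit_triangle (M : Cell a b) (N : Cell b c) :
    assocHom M (regular b) N ≫ wL M (unitLIso N).inv = wR N (unitRIso M).inv := by
  have hL : wL M (unitL N) ≫ wL M (unitLIso N).inv = 𝟙 _ := by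
    rw [← wL_comp, ← wL_id]
    exact congrArg (wL M) (unitLIso N).hom_inv_id
  have hR : wR N (unitRIso M).inv ≫ wR N (unitR M) = 𝟙 _ := by
    rw [← wR_comp, ← wR_id]
    exact congrArg (wR N) (unitRIso M).inv_hom_id
  rw [← Category.comp_id (wR N (unitRIso M).inv), ← hL, ← assocHom_unit, Category.assoc,
    ← Category.assoc, hR, Category.id_comp]

variable (k) in
/-- The bicategory of bialgebroids, comodule algebras and maps of comodule algebras. -/
noncomputable def bicategory : BicategoryOn (Obj.{u, v} k) Cell where
  id := regular
  comp := bul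
  whiskerLeft M _ _ g := wL M g
  whiskerRight f N := wR N f
  associator := assoc
  leftUnitor M := (unitLIso M).symm
  rightUnitor M := (unitRIso M).symm
  whiskerLeft_id := wL_id
  whiskerLeft_comp M _ _ _ f g := wL_comp M f g
  id_whiskerLeft f := (Iso.eq_inv_comp (unitLIso _)).2 (unitL_naturality f)
  comp_whiskerLeft M N _ _ g := wL_bul M N g
  id_whiskerRight := wR_id
  comp_whiskerRight f g N := wR_comp f g N
  whiskerRight_id f := (Iso.eq_inv_comp (unitRIso _)).2 (unitR_naturality f)
  whiskerRight_comp f N L :=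
    (Iso.eq_inv_comp (assoc _ N L)).2 (assocHom_naturality_left f N L)
  whisker_assoc M _ _ g L := wR_wL M g L
  whisker_exchange f g := wL_wR f g
  pentagon := assocHom_pentagon
  triangle := unit_triangle

end Cells

section Cells

variable {k : Type u} [CommRing k] {a b c d : Obj.{u, v} k}

/-! ### The explicit description -/

theorem bimap_id_id {R S T : Type v} [Ring R] [Algebra k R] [Ring S] [Algebra k S] [Ring T]
    [Algebra k T] (X : EnvAlg k R S) (Y : EnvAlg k S T) (w : (X ⊠ Y.last).carrier) :
    bimap (P := Y.last) (P' := Y.last) (AlgHom.id k X) (AlgHom.id k Y) w = w := by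
  induction w using tm_induction with
  | h0 => rw [map_zero]
  | h1 x y => rfl
  | h2 a b ha hb => rw [map_add, ha, hb]

theorem isRegular_regular (a : Obj.{u, v} k) :
    IsRegular (regular a).toComodAlg (AlgEquiv.refl : a.bialgebroid.carrier ≃ₐ[k] _) where
  map_η _ := rfl
  coact x u w hu hw := by
    have hw : cls (a.bialgebroid.toEnvAlg ⊠ a.bialgebroid.last) w =
      a.bialgebroid.com.fin (cls a.bialgebroid.last x) := hw
    refine (congrArg _ (ext_bimap_id _ _ _ u)).trans (hu.trans ?_)
    refine (a.bialgebroid.regularCoactions.coact_eq x).trans ?_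
    refine Eq.trans ?_ (rext_eq a.bialgebroid.toEnvAlg a.bialgebroid.com w).symm
    rw [hw]
    exact a.bialgebroid.com_coassoc _

theorem cls_bimap_hom_right (M : Cell a b) {N N' : Cell b c} (g : N ⟶ N')
    (w : (M.toEnvAlg ⊠ N.last).carrier) :
    cls (M.toEnvAlg ⊠ N'.last)
        (bimap (P := N.last) (P' := N'.last) (AlgHom.id k M.carrier) (hom g) w) =
      wl M.toEnvAlg (env g).fin (cls (M.toEnvAlg ⊠ N.last) w) := by
  induction w using tm_induction with
  | h0 => simp only [map_zero]
  | h1 x y =>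
    rw [← ten_cls, wl_ten, (env g).fin_cls, ten_cls]
    rfl
  | h2 a b ha hb => simp only [map_add, ha, hb]

theorem cls_bimap_hom_left {M M' : Cell a b} (f : M ⟶ M') (N : Cell b c)
    (w : (M.toEnvAlg ⊠ N.last).carrier) :
    cls (M'.toEnvAlg ⊠ N.last)
        (bimap (P := N.last) (P' := N.last) (hom f) (AlgHom.id k N.carrier) w) =
      (env f).ext N.last (cls (M.toEnvAlg ⊠ N.last) w) := by
  induction w using tm_induction with
  | h0 => simp only [map_zero]
  | h1 x y =>
    rw [← ten_cls, (env f).ext_ten, ten_cls]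
    rfl
  | h2 a b ha hb => simp only [map_add, ha, hb]

theorem toQuo_wL (M : Cell a b) {N N' : Cell b c} (g : N ⟶ N') (p : (bul M N).carrier)
    (w : (M.toEnvAlg ⊠ N.last).carrier) (hw : cls _ w = toQuo (inc M N).toAlg p) :
    toQuo (inc M N').toAlg (hom (wL M g) p) = cls (M.toEnvAlg ⊠ N'.last)
      (bimap (P := N.last) (P' := N'.last) (AlgHom.id k M.carrier) (hom g) w) := by
  rw [cls_bimap_hom_right, hw]
  exact inc_wL M g (cls _ p)

theorem toQuo_wR {M M' : Cell a b} (f : M ⟶ M') (N : Cell b c) (p : (bul M N).carrier)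
    (w : (M.toEnvAlg ⊠ N.last).carrier) (hw : cls _ w = toQuo (inc M N).toAlg p) :
    toQuo (inc M' N).toAlg (hom (wR N f) p) = cls (M'.toEnvAlg ⊠ N.last)
      (bimap (P := N.last) (P' := N.last) (hom f) (AlgHom.id k N.carrier) w) := by
  rw [cls_bimap_hom_left, hw]
  exact inc_wR N f (cls _ p)

theorem rext_assoc (M : Cell a b) (N : Cell b c) (L : Cell c d)
    (p : (bul (bul M N) L).carrier) (w : ((bul M N).toEnvAlg ⊠ L.last).carrier)
    (w' : (M.toEnvAlg ⊠ (bul N L).last).carrier)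
    (hw : cls _ w = toQuo (inc (bul M N) L).toAlg p)
    (hw' : cls _ w' = toQuo (inc M (bul N L)).toAlg (hom (assoc M N L).hom p)) :
    rext (bul M N).toEnvAlg L.toEnvAlg M.toEnvAlg N.toEnvAlg (toQuo (inc M N).toAlg) w =
      lext M.toEnvAlg (bul N L).toEnvAlg N.toEnvAlg L.toEnvAlg (toQuo (inc N L).toAlg) w' := by
  rw [rext_eq, lext_eq, hw, hw']
  exact (incR_assocHom M N L (cls _ p)).symm

theorem cls_unitL (M : Cell a b) (m : M.carrier) (w : ((regular a).toEnvAlg ⊠ M.last).carrier)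
    (hw : cls _ w = toQuo (inc (regular a) M).toAlg (hom (unitLIso M).hom m)) :
    cls (a.bialgebroid.toEnvAlg ⊠ M.last) (bimap (P := M.last) (P' := M.last)
      (AlgHom.id k a.bialgebroid.carrier) (AlgHom.id k M.carrier) w) = M.coactL m := by
  refine (congrArg _ (bimap_id_id a.bialgebroid.toEnvAlg M.toEnvAlg w)).trans ?_
  exact hw.trans ((inc_unitL M (cls _ m)).trans (M.lam_cls m))

theorem cls_unitR (M : Cell a b) (m : M.carrier) (w : (M.toEnvAlg ⊠ (regular b).last).carrier)
    (hw : cls _ w = toQuo (inc M (regular b)).toAlg (hom (unitRIso M).hom m)) :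
    cls (M.toEnvAlg ⊠ b.bialgebroid.last) (bimap (P := b.bialgebroid.last)
      (P' := b.bialgebroid.last) (AlgHom.id k M.carrier) (AlgHom.id k b.bialgebroid.carrier) w) =
      M.coactR m := by
  refine (congrArg _ (bimap_id_id M.toEnvAlg b.bialgebroid.toEnvAlg w)).trans ?_
  exact hw.trans ((inc_unitR M (cls _ m)).trans (M.rho_cls m))

end Cells

end Takeuchi

open Takeuchi
theorem theorem23 (k : Type u) [CommRing k] :
    ∃ (S : BicategoryOn (Obj.{u, v} k) Cell)
      (κ : ∀ a : Obj.{u, v} k, (S.id a).carrier ≃ₐ[k] a.bialgebroid.carrier)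
      (ι : ∀ {a b c : Obj.{u, v} k} (M : Cell a b) (N : Cell b c),
        (S.comp M N).carrier →ₐ[k] Tak (M.toEnvAlg ⊠ N.last)),
      (∀ a, IsRegular (S.id a).toComodAlg (κ a)) ∧
      (∀ {a b c : Obj.{u, v} k} (M : Cell a b) (N : Cell b c),
        IsBullet M.toComodAlg N.toComodAlg (S.comp M N).toComodAlg (ι M N)) ∧
      (∀ {a b c : Obj.{u, v} k} (M : Cell a b) {N N' : Cell b c} (g : N ⟶ N')
        (p : (S.comp M N).carrier) (w : (M.toEnvAlg ⊠ N.last).carrier),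
        cls _ w = toQuo (ι M N) p →
          toQuo (ι M N') (hom (S.whiskerLeft M g) p) =
            cls (M.toEnvAlg ⊠ N'.last)
              (bimap (P := N.last) (P' := N'.last) (AlgHom.id k M.carrier) (hom g) w)) ∧
      (∀ {a b c : Obj.{u, v} k} {M M' : Cell a b} (f : M ⟶ M') (N : Cell b c)
        (p : (S.comp M N).carrier) (w : (M.toEnvAlg ⊠ N.last).carrier),
        cls _ w = toQuo (ι M N) p →
          toQuo (ι M' N) (hom (S.whiskerRight f N) p) =
            cls (M'.toEnvAlg ⊠ N.last)
              (bimap (P := N.last) (P' := N.last) (hom f) (AlgHom.id k N.carrier) w)) ∧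
      (∀ {a b c d : Obj.{u, v} k} (M : Cell a b) (N : Cell b c) (L : Cell c d)
        (p : (S.comp (S.comp M N) L).carrier)
        (w : ((S.comp M N).toEnvAlg ⊠ L.last).carrier)
        (w' : (M.toEnvAlg ⊠ (S.comp N L).last).carrier),
        cls _ w = toQuo (ι (S.comp M N) L) p →
        cls _ w' = toQuo (ι M (S.comp N L)) (hom (S.associator M N L).hom p) →
          rext (S.comp M N).toEnvAlg L.toEnvAlg M.toEnvAlg N.toEnvAlg
              (toQuo (ι M N)) w =
            lext M.toEnvAlg (S.comp N L).toEnvAlg N.toEnvAlg L.toEnvAlg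
              (toQuo (ι N L)) w') ∧
      (∀ {a b : Obj.{u, v} k} (M : Cell a b) (m : M.carrier)
        (w : ((S.id a).toEnvAlg ⊠ M.last).carrier),
        cls _ w = toQuo (ι (S.id a) M) (hom (S.leftUnitor M).inv m) →
          cls (a.bialgebroid.toEnvAlg ⊠ M.last)
            (bimap (P := M.last) (P' := M.last) (κ a).toAlgHom (AlgHom.id k M.carrier) w) =
          M.coactL m) ∧
      (∀ {a b : Obj.{u, v} k} (M : Cell a b) (m : M.carrier)
        (w : (M.toEnvAlg ⊠ (S.id b).last).carrier),
        cls _ w = toQuo (ι M (S.id b)) (hom (S.rightUnitor M).inv m) →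
          cls (M.toEnvAlg ⊠ b.bialgebroid.last)
            (bimap (P := (S.id b).last) (P' := b.bialgebroid.last) (AlgHom.id k M.carrier)
              (κ b).toAlgHom w) =
          M.coactR m) := by
  -- The identity 1-cell has the bialgebroid itself as its underlying algebra, so `κ` is the
  -- identity; `ι` is the inclusion of the composite in the Takeuchi product.
  exact ⟨bicategory k, fun _ => AlgEquiv.refl, fun M N => (inc M N).toAlg, isRegular_regular,
    fun M N => (composite M N).isBullet, toQuo_wL, toQuo_wR, rext_assoc, cls_unitL, cls_unitR⟩
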